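/- Let $\mathbb T=\mathbb C^4$ be twistor space and let $\mathbb K\subset\mathbb P(\Lambda^2\mathbb T)=\mathbb P^5$ be the Klein quadric $G(X,X)=X\wedge X=0$, whose points are the lines of $\mathbb P(\mathbb T)$. For symmetric tensors $A,B$ on $\mathbb T$ write $$AB(X,X)=A_{\alpha\gamma}B_{\beta\delta}X^{\beta\gamma}X^{\alpha\delta},\qquad X^{\alpha\beta}=-X^{\beta\alpha},$$ for the Battaglini form. A hyperelliptic curve of genus two is a curve $z^2=f(x,y)$ with $f$ a binary sextic form over $\mathbb C$ with six distinct zeros on $\mathbb P^1$. The curve of a pencil of quadrics $xP+yQ$ in $\mathbb P^5$ is $z^2=\det(xP+yQ)$. An extra involution is an automorphism of order two other than the hyperelliptic involution $z\mapsto -z$. 1. Let $A,B$ be symmetric with $\det(xA+yB)$ having four distinct zeros on $\mathbb P^1$. Consider the lines that meet each of the quadrics $A=0$, $B=0$ in two distinct points such that the two pairs of points are harmonically separated (cross-ratio $-1$). The closure of this set of lines in $\mathbb P(\Lambda^2\mathbb T)$ is the intersection of $\mathbb K$ with the Battaglini quadric $AB(X,X)=0$, and the forms $AB$ and $G$ are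 linearly independent. 2. For all symmetric $A,B$, the sextic $\det(x\,AB+y\,G)$ has six distinct zeros, that is, the pencil spanned by the Battaglini quadric and the Klein quadric has a hyperelliptic curve of genus two, if and only if $\det(xA+yB)$ has four distinct zeros and the Battaglini quadric is non-singular. Call the pair $(A,B)$ general in this case. 3. If $(A,B)$ is general, the curve of the pencil spanned by the Battaglini quadric and the Klein quadric has an extra involution, and one that maps to itself the fibre over the Klein quadric, regarded as a point of the pencil. 4. All such pencils arise. (a) A pencil of quadrics in $\mathbb P(\Lambda^2\mathbb T)$ that contains the Klein quadric and whose curve is of genus two is the pencil spanned by the Klein quadric and the Battaglini quadric of some general pair $(A,B)$ if and only if its curve has an extra involution mapping to itself the fibre over the Klein quadric. (b) Every pencil of quadrics in $\mathbb P^5$ whose curve is of genus two and has an extra involution is projectively equivalent to the pencil spanned by the Klein quadric and the Battaglini quadric of some general pair $(A,B)$. 5. Every hyperelliptic curve of genus two with an extra involution is isomorphic to the curve of the pencil spanned by the Klein quadric and the Battaglini quadric of some general pair $(A,B)$. -/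

import Mathlib

open Polynomial Matrix
open scoped LinearAlgebra.Projectivization

/-! ### Lines in projective twistor space, bivectors, and quadrics

Twistor space is `Fin 4 → ℂ`. A bivector is recorded by its six coordinates
`(X¹², X¹³, X¹⁴, X³⁴, X⁴², X²³)` (indices of twistor space counted from `1`), so the projective space
of bivectors is `ℙ ℂ (Fin 6 → ℂ)`. A quadric is given by a symmetric matrix. -/

/-- The skew matrix `X^{αβ}` with coordinates `x = (X¹², X¹³, X¹⁴, X³⁴, X⁴², X²³)`. -/
def bivector (x : Fin 6 → ℂ) : Matrix (Fin 4) (Fin 4) ℂ :=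
  !![0, x 0, x 1, x 2;
     -x 0, 0, x 5, -x 4;
     -x 1, -x 5, 0, x 3;
     -x 2, x 4, -x 3, 0]

/-- The coordinates of the bivector `p ∧ q`. -/
def plucker (p q : Fin 4 → ℂ) : Fin 6 → ℂ :=
  ![p 0 * q 1 - p 1 * q 0, p 0 * q 2 - p 2 * q 0, p 0 * q 3 - p 3 * q 0,
    p 2 * q 3 - p 3 * q 2, p 3 * q 1 - p 1 * q 3, p 1 * q 2 - p 2 * q 1]

theorem bivector_plucker (p q : Fin 4 → ℂ) :
    bivector (plucker p q) = vecMulVec p q - vecMulVec q p := by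
  ext i j
  fin_cases i <;> fin_cases j <;> simp [bivector, plucker, vecMulVec_apply] <;> ring

/-- The matrix of the Klein form
`G(X, X) = X ∧ X = 2 (X¹² X³⁴ + X¹³ X⁴² + X¹⁴ X²³)` (addition in `Fin 6` is modulo `6`). -/
def kleinMatrix : Matrix (Fin 6) (Fin 6) ℂ :=
  Matrix.of fun i j => if j = i + 3 then 1 else 0

theorem kleinMatrix_form (x : Fin 6 → ℂ) :
    x ⬝ᵥ kleinMatrix *ᵥ x = 2 * (x 0 * x 3 + x 1 * x 4 + x 2 * x 5) := by
  simp [kleinMatrix, dotProduct, mulVec, Fin.sum_univ_six]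
  ring

/-- The bilinear form `(X, Y) ↦ A_{αγ} B_{βδ} X^{βγ} Y^{αδ}` on bivectors, which is symmetric when
`A` and `B` are. On the diagonal it is the Battaglini form `AB(X, X)`. -/
def battagliniForm (A B : Matrix (Fin 4) (Fin 4) ℂ) (x y : Fin 6 → ℂ) : ℂ :=
  ∑ α, ∑ β, ∑ γ, ∑ δ, A α γ * B β δ * bivector x β γ * bivector y α δ

/-- The Gram matrix of the Battaglini form in the coordinates of `bivector`. -/
def battagliniMatrix (A B : Matrix (Fin 4) (Fin 4) ℂ) : Matrix (Fin 6) (Fin 6) ℂ :=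
  Matrix.of fun i j => battagliniForm A B (Pi.single i 1) (Pi.single j 1)

theorem battagliniMatrix_form (A B : Matrix (Fin 4) (Fin 4) ℂ) (x : Fin 6 → ℂ) :
    x ⬝ᵥ battagliniMatrix A B *ᵥ x = battagliniForm A B x x := by
  have hadd : ∀ u v : Fin 6 → ℂ, bivector (u + v) = bivector u + bivector v := by
    intro u v
    ext i j
    fin_cases i <;> fin_cases j <;> simp [bivector] <;> ring
  have hsmul : ∀ (c : ℂ) (u : Fin 6 → ℂ), bivector (c • u) = c • bivector u := by
    intro c u
    ext i j
    fin_cases i <;> fin_cases j <;> simp [bivector]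
  let b : (Fin 6 → ℂ) →ₗ[ℂ] (Fin 6 → ℂ) →ₗ[ℂ] ℂ := LinearMap.mk₂ ℂ (battagliniForm A B)
    (fun u v w => by
      simp only [battagliniForm, hadd, Matrix.add_apply, mul_add, add_mul, Finset.sum_add_distrib])
    (fun c u v => by
      simp only [battagliniForm, hsmul, Matrix.smul_apply, smul_eq_mul, Finset.mul_sum]
      refine Finset.sum_congr rfl fun _ _ => Finset.sum_congr rfl fun _ _ =>
        Finset.sum_congr rfl fun _ _ => Finset.sum_congr rfl fun _ _ => by ring)
    (fun u v w => by
      simp only [battagliniForm, hadd, Matrix.add_apply, mul_add, Finset.sum_add_distrib])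
    (fun c u v => by
      simp only [battagliniForm, hsmul, Matrix.smul_apply, smul_eq_mul, Finset.mul_sum]
      refine Finset.sum_congr rfl fun _ _ => Finset.sum_congr rfl fun _ _ =>
        Finset.sum_congr rfl fun _ _ => Finset.sum_congr rfl fun _ _ => by ring)
  have hM : battagliniMatrix A B = LinearMap.toMatrix₂' ℂ b := by
    ext i j
    rw [LinearMap.toMatrix₂'_apply]
    rfl
  have h := Matrix.toLinearMap₂'_apply' (LinearMap.toMatrix₂' ℂ b) x x
  rw [Matrix.toLinearMap₂'_toMatrix'] at h
  rw [hM, ← h]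
  rfl

/-- The Klein quadric in the projective space of bivectors. -/
def kleinQuadric : Set (ℙ ℂ (Fin 6 → ℂ)) :=
  {P | ∀ x ∈ P.submodule, x ⬝ᵥ kleinMatrix *ᵥ x = 0}

/-- The Battaglini quadric `A_{αγ} B_{βδ} X^{βγ} X^{αδ} = 0`. -/
def battagliniQuadric (A B : Matrix (Fin 4) (Fin 4) ℂ) : Set (ℙ ℂ (Fin 6 → ℂ)) :=
  {P | ∀ x ∈ P.submodule, battagliniForm A B x x = 0}

/-- The classical topology of the projective space of bivectors: the quotient topology from
the space of non-zero bivectors. -/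
noncomputable instance projectiveTopology : TopologicalSpace (ℙ ℂ (Fin 6 → ℂ)) :=
  TopologicalSpace.coinduced
    (fun v : {v : Fin 6 → ℂ // v ≠ 0} => Projectivization.mk ℂ v.1 v.2) inferInstance

/-! ### Harmonic separation -/

/-- The pair of projective points `[r], [s]` separates the pair `[p], [q]` harmonically:
`[p] ≠ [q]`, the four points are collinear, and their cross-ratio is `-1`. (Division by zero
gives `0`, so all four coefficients below are non-zero and the four points are distinct.) -/
def HarmonicallySeparated (p q r s : Fin 4 → ℂ) : Prop :=
  LinearIndependent ℂ ![p, q] ∧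
    ∃ a b c d : ℂ, r = a • p + b • q ∧ s = c • p + d • q ∧ (b * c) / (a * d) = -1

/-- The line through `[p]` and `[q]` meets the quadric `A` exactly in the points `[u]` and `[v]`. -/
def LineMeetsQuadricIn (A : Matrix (Fin 4) (Fin 4) ℂ) (p q u v : Fin 4 → ℂ) : Prop :=
  ∀ w ∈ Submodule.span ℂ {p, q},
    w ⬝ᵥ A *ᵥ w = 0 ↔ w ∈ Submodule.span ℂ {u} ∨ w ∈ Submodule.span ℂ {v}

/-- The set of lines, as points of the projective space of bivectors, that meet each of the
quadrics `A` and `B` in a pair of distinct points, the two pairs being harmonically separated. -/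
def harmonicLines (A B : Matrix (Fin 4) (Fin 4) ℂ) : Set (ℙ ℂ (Fin 6 → ℂ)) :=
  {P | ∃ p q r s : Fin 4 → ℂ, HarmonicallySeparated p q r s ∧
    LineMeetsQuadricIn A p q p q ∧ LineMeetsQuadricIn B p q r s ∧
    P.submodule = Submodule.span ℂ {plucker p q}}

/-! ### Pencils and hyperelliptic curves -/

/-- The characteristic polynomial `det (P + t Q)` of the pencil spanned by `P` and `Q`, that is,
the binary form `det (x P + y Q)` in the affine coordinate `t = y / x`. The member `Q` of the pencil
sits at `t = ∞`. -/
noncomputable def pencilPoly {n : ℕ} (P Q : Matrix (Fin n) (Fin n) ℂ) : ℂ[X] :=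
  (P.map Polynomial.C + (Polynomial.X : ℂ[X]) • Q.map Polynomial.C).det

/-- The polynomial `f`, read as a binary form of degree `d`, has `d` distinct zeros on the projective
line; when its degree drops by one, one of these zeros is `∞`. -/
def HasDistinctZeros (d : ℕ) (f : ℂ[X]) : Prop :=
  Squarefree f ∧ (f.natDegree = d ∨ f.natDegree + 1 = d)

/-- The function field `ℂ(t)[z] / (z² - f(t))` of the curve `z² = f(t)`. When
`HasDistinctZeros 6 f`, the smooth projective curve is the double cover of the projective line
branched at six points, so hyperelliptic of genus two. -/
abbrev CurveField (f : ℂ[X]) : Type :=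
  AdjoinRoot ((Polynomial.X : (RatFunc ℂ)[X]) ^ 2 -
    Polynomial.C (algebraMap ℂ[X] (RatFunc ℂ) f))

/-- The function `t` on the curve `z² = f(t)`. -/
noncomputable def curveT (f : ℂ[X]) : CurveField f := AdjoinRoot.of _ RatFunc.X

/-- The function `z` on the curve `z² = f(t)`. -/
noncomputable def curveZ (f : ℂ[X]) : CurveField f := AdjoinRoot.root _

/-- An extra involution of the curve `z² = f(t)`: an automorphism of order two (of the function field
over `ℂ`, equivalently of the smooth projective curve), other than the hyperelliptic
involution `(t, z) ↦ (t, -z)`. -/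
def IsExtraInvolution (f : ℂ[X]) (σ : CurveField f ≃ₐ[ℂ] CurveField f) : Prop :=
  orderOf σ = 2 ∧ ¬ (σ (curveT f) = curveT f ∧ σ (curveZ f) = -curveZ f)

/-- The curve `z² = f(t)` has an extra involution. -/
def HasExtraInvolution (f : ℂ[X]) : Prop :=
  ∃ σ : CurveField f ≃ₐ[ℂ] CurveField f, IsExtraInvolution f σ

/-- The curve `z² = f(t)` has an extra involution that preserves the fibre over `t = ∞`: it acts on
the `t`-line by an affine map. For `f = pencilPoly P Q` this says that it preserves the fibre over
the member `Q` of the pencil. -/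
def HasExtraInvolutionFixingInfinity (f : ℂ[X]) : Prop :=
  ∃ σ : CurveField f ≃ₐ[ℂ] CurveField f, IsExtraInvolution f σ ∧
    ∃ a b : ℂ, σ (curveT f) = algebraMap ℂ (CurveField f) a * curveT f + algebraMap ℂ (CurveField f) b

/-- A general pair of quadrics in twistor space: `A` and `B` are symmetric, the four zeros
of `det (x A + y B)` are distinct (so the quadrics meet in a smooth elliptic curve), and
the Battaglini quadric is non-singular. -/
def IsGeneralPair (A B : Matrix (Fin 4) (Fin 4) ℂ) : Prop :=
  A.IsSymm ∧ B.IsSymm ∧ HasDistinctZeros 4 (pencilPoly A B) ∧ (battagliniMatrix A B).det ≠ 0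

/-! ### Products of linear forms -/

/-! One determinant governs everything about the sextic. A pair with four distinct characteristic
roots (a i : b i) is simultaneously diagonalizable (`exists_simultaneous_diagonalization`). In such
coordinates AB is diagonal with entries -(a i * b j + a j * b i), while G couples each Plücker
coordinate only to the complementary one. So the determinant splits into three 2 × 2 blocks, and
det(AB + tG) = ∏ (θ_k - t²) with θ = `resolventRoots`. Up to sign and a shift the θ_k are the roots
of the resolvent cubic of the quartic det(A + sB). Written in the coefficients of the quartic, the
identity extends to all symmetric pairs by analytic continuation (`det_battaglini_pencil`). The
differences of the θ_k are products of differences of the roots of the quartic, and ∏ θ_k = det AB,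
which yields the criterion for six distinct zeros. Evenness in t yields the involution (t, z) ↦ (-t,
z).

Conversely, an involution of a curve of genus two acts on t by a Möbius transformation
(`exists_moebius`). Once its fixed points are moved to 0 and ∞ the sextic becomes even
(`exists_moebiusProd_eq_evenSextic`). Any three distinct non-zero θ_k come from an explicit diagonal
pair (`exists_isGeneralPair`). Pencils with the same distinct characteristic roots are congruent,
which settles projective equivalence, and equal sextics up to a scalar give isomorphic curves. If
the Klein quadric itself must be kept, the comparison of two pencils is, up to signs of the basis
vectors, an isometry of G and a product of exactly six reflections. Each reflection is induced by a
correlation of twistor space, so the product is induced by a collineation, and this acts on the pair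
(A, B) (`exists_bivectorMap_of_orthonormal`).

For the closure, AB on p ∧ q is minus the apolarity invariant of the two binary quadratic forms cut
out by A and B on the line. Its vanishing means harmonic separation as long as both discriminants
are non-zero. The remaining lines are limits of such ones (`mem_closure_of_exists_generic`): the
line is deformed towards a generic one and corrected by a small root of a quadratic equation so as
to stay in the complex. The resultants with the discriminants are entire in the parameter and not
identically zero, so they vanish for no small non-zero parameter. -/

theorem linearFactor_ne_zero {a b : ℂ} (h : ¬(a = 0 ∧ b = 0)) : (C a + C b * X : ℂ[X]) ≠ 0 := by
  intro h0
  apply h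
  have h1 := congrArg (fun p => p.coeff 0) h0
  have h2 := congrArg (fun p => p.coeff 1) h0
  simp at h1 h2
  exact ⟨h1, h2⟩

theorem natDegree_linearFactor (a b : ℂ) :
    (C a + C b * X : ℂ[X]).natDegree = if b = 0 then 0 else 1 := by
  split_ifs with h
  · simp [h]
  · rw [add_comm]; exact natDegree_linear h

theorem squarefree_linearFactor {a b : ℂ} (h : ¬(a = 0 ∧ b = 0)) :
    Squarefree (C a + C b * X : ℂ[X]) := by
  by_cases hb : b = 0
  · subst hb
    have ha : a ≠ 0 := fun ha => h ⟨ha, rfl⟩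
    have : IsUnit (C a : ℂ[X]) := isUnit_C.2 (isUnit_iff_ne_zero.2 ha)
    simpa using this.squarefree
  · have : Irreducible (C a + C b * X : ℂ[X]) := by
      apply irreducible_of_degree_eq_one
      rw [add_comm]; exact degree_linear hb
    exact this.squarefree

theorem isCoprime_linearFactor {a b a' b' : ℂ} (h : a * b' - a' * b ≠ 0) :
    IsCoprime (C a + C b * X : ℂ[X]) (C a' + C b' * X) := by
  refine ⟨C (b' / (a * b' - a' * b)), C (-b / (a * b' - a' * b)), ?_⟩
  have : (1 : ℂ[X]) = C (b' / (a * b' - a' * b) * a + -b / (a * b' - a' * b) * a') := by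
    rw [show b' / (a * b' - a' * b) * a + -b / (a * b' - a' * b) * a' =
      (a * b' - a' * b) / (a * b' - a' * b) by ring,
      div_self h, C_1]
  rw [this]
  have h2 : b' / (a * b' - a' * b) * b + -b / (a * b' - a' * b) * b' = 0 := by ring
  calc _ = C (b' / (a * b' - a' * b) * a + -b / (a * b' - a' * b) * a') +
        C (b' / (a * b' - a' * b) * b + -b / (a * b' - a' * b) * b') * X := by
        simp only [C_add, C_mul]; ring
    _ = _ := by rw [h2]; simp

/-- The product of the linear forms `a i + b i t`. -/
noncomputable def linearProd {d : ℕ} (a b : Fin d → ℂ) : ℂ[X] := ∏ i, (C (a i) + C (b i) * X)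

theorem eval_linearProd {d : ℕ} (a b : Fin d → ℂ) (t : ℂ) :
    (linearProd a b).eval t = ∏ i, (a i + b i * t) := by
  simp [linearProd, eval_prod]

/-- The zeros of a product of linear forms are pairwise distinct points of the projective line. -/
def PairwiseIndependent {d : ℕ} (a b : Fin d → ℂ) : Prop :=
  ∀ i j, i ≠ j → a i * b j - a j * b i ≠ 0

theorem PairwiseIndependent.ne_zero {d : ℕ} (hd : 2 ≤ d) {a b : Fin d → ℂ}
    (h : PairwiseIndependent a b) (i : Fin d) : ¬(a i = 0 ∧ b i = 0) := by
  rintro ⟨h1, h2⟩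
  have : Nontrivial (Fin d) := Fin.nontrivial_iff_two_le.2 hd
  obtain ⟨j, hj⟩ := exists_ne i
  exact h i j hj.symm (by rw [h1, h2]; ring)

theorem natDegree_linearProd_le {d : ℕ} (a b : Fin d → ℂ) :
    (linearProd a b).natDegree ≤ (Finset.univ.filter fun i => b i ≠ 0).card := by
  refine (natDegree_prod_le _ _).trans ?_
  simp only [natDegree_linearFactor]
  rw [Finset.card_filter]
  exact Finset.sum_le_sum fun i _ => by by_cases h : b i = 0 <;> simp [h]

theorem hasDistinctZeros_linearProd_iff {d : ℕ} (hd : 2 ≤ d) (a b : Fin d → ℂ) :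
    HasDistinctZeros d (linearProd a b) ↔ PairwiseIndependent a b := by
  constructor
  · rintro ⟨hsq, hdeg⟩
    -- A factor proportional to another one and of degree one would divide the product twice, so
    -- proportional factors must be constants.
    have key : ∀ i j, i ≠ j → a i * b j - a j * b i = 0 → b i = 0 := by
      intro i j hij h0
      by_contra hb
      have hdvd : (C (a i) + C (b i) * X : ℂ[X]) * (C (a j) + C (b j) * X) ∣ linearProd a b := by
        have := Finset.prod_dvd_prod_of_subset {i, j} Finset.univ
          (fun i => (C (a i) + C (b i) * X : ℂ[X])) (Finset.subset_univ _)
        rwa [Finset.prod_pair hij] at this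
      have hprop : (C (a j) + C (b j) * X : ℂ[X]) = C (b j / b i) * (C (a i) + C (b i) * X) := by
        rw [mul_add, ← mul_assoc, ← C_mul, ← C_mul]
        congr 2
        · field_simp; linear_combination -h0
        · field_simp
      have hu := hsq (C (a i) + C (b i) * X) (dvd_trans ⟨C (b j / b i), by rw [hprop]; ring⟩ hdvd)
      have := natDegree_eq_zero_of_isUnit hu
      rw [natDegree_linearFactor, if_neg hb] at this
      exact one_ne_zero this
    intro i j hij h0
    have hi := key i j hij h0
    have hj := key j i hij.symm (by linear_combination -h0)
    have h1 := natDegree_linearProd_le a b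
    -- Two constant factors lower the degree by at least two, a double zero at infinity, whereas
    -- only a drop by one is allowed.
    have h2 : (Finset.univ.filter fun i => b i ≠ 0).card + 2 ≤ d := by
      have h3 : (Finset.univ.filter fun i => b i ≠ 0) ⊆ Finset.univ \ {i, j} := by
        intro k hk
        simp only [Finset.mem_filter, Finset.mem_univ, true_and] at hk
        simp only [Finset.mem_sdiff, Finset.mem_univ, true_and, Finset.mem_insert,
          Finset.mem_singleton]
        rintro (rfl | rfl)
        · exact hk hi
        · exact hk hj
      have h4 := Finset.card_le_card h3
      rw [Finset.card_sdiff_of_subset (Finset.subset_univ _), Finset.card_pair hij] at h4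
      rw [Finset.card_univ, Fintype.card_fin] at h4
      omega
    omega
  · intro h
    refine ⟨?_, ?_⟩
    · refine Finset.squarefree_prod_of_pairwise_isCoprime ?_
        (fun i _ => squarefree_linearFactor (h.ne_zero hd i))
      intro i _ j _ hij
      exact (isCoprime_linearFactor (h i j hij)).isRelPrime
    · rw [linearProd, natDegree_prod _ _ fun i _ => linearFactor_ne_zero (h.ne_zero hd i)]
      simp only [natDegree_linearFactor]
      have h1 : ∑ i, (if b i = 0 then 0 else 1) + (Finset.univ.filter fun i => b i = 0).card = d := by
        rw [Finset.card_filter, ← Finset.sum_add_distrib]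
        rw [Finset.sum_congr rfl (g := fun _ => 1) (fun i _ => by split_ifs <;> rfl)]
        simp
      have h2 : (Finset.univ.filter fun i => b i = 0).card ≤ 1 := by
        rw [Finset.card_le_one]
        intro i hi j hj
        simp only [Finset.mem_filter, Finset.mem_univ, true_and] at hi hj
        by_contra hij
        exact h i j hij (by rw [hi, hj]; ring)
      omega

theorem exists_eq_C_mul_linearProd (d : ℕ) (f : ℂ[X]) (hf : f.natDegree ≤ d) :
    ∃ (c : ℂ) (a b : Fin d → ℂ), f = C c * linearProd a b := by
  induction d generalizing f with
  | zero =>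
    exact ⟨f.coeff 0, 0, 0, by rw [linearProd, Fin.prod_univ_zero, mul_one]
                               exact eq_C_of_natDegree_le_zero hf⟩
  | succ d ih =>
    by_cases h0 : f.natDegree = 0
    · obtain ⟨c, a, b, h⟩ := ih f (by omega)
      -- Missing degree is filled up by the constant factor 1 + 0 · t, a zero at infinity.
      refine ⟨c, Fin.cons 1 a, Fin.cons 0 b, ?_⟩
      rw [linearProd, Fin.prod_univ_succ]
      simpa [linearProd] using h
    · obtain ⟨r, hr⟩ := IsAlgClosed.exists_root f (by
        intro h; exact h0 (natDegree_eq_of_degree_eq_some h))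
      obtain ⟨g, hg⟩ := dvd_iff_isRoot.2 hr
      have hg0 : g ≠ 0 := by rintro rfl; simp [hg] at h0
      have hd : g.natDegree ≤ d := by
        rw [hg, natDegree_mul (X_sub_C_ne_zero r) hg0, natDegree_X_sub_C] at hf
        omega
      obtain ⟨c, a, b, h⟩ := ih g hd
      refine ⟨c, Fin.cons (-r) a, Fin.cons 1 b, ?_⟩
      rw [linearProd, Fin.prod_univ_succ]
      simp only [Fin.cons_zero, Fin.cons_succ]
      rw [hg, h, linearProd]
      simp
      ring

theorem exists_eq_linearProd {d : ℕ} (f : ℂ[X]) (hf : f.natDegree ≤ d + 1) :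
    ∃ a b : Fin (d + 1) → ℂ, f = linearProd a b := by
  obtain ⟨c, a, b, h⟩ := exists_eq_C_mul_linearProd _ f hf
  refine ⟨Fin.cons (c * a 0) (fun i => a i.succ), Fin.cons (c * b 0) (fun i => b i.succ), ?_⟩
  rw [h, linearProd, linearProd, Fin.prod_univ_succ, Fin.prod_univ_succ]
  simp
  ring

theorem HasDistinctZeros.natDegree_le {d : ℕ} {f : ℂ[X]} (h : HasDistinctZeros d f) :
    f.natDegree ≤ d := by
  have := h.2
  omega

/-! ### Simultaneous diagonalization -/

theorem eval_pencilPoly {n : ℕ} (P Q : Matrix (Fin n) (Fin n) ℂ) (t : ℂ) :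
    (pencilPoly P Q).eval t = (P + t • Q).det := by
  rw [pencilPoly, ← coe_evalRingHom, RingHom.map_det]
  congr 1
  ext i j
  simp
  ring

theorem natDegree_pencilPoly_le {n : ℕ} (P Q : Matrix (Fin n) (Fin n) ℂ) :
    (pencilPoly P Q).natDegree ≤ n := by
  have := natDegree_det_X_add_C_le Q P
  rw [add_comm] at this
  simpa [pencilPoly] using this

/-- Homogenization: for x ≠ 0 the factor x ^ n is pulled out, and the member at infinity, x = 0,
follows by continuity. -/
theorem det_pencil_eq_prod {n : ℕ} {P Q : Matrix (Fin n) (Fin n) ℂ} {c : ℂ} {a b : Fin n → ℂ}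
    (h : pencilPoly P Q = C c * linearProd a b) (x y : ℂ) :
    (x • P + y • Q).det = c * ∏ i, (a i * x + b i * y) := by
  have h1 : ∀ x : ℂ, x ≠ 0 → (x • P + y • Q).det = c * ∏ i, (a i * x + b i * y) := by
    intro x hx
    have h2 := congrArg (eval (y / x)) h
    rw [eval_pencilPoly, eval_mul, eval_linearProd, eval_C] at h2
    have h3 : x • P + y • Q = x • (P + (y / x) • Q) := by
      rw [smul_add, smul_smul]; congr 2; field_simp
    rw [h3, det_smul, h2, Fintype.card_fin]
    have : ∏ i, (a i * x + b i * y) = x ^ n * ∏ i, (a i + b i * (y / x)) := by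
      have : x ^ n = ∏ _i : Fin n, x := by simp
      rw [this, ← Finset.prod_mul_distrib]
      refine Finset.prod_congr rfl fun i _ => ?_
      field_simp
    rw [this]; ring
  have h2 : Set.EqOn (fun x : ℂ => (x • P + y • Q).det)
      (fun x : ℂ => c * ∏ i, (a i * x + b i * y)) {0}ᶜ := fun x hx => h1 x hx
  have h3 : Continuous fun x : ℂ => (x • P + y • Q).det :=
    Continuous.matrix_det (by fun_prop)
  have h4 : Continuous fun x : ℂ => c * ∏ i, (a i * x + b i * y) := by fun_prop
  exact congrFun (h3.ext_on (dense_compl_singleton 0) h4 h2) x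

theorem Matrix.IsSymm.dotProduct_mulVec_comm {n : ℕ} {P : Matrix (Fin n) (Fin n) ℂ} (hP : P.IsSymm)
    (u v : Fin n → ℂ) : u ⬝ᵥ P *ᵥ v = v ⬝ᵥ P *ᵥ u := by
  rw [dotProduct_mulVec, ← mulVec_transpose, hP.eq, dotProduct_comm]

theorem transpose_mul_mul_apply {n : ℕ} (V P : Matrix (Fin n) (Fin n) ℂ) (i j : Fin n) :
    (Vᵀ * P * V) i j = V.col i ⬝ᵥ P *ᵥ V.col j := by
  rw [Matrix.mul_assoc, Matrix.mul_apply]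
  simp only [dotProduct, mulVec, Matrix.mul_apply, transpose_apply, col_apply]

/-- Two symmetric matrices whose pencil has distinct characteristic roots `(a i : b i)` are
simultaneously congruent to the diagonal matrices with entries `a i` and `b i`. -/
theorem exists_simultaneous_diagonalization {n : ℕ} (hn : 2 ≤ n) {P Q : Matrix (Fin n) (Fin n) ℂ}
    (hP : P.IsSymm) (hQ : Q.IsSymm) {c : ℂ} (hc : c ≠ 0) {a b : Fin n → ℂ}
    (hab : PairwiseIndependent a b) (h : pencilPoly P Q = C c * linearProd a b) :
    ∃ V : Matrix (Fin n) (Fin n) ℂ, IsUnit V.det ∧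
      Vᵀ * P * V = diagonal a ∧ Vᵀ * Q * V = diagonal b := by
  -- The singular member b i P - a i Q of the pencil has a kernel, whose vectors will form the
  -- diagonalizing basis.
  have hex : ∀ i, ∃ v : Fin n → ℂ, v ≠ 0 ∧ b i • P *ᵥ v = a i • Q *ᵥ v := by
    intro i
    have h0 : (b i • P + (-a i) • Q).det = 0 := by
      rw [det_pencil_eq_prod h, Finset.prod_eq_zero (Finset.mem_univ i) (by ring), mul_zero]
    obtain ⟨v, hv, hv0⟩ := exists_mulVec_eq_zero_iff.2 h0
    refine ⟨v, hv, ?_⟩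
    rw [add_mulVec, smul_mulVec, smul_mulVec, neg_smul] at hv0
    exact add_neg_eq_zero.1 hv0
  choose v hv0 hv using hex
  have hv' : ∀ i (u : Fin n → ℂ), b i * (u ⬝ᵥ P *ᵥ v i) = a i * (u ⬝ᵥ Q *ᵥ v i) := by
    intro i u
    have := congrArg (fun w => u ⬝ᵥ w) (hv i)
    simpa only [dotProduct_smul, smul_eq_mul] using this
  -- The kernel equations of v i and v j give two linear equations for the numbers v i P v j and v i
  -- Q v j, with determinant ±(a i * b j - a j * b i).
  have horth : ∀ i j, i ≠ j → v i ⬝ᵥ P *ᵥ v j = 0 ∧ v i ⬝ᵥ Q *ᵥ v j = 0 := by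
    intro i j hij
    have h1 := hv' j (v i)
    have h2 := hv' i (v j)
    rw [hP.dotProduct_mulVec_comm, hQ.dotProduct_mulVec_comm] at h2
    have h3 := hab i j hij
    constructor
    · refine (mul_eq_zero.1 ?_).resolve_left h3
      linear_combination a i * h1 - a j * h2
    · refine (mul_eq_zero.1 ?_).resolve_left h3
      linear_combination b i * h1 - b j * h2
  have hf0 : linearProd a b ≠ 0 :=
    Finset.prod_ne_zero_iff.2 fun i _ => linearFactor_ne_zero (hab.ne_zero hn i)
  -- A non-singular member N = P + tQ turns the pencil into the eigenvalue problem of N⁻¹Q, whose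
  -- eigenvalues b i / (a i + b i t) are distinct; hence the v i form a basis.
  obtain ⟨t, ht⟩ : ∃ t, (linearProd a b).eval t ≠ 0 := by
    by_contra! hcon
    exact hf0 (Polynomial.funext (by simpa using hcon))
  have hN : (P + t • Q).det ≠ 0 := by
    rw [← eval_pencilPoly, h, eval_mul, eval_C]
    exact mul_ne_zero hc ht
  have hat : ∀ i, a i + b i * t ≠ 0 := by
    intro i
    rw [eval_linearProd] at ht
    exact (Finset.prod_ne_zero_iff.1 ht) i (Finset.mem_univ i)
  set N := P + t • Q with hNdef
  have hNu : IsUnit N.det := isUnit_iff_ne_zero.2 hN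
  have heig : ∀ i, Module.End.HasEigenvector (toLin' (N⁻¹ * Q)) (b i / (a i + b i * t)) (v i) := by
    intro i
    refine ⟨Module.End.mem_eigenspace_iff.2 ?_, hv0 i⟩
    have h1 : Q *ᵥ v i = (b i / (a i + b i * t)) • N *ᵥ v i := by
      have h2 : b i • N *ᵥ v i = (a i + b i * t) • Q *ᵥ v i := by
        rw [hNdef, add_mulVec, smul_add, hv i, smul_mulVec, smul_smul, add_smul]
      rw [div_eq_inv_mul, mul_smul, h2, smul_smul, inv_mul_cancel₀ (hat i), one_smul]
    rw [toLin'_apply, ← mulVec_mulVec, h1, mulVec_smul, mulVec_mulVec, nonsing_inv_mul _ hNu,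
      one_mulVec]
  have hinj : Function.Injective fun i => b i / (a i + b i * t) := by
    intro i j hij
    by_contra hne
    apply hab i j hne
    simp only at hij
    rw [div_eq_div_iff (hat i) (hat j)] at hij
    linear_combination -hij
  have hli : LinearIndependent ℂ v := Module.End.eigenvectors_linearIndependent' _ _ hinj v heig
  let d : Fin n → ℂ := fun i => v i ⬝ᵥ N *ᵥ v i
  let U : Matrix (Fin n) (Fin n) ℂ := (Matrix.of v)ᵀ
  have hU : IsUnit U.det := by
    rw [← isUnit_iff_isUnit_det]
    exact linearIndependent_cols_iff_isUnit.1 hli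
  have hUN : Uᵀ * N * U = diagonal d := by
    ext i j
    rw [transpose_mul_mul_apply]
    by_cases hij : i = j
    · subst hij; simp [d, U, Matrix.col]; rfl
    · rw [diagonal_apply_ne _ hij]
      change v i ⬝ᵥ N *ᵥ v j = 0
      rw [hNdef, add_mulVec, dotProduct_add, smul_mulVec, dotProduct_smul, (horth i j hij).1,
        (horth i j hij).2, smul_zero, add_zero]
  have hd : ∀ i, d i ≠ 0 := by
    have h1 : (diagonal d).det ≠ 0 := by
      rw [← hUN, det_mul, det_mul, det_transpose]
      exact mul_ne_zero (mul_ne_zero hU.ne_zero hN) hU.ne_zero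
    rw [det_diagonal] at h1
    exact fun i => (Finset.prod_ne_zero_iff.1 h1) i (Finset.mem_univ i)
  -- Dividing v i by k i makes its N-norm equal to a i + b i t. As the P- and Q-norms are in the
  -- ratio a i : b i, they become exactly a i and b i.
  have hl : ∀ i, ∃ k : ℂ, k ^ 2 = d i / (a i + b i * t) := fun i =>
    IsAlgClosed.exists_pow_nat_eq _ two_pos
  choose k hk using hl
  have hk0 : ∀ i, k i ≠ 0 := by
    intro i h0
    have := hk i
    rw [h0] at this
    exact div_ne_zero (hd i) (hat i) (by rw [← this]; simp)
  have hdd : ∀ i, d i = v i ⬝ᵥ P *ᵥ v i + t * (v i ⬝ᵥ Q *ᵥ v i) := by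
    intro i
    simp only [d, hNdef, add_mulVec, dotProduct_add, smul_mulVec, dotProduct_smul, smul_eq_mul]
  let W : Matrix (Fin n) (Fin n) ℂ := U * diagonal fun i => (k i)⁻¹
  have hcol : ∀ i, W.col i = (k i)⁻¹ • v i := by
    intro i
    ext j
    simp [W, U, Matrix.mul_diagonal, mul_comm]
  refine ⟨W, ?_, ?_, ?_⟩
  · rw [det_mul, det_diagonal]
    exact hU.mul (isUnit_iff_ne_zero.2 (Finset.prod_ne_zero_iff.2 fun i _ => inv_ne_zero (hk0 i)))
  all_goals
    ext i j
    rw [transpose_mul_mul_apply, hcol, hcol, mulVec_smul, smul_dotProduct, dotProduct_smul,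
      smul_eq_mul, smul_eq_mul]
    by_cases hij : i = j
    · subst hij
      rw [diagonal_apply_eq]
      have h1 := hk i
      have h2 := hdd i
      have h3 := hv' i (v i)
      rw [eq_div_iff (hat i)] at h1
      have h4 := hk0 i
      have h5 := hat i
      field_simp
      apply mul_right_cancel₀ h5
      first
        | linear_combination h3 * t - a i * h1 - a i * h2
        | linear_combination (-1 : ℂ) * h3 - b i * h1 - b i * h2
    · rw [diagonal_apply_ne _ hij]
      simp [(horth i j hij).1, (horth i j hij).2]

/-! ### Bivectors and the Battaglini form -/

theorem bivector_add (x y : Fin 6 → ℂ) : bivector (x + y) = bivector x + bivector y := by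
  ext i j
  fin_cases i <;> fin_cases j <;> simp [bivector] <;> ring

theorem bivector_smul (c : ℂ) (x : Fin 6 → ℂ) : bivector (c • x) = c • bivector x := by
  ext i j
  fin_cases i <;> fin_cases j <;> simp [bivector]

theorem bivector_transpose (x : Fin 6 → ℂ) : (bivector x)ᵀ = -bivector x := by
  ext i j
  fin_cases i <;> fin_cases j <;> simp [bivector]

/-- The coordinates of a bivector. -/
def bivectorCoords : Matrix (Fin 4) (Fin 4) ℂ →ₗ[ℂ] (Fin 6 → ℂ) where
  toFun X := ![X 0 1, X 0 2, X 0 3, X 2 3, X 3 1, X 1 2]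
  map_add' X Y := by ext i; fin_cases i <;> simp
  map_smul' c X := by ext i; fin_cases i <;> simp

theorem bivectorCoords_bivector (x : Fin 6 → ℂ) : bivectorCoords (bivector x) = x := by
  ext i
  fin_cases i <;> simp [bivectorCoords, bivector]

theorem bivector_injective : Function.Injective bivector :=
  Function.LeftInverse.injective bivectorCoords_bivector

theorem bivector_bivectorCoords {X : Matrix (Fin 4) (Fin 4) ℂ} (hX : Xᵀ = -X) :
    bivector (bivectorCoords X) = X := by
  have h : ∀ i j, X j i = -X i j := fun i j => congrFun (congrFun hX i) j
  have h0 : ∀ i, X i i = 0 := fun i => self_eq_neg.1 (h i i)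
  ext i j
  fin_cases i <;> fin_cases j <;>
    simp [bivectorCoords, bivector, h0, h 0 1, h 0 2, h 0 3, h 2 3, h 1 3, h 1 2]

/-- The action of a matrix on bivectors. -/
def bivectorMap (h : Matrix (Fin 4) (Fin 4) ℂ) : (Fin 6 → ℂ) →ₗ[ℂ] (Fin 6 → ℂ) where
  toFun x := bivectorCoords (h * bivector x * hᵀ)
  map_add' x y := by rw [bivector_add, Matrix.mul_add, Matrix.add_mul, map_add]
  map_smul' c x := by rw [bivector_smul, Matrix.mul_smul, Matrix.smul_mul, map_smul]; rfl

theorem bivector_bivectorMap (h : Matrix (Fin 4) (Fin 4) ℂ) (x : Fin 6 → ℂ) :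
    bivector (bivectorMap h x) = h * bivector x * hᵀ := by
  refine bivector_bivectorCoords ?_
  simp only [transpose_mul, transpose_transpose, bivector_transpose, Matrix.mul_neg,
    Matrix.neg_mul, Matrix.mul_assoc]

theorem battagliniForm_eq_trace (A B : Matrix (Fin 4) (Fin 4) ℂ) (x y : Fin 6 → ℂ) :
    battagliniForm A B x y = trace (bivector x * Aᵀ * bivector y * Bᵀ) := by
  simp only [battagliniForm, trace, Matrix.mul_apply, diag_apply, transpose_apply,
    Finset.sum_mul]
  rw [Finset.sum_comm]
  refine Finset.sum_congr rfl fun β _ => ?_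
  rw [Finset.sum_congr rfl fun α _ => Finset.sum_comm]
  rw [Finset.sum_comm]
  refine Finset.sum_congr rfl fun δ _ => ?_
  refine Finset.sum_congr rfl fun α _ => Finset.sum_congr rfl fun γ _ => ?_
  ring

/-- In the trace form of the Battaglini pairing, cyclicity moves the factors h of h X hᵀ onto A and
B. Changes of basis in twistor space thus act on pairs by congruence. -/
theorem battagliniForm_bivectorMap (A B h : Matrix (Fin 4) (Fin 4) ℂ) (x y : Fin 6 → ℂ) :
    battagliniForm A B (bivectorMap h x) (bivectorMap h y) =
      battagliniForm (hᵀ * A * h) (hᵀ * B * h) x y := by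
  simp only [battagliniForm_eq_trace, bivector_bivectorMap, transpose_mul, transpose_transpose]
  simp only [Matrix.mul_assoc]
  rw [trace_mul_comm]
  simp only [Matrix.mul_assoc]

theorem battagliniMatrix_bilin (A B : Matrix (Fin 4) (Fin 4) ℂ) (x y : Fin 6 → ℂ) :
    x ⬝ᵥ battagliniMatrix A B *ᵥ y = battagliniForm A B x y := by
  let b : (Fin 6 → ℂ) →ₗ[ℂ] (Fin 6 → ℂ) →ₗ[ℂ] ℂ := LinearMap.mk₂ ℂ (battagliniForm A B)
    (fun u v w => by
      simp only [battagliniForm_eq_trace, bivector_add, Matrix.add_mul, trace_add])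
    (fun c u v => by
      simp only [battagliniForm_eq_trace, bivector_smul, Matrix.smul_mul, trace_smul])
    (fun u v w => by
      simp only [battagliniForm_eq_trace, bivector_add, Matrix.add_mul, Matrix.mul_add, trace_add])
    (fun c u v => by
      simp only [battagliniForm_eq_trace, bivector_smul, Matrix.smul_mul, Matrix.mul_smul,
        trace_smul])
  have hM : battagliniMatrix A B = LinearMap.toMatrix₂' ℂ b := by
    ext i j
    rw [LinearMap.toMatrix₂'_apply]
    rfl
  have h := Matrix.toLinearMap₂'_apply' (LinearMap.toMatrix₂' ℂ b) x y
  rw [Matrix.toLinearMap₂'_toMatrix'] at h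
  rw [hM, ← h]
  rfl

theorem kleinMatrix_bilin (x y : Fin 6 → ℂ) : x ⬝ᵥ kleinMatrix *ᵥ y =
    x 0 * y 3 + x 3 * y 0 + (x 1 * y 4 + x 4 * y 1) + (x 2 * y 5 + x 5 * y 2) := by
  simp [kleinMatrix, dotProduct, mulVec, Fin.sum_univ_six]
  ring

theorem Matrix.ext_of_bilin {n : ℕ} {P Q : Matrix (Fin n) (Fin n) ℂ}
    (h : ∀ x y : Fin n → ℂ, x ⬝ᵥ P *ᵥ y = x ⬝ᵥ Q *ᵥ y) : P = Q := by
  ext i j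
  simpa using h (Pi.single i 1) (Pi.single j 1)

theorem battagliniForm_comm {A B : Matrix (Fin 4) (Fin 4) ℂ} (hA : A.IsSymm) (hB : B.IsSymm)
    (x y : Fin 6 → ℂ) : battagliniForm A B x y = battagliniForm A B y x := by
  rw [battagliniForm_eq_trace, battagliniForm_eq_trace, ← trace_transpose]
  simp only [transpose_mul, bivector_transpose, hA.eq, hB.eq]
  rw [trace_mul_comm]
  simp [Matrix.mul_assoc]

theorem battagliniMatrix_isSymm {A B : Matrix (Fin 4) (Fin 4) ℂ} (hA : A.IsSymm) (hB : B.IsSymm) :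
    (battagliniMatrix A B).IsSymm := by
  ext i j
  exact battagliniForm_comm hA hB _ _

theorem kleinMatrix_isSymm : kleinMatrix.IsSymm := by
  ext i j
  fin_cases i <;> fin_cases j <;> simp [kleinMatrix]

theorem kleinMatrix_mul_self : kleinMatrix * kleinMatrix = 1 := by
  ext i j
  fin_cases i <;> fin_cases j <;> simp [kleinMatrix, Matrix.mul_apply, Fin.sum_univ_six]

theorem det_kleinMatrix_ne_zero : kleinMatrix.det ≠ 0 := by
  intro h
  have := congrArg det kleinMatrix_mul_self
  rw [det_mul, h] at this
  simp at this

/-- The Klein form is the wedge product with values in the fourth exterior power, on which h acts by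
its determinant. -/
theorem kleinMatrix_bivectorMap (h : Matrix (Fin 4) (Fin 4) ℂ) (x y : Fin 6 → ℂ) :
    bivectorMap h x ⬝ᵥ kleinMatrix *ᵥ bivectorMap h y = h.det * (x ⬝ᵥ kleinMatrix *ᵥ y) := by
  rw [kleinMatrix_bilin, kleinMatrix_bilin]
  simp only [bivectorMap, bivectorCoords, LinearMap.coe_mk, AddHom.coe_mk, bivector,
    Matrix.mul_apply, Fin.sum_univ_four, transpose_apply, det_succ_row_zero]
  simp [Fin.sum_univ_succ, Fin.succAbove]
  ring

/-- The diagonal coefficients `a i * b j + a j * b i` of the Battaglini form of a diagonal pair,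
in the order of the coordinates of `bivector`. -/
def mixedMinors (a b : Fin 4 → ℂ) : Fin 6 → ℂ :=
  ![a 0 * b 1 + a 1 * b 0, a 0 * b 2 + a 2 * b 0, a 0 * b 3 + a 3 * b 0,
    a 2 * b 3 + a 3 * b 2, a 1 * b 3 + a 3 * b 1, a 1 * b 2 + a 2 * b 1]

theorem battagliniForm_diagonal (a b : Fin 4 → ℂ) (x y : Fin 6 → ℂ) :
    battagliniForm (diagonal a) (diagonal b) x y = -∑ i, mixedMinors a b i * x i * y i := by
  have h : battagliniForm (diagonal a) (diagonal b) x y =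
      ∑ α, ∑ β, a α * b β * bivector x β α * bivector y α β := by
    simp [battagliniForm, diagonal_apply]
  rw [h]
  simp [Fin.sum_univ_four, Fin.sum_univ_six, bivector, mixedMinors]
  ring

theorem battagliniMatrix_diagonal (a b : Fin 4 → ℂ) :
    battagliniMatrix (diagonal a) (diagonal b) = diagonal fun i => -mixedMinors a b i := by
  refine Matrix.ext_of_bilin fun x y => ?_
  rw [battagliniMatrix_bilin, battagliniForm_diagonal, dotProduct, ← Finset.sum_neg_distrib]
  refine Finset.sum_congr rfl fun i _ => ?_
  rw [mulVec_diagonal]; ring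

/-- G couples coordinate i only to i + 3, so after reindexing `Fin 6` as `Fin 2 × Fin 3` the matrix
is block diagonal with blocks of size two. -/
theorem det_diagonal_add_smul_kleinMatrix (d : Fin 6 → ℂ) (t : ℂ) :
    (diagonal d + t • kleinMatrix).det =
      (d 0 * d 3 - t ^ 2) * (d 1 * d 4 - t ^ 2) * (d 2 * d 5 - t ^ 2) := by
  have h : (diagonal d + t • kleinMatrix).submatrix (finProdFinEquiv (m := 2) (n := 3))
      (finProdFinEquiv (m := 2) (n := 3)) = blockDiagonal (fun k : Fin 3 =>
        !![d (finProdFinEquiv (m := 2) (0, k)), t; t, d (finProdFinEquiv (m := 2) (1, k))]) := by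
    ext ⟨i, k⟩ ⟨j, l⟩
    fin_cases i <;> fin_cases j <;> fin_cases k <;> fin_cases l <;>
      simp [blockDiagonal_apply, kleinMatrix, finProdFinEquiv]
  rw [← det_submatrix_equiv_self (finProdFinEquiv (m := 2) (n := 3)), h, det_blockDiagonal,
    Fin.prod_univ_three]
  simp only [det_fin_two_of, ← sq]
  rfl

/-! ### The characteristic polynomial of the pencil of the Battaglini and the Klein quadric -/

/-- The squares of the characteristic roots of the pencil of the Battaglini quadric and the Klein
quadric, for a pair of quadrics with characteristic roots `(a i : b i)`. -/
def resolventRoots (a b : Fin 4 → ℂ) : Fin 3 → ℂ :=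
  ![(a 0 * b 1 + a 1 * b 0) * (a 2 * b 3 + a 3 * b 2),
    (a 0 * b 2 + a 2 * b 0) * (a 1 * b 3 + a 3 * b 1),
    (a 0 * b 3 + a 3 * b 0) * (a 1 * b 2 + a 2 * b 1)]

/-- The six minors of the rows a and b each occur exactly once, up to sign, in these three products.
So the four roots are distinct precisely when the three resolvent roots are. -/
theorem resolventRoots_sub (a b : Fin 4 → ℂ) :
    resolventRoots a b 0 - resolventRoots a b 1 =
        (a 0 * b 3 - a 3 * b 0) * (a 2 * b 1 - a 1 * b 2) ∧
      resolventRoots a b 0 - resolventRoots a b 2 =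
        (a 0 * b 2 - a 2 * b 0) * (a 3 * b 1 - a 1 * b 3) ∧
      resolventRoots a b 1 - resolventRoots a b 2 =
        (a 0 * b 1 - a 1 * b 0) * (a 3 * b 2 - a 2 * b 3) := by
  simp only [resolventRoots, cons_val]
  refine ⟨?_, ?_, ?_⟩ <;> ring

theorem pairwiseIndependent_iff_injective_resolventRoots (a b : Fin 4 → ℂ) :
    PairwiseIndependent a b ↔ Function.Injective (resolventRoots a b) := by
  obtain ⟨h01, h02, h12⟩ := resolventRoots_sub a b
  constructor
  · intro h
    have n01 : resolventRoots a b 0 ≠ resolventRoots a b 1 := sub_ne_zero.1 (by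
      rw [h01]; exact mul_ne_zero (h 0 3 (by decide)) (h 2 1 (by decide)))
    have n02 : resolventRoots a b 0 ≠ resolventRoots a b 2 := sub_ne_zero.1 (by
      rw [h02]; exact mul_ne_zero (h 0 2 (by decide)) (h 3 1 (by decide)))
    have n12 : resolventRoots a b 1 ≠ resolventRoots a b 2 := sub_ne_zero.1 (by
      rw [h12]; exact mul_ne_zero (h 0 1 (by decide)) (h 3 2 (by decide)))
    intro i j hij
    by_contra hne
    fin_cases i <;> fin_cases j <;> first
      | exact hne rfl
      | exact n01 hij
      | exact n02 hij
      | exact n12 hij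
      | exact n01 hij.symm
      | exact n02 hij.symm
      | exact n12 hij.symm
  · intro h
    have n01 := sub_ne_zero.2 (h.ne (show (0 : Fin 3) ≠ 1 by decide))
    have n02 := sub_ne_zero.2 (h.ne (show (0 : Fin 3) ≠ 2 by decide))
    have n12 := sub_ne_zero.2 (h.ne (show (1 : Fin 3) ≠ 2 by decide))
    rw [h01] at n01
    rw [h02] at n02
    rw [h12] at n12
    have m03 := left_ne_zero_of_mul n01
    have m21 := right_ne_zero_of_mul n01
    have m02 := left_ne_zero_of_mul n02
    have m31 := right_ne_zero_of_mul n02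
    have m01 := left_ne_zero_of_mul n12
    have m32 := right_ne_zero_of_mul n12
    intro i j hne
    rw [sub_ne_zero] at *
    fin_cases i <;> fin_cases j <;> first
      | exact absurd rfl hne
      | assumption
      | (apply Ne.symm; assumption)

/-! ### Transport of the pencil to the diagonal form of the pair -/

theorem pencil_bivectorMap (A B V : Matrix (Fin 4) (Fin 4) ℂ) (t : ℂ) :
    (LinearMap.toMatrix' (bivectorMap V))ᵀ * (battagliniMatrix A B + t • kleinMatrix) *
        LinearMap.toMatrix' (bivectorMap V) =
      battagliniMatrix (Vᵀ * A * V) (Vᵀ * B * V) + (t * V.det) • kleinMatrix := by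
  refine Matrix.ext_of_bilin fun x y => ?_
  rw [← mulVec_mulVec, ← mulVec_mulVec, LinearMap.toMatrix'_mulVec, dotProduct_mulVec,
    vecMul_transpose, LinearMap.toMatrix'_mulVec]
  simp only [add_mulVec, dotProduct_add, smul_mulVec, dotProduct_smul, battagliniMatrix_bilin,
    battagliniForm_bivectorMap, kleinMatrix_bivectorMap, smul_eq_mul]
  ring

theorem det_bivectorMap_sq (V : Matrix (Fin 4) (Fin 4) ℂ) :
    (LinearMap.toMatrix' (bivectorMap V)).det ^ 2 = V.det ^ 6 := by
  have h : (LinearMap.toMatrix' (bivectorMap V))ᵀ * kleinMatrix *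
      LinearMap.toMatrix' (bivectorMap V) = V.det • kleinMatrix := by
    refine Matrix.ext_of_bilin fun x y => ?_
    rw [← mulVec_mulVec, ← mulVec_mulVec, LinearMap.toMatrix'_mulVec, dotProduct_mulVec,
      vecMul_transpose, LinearMap.toMatrix'_mulVec, kleinMatrix_bivectorMap, smul_mulVec,
      dotProduct_smul, smul_eq_mul]
  have h2 := congrArg det h
  rw [det_mul, det_mul, det_transpose, det_smul, Fintype.card_fin] at h2
  apply mul_right_cancel₀ det_kleinMatrix_ne_zero
  linear_combination h2

/-- With no scalar in front of the product, the determinants before and after the congruence agree,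
at a parameter where they are non-zero. -/
theorem det_sq_of_diagonalization {n : ℕ} {P Q V : Matrix (Fin n) (Fin n) ℂ} {a b : Fin n → ℂ}
    (hn : 2 ≤ n) (hab : PairwiseIndependent a b) (h : pencilPoly P Q = linearProd a b)
    (hP : Vᵀ * P * V = diagonal a) (hQ : Vᵀ * Q * V = diagonal b) : V.det ^ 2 = 1 := by
  have hf0 : linearProd a b ≠ 0 :=
    Finset.prod_ne_zero_iff.2 fun i _ => linearFactor_ne_zero (hab.ne_zero hn i)
  obtain ⟨t, ht⟩ : ∃ t, (linearProd a b).eval t ≠ 0 := by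
    by_contra! hcon
    exact hf0 (Polynomial.funext (by simpa using hcon))
  have h1 : Vᵀ * (P + t • Q) * V = diagonal fun i => a i + b i * t := by
    rw [Matrix.mul_add, Matrix.add_mul, Matrix.mul_smul, Matrix.smul_mul, hP, hQ]
    ext i j
    by_cases hij : i = j
    · subst hij; simp [mul_comm]
    · simp [hij]
  have h2 := congrArg det h1
  rw [det_mul, det_mul, det_transpose, det_diagonal, ← eval_linearProd, ← h, eval_pencilPoly] at h2
  rw [← h, eval_pencilPoly] at ht
  apply mul_right_cancel₀ ht
  linear_combination h2

theorem det_battaglini_pencil_of_independent {A B : Matrix (Fin 4) (Fin 4) ℂ} (hA : A.IsSymm)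
    (hB : B.IsSymm) {a b : Fin 4 → ℂ} (hab : PairwiseIndependent a b)
    (h : pencilPoly A B = linearProd a b) (t : ℂ) :
    (battagliniMatrix A B + t • kleinMatrix).det = ∏ k, (resolventRoots a b k - t ^ 2) := by
  obtain ⟨V, -, hVA, hVB⟩ := exists_simultaneous_diagonalization (by norm_num) hA hB one_ne_zero
    hab (by rw [h, C_1, one_mul])
  have hV := det_sq_of_diagonalization (by norm_num) hab h hVA hVB
  have h1 := congrArg det (pencil_bivectorMap A B V t)
  rw [det_mul, det_mul, det_transpose, hVA, hVB, battagliniMatrix_diagonal,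
    det_diagonal_add_smul_kleinMatrix, mul_pow, hV] at h1
  have h2 := det_bivectorMap_sq V
  rw [show V.det ^ 6 = (V.det ^ 2) ^ 3 by ring, hV] at h2
  rw [Fin.prod_univ_three]
  simp only [mixedMinors, resolventRoots, cons_val] at h1 ⊢
  linear_combination h1 - h2 * (battagliniMatrix A B + t • kleinMatrix).det

/-- The coefficients of `det (A + t B)`, by interpolation. -/
noncomputable def quarticCoeffs (A B : Matrix (Fin 4) (Fin 4) ℂ) : Fin 5 → ℂ :=
  -- The values at t = ±1 give the sum `o` of the two odd coefficients and, with the extreme ones,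
  -- the middle coefficient; the value at t = 2 separates the odd ones.
  let o := ((A + B).det - (A + (-1 : ℂ) • B).det) / 2
  let p2 := ((A + B).det + (A + (-1 : ℂ) • B).det) / 2 - A.det - B.det
  let p3 := ((A + (2 : ℂ) • B).det - A.det - 4 * p2 - 16 * B.det - 2 * o) / 6
  ![A.det, o - p3, p2, p3, B.det]

theorem quarticCoeffs_eq {A B : Matrix (Fin 4) (Fin 4) ℂ} {a b : Fin 4 → ℂ}
    (h : pencilPoly A B = linearProd a b) :
    quarticCoeffs A B = ![a 0 * a 1 * a 2 * a 3,
      b 0 * a 1 * a 2 * a 3 + a 0 * b 1 * a 2 * a 3 + a 0 * a 1 * b 2 * a 3 + a 0 * a 1 * a 2 * b 3,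
      b 0 * b 1 * a 2 * a 3 + b 0 * a 1 * b 2 * a 3 + b 0 * a 1 * a 2 * b 3 + a 0 * b 1 * b 2 * a 3 +
        a 0 * b 1 * a 2 * b 3 + a 0 * a 1 * b 2 * b 3,
      a 0 * b 1 * b 2 * b 3 + b 0 * a 1 * b 2 * b 3 + b 0 * b 1 * a 2 * b 3 + b 0 * b 1 * b 2 * a 3,
      b 0 * b 1 * b 2 * b 3] := by
  have hc : pencilPoly A B = C 1 * linearProd a b := by rw [h, C_1, one_mul]
  have h0 := det_pencil_eq_prod hc 1 0
  have h4 := det_pencil_eq_prod hc 0 1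
  have h1 := det_pencil_eq_prod hc 1 1
  have hm := det_pencil_eq_prod hc 1 (-1)
  have h2 := det_pencil_eq_prod hc 1 2
  simp only [one_smul, zero_smul, add_zero, zero_add, Fin.prod_univ_four] at h0 h4 h1 hm h2
  rw [quarticCoeffs, h0, h4, h1, hm, h2]
  ext i
  fin_cases i <;> simp <;> ring

/-- The resolvent cubic of a quartic with coefficients `p`. -/
def resolventCubic (p : Fin 5 → ℂ) (y : ℂ) : ℂ :=
  y ^ 3 - p 2 * y ^ 2 + (p 1 * p 3 - 4 * p 0 * p 4) * y +
    (4 * p 0 * p 2 * p 4 - p 1 ^ 2 * p 4 - p 0 * p 3 ^ 2)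

/-- The discriminant of the resolvent cubic. -/
def resolventDiscr (p : Fin 5 → ℂ) : ℂ :=
  let A := -p 2
  let B := p 1 * p 3 - 4 * p 0 * p 4
  let C := 4 * p 0 * p 2 * p 4 - p 1 ^ 2 * p 4 - p 0 * p 3 ^ 2
  A ^ 2 * B ^ 2 - 4 * B ^ 3 - 4 * A ^ 3 * C - 27 * C ^ 2 + 18 * A * B * C

/-- The classical roots of the resolvent cubic are a₀a₁b₂b₃ + b₀b₁a₂a₃ and its two companions. Each
is the middle coefficient minus one of the resolvent roots, whence the shift by `quarticCoeffs A B
2`. -/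
theorem resolventCubic_eq {A B : Matrix (Fin 4) (Fin 4) ℂ} {a b : Fin 4 → ℂ}
    (h : pencilPoly A B = linearProd a b) (s : ℂ) :
    resolventCubic (quarticCoeffs A B) (quarticCoeffs A B 2 - s) =
      ∏ k, (resolventRoots a b k - s) := by
  rw [quarticCoeffs_eq h, Fin.prod_univ_three]
  simp only [resolventCubic, resolventRoots, cons_val]
  ring

theorem resolventDiscr_eq {A B : Matrix (Fin 4) (Fin 4) ℂ} {a b : Fin 4 → ℂ}
    (h : pencilPoly A B = linearProd a b) :
    resolventDiscr (quarticCoeffs A B) = ((resolventRoots a b 0 - resolventRoots a b 1) *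
      (resolventRoots a b 0 - resolventRoots a b 2) *
      (resolventRoots a b 1 - resolventRoots a b 2)) ^ 2 := by
  set p := quarticCoeffs A B with hp
  have h1 : ∀ s, resolventCubic p s = ∏ k, (resolventRoots a b k - (p 2 - s)) := by
    intro s
    rw [hp, ← resolventCubic_eq h, sub_sub_cancel]
  set u := resolventRoots a b 0
  set v := resolventRoots a b 1
  set w := resolventRoots a b 2
  -- Three values determine a monic cubic: its coefficients are read off as symmetric functions of
  -- the shifted roots, and a discriminant is invariant under shifts.
  have k0 := h1 0
  have k1 := h1 1
  have km := h1 (-1)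
  simp only [resolventCubic, Fin.prod_univ_three] at k0 k1 km
  have e1 : -p 2 = (u + v + w - 3 * p 2) := by linear_combination (k1 + km) / 2 - k0
  have hC : 4 * p 0 * p 2 * p 4 - p 1 ^ 2 * p 4 - p 0 * p 3 ^ 2 =
      (u - p 2) * (v - p 2) * (w - p 2) := by linear_combination k0
  have hB : p 1 * p 3 - 4 * p 0 * p 4 = (u - p 2) * (v - p 2) + (u - p 2) * (w - p 2) +
      (v - p 2) * (w - p 2) := by linear_combination (k1 - km) / 2
  rw [resolventDiscr, hC, hB, e1]
  ring

/-! ### Extension to all symmetric pairs by analytic continuation -/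

theorem differentiable_det {n : ℕ} {N : ℂ → Matrix (Fin n) (Fin n) ℂ}
    (h : ∀ i j, Differentiable ℂ fun z => N z i j) : Differentiable ℂ fun z => (N z).det := by
  simp only [det_apply]
  fun_prop

theorem det_battaglini_pencil_of_resolventDiscr_ne_zero {A B : Matrix (Fin 4) (Fin 4) ℂ}
    (hA : A.IsSymm) (hB : B.IsSymm) (hD : resolventDiscr (quarticCoeffs A B) ≠ 0) (t : ℂ) :
    (battagliniMatrix A B + t • kleinMatrix).det =
      resolventCubic (quarticCoeffs A B) (quarticCoeffs A B 2 - t ^ 2) := by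
  obtain ⟨a, b, h⟩ := exists_eq_linearProd _ (natDegree_pencilPoly_le A B)
  rw [resolventDiscr_eq h] at hD
  have hD' := pow_ne_zero_iff two_ne_zero |>.1 hD
  have n12 := sub_ne_zero.1 (right_ne_zero_of_mul hD')
  have n02 := sub_ne_zero.1 (right_ne_zero_of_mul (left_ne_zero_of_mul hD'))
  have n01 := sub_ne_zero.1 (left_ne_zero_of_mul (left_ne_zero_of_mul hD'))
  rw [resolventCubic_eq h]
  refine det_battaglini_pencil_of_independent hA hB
    ((pairwiseIndependent_iff_injective_resolventRoots a b).2 ?_) h t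
  intro i j hij
  by_contra hne
  fin_cases i <;> fin_cases j <;> first
    | exact hne rfl
    | exact n01 hij
    | exact n02 hij
    | exact n12 hij
    | exact n01 hij.symm
    | exact n02 hij.symm
    | exact n12 hij.symm

theorem differentiable_quarticCoeffs {A B : ℂ → Matrix (Fin 4) (Fin 4) ℂ}
    (hA : ∀ i j, Differentiable ℂ fun z => A z i j) (hB : ∀ i j, Differentiable ℂ fun z => B z i j)
    (k : Fin 5) : Differentiable ℂ fun z => quarticCoeffs (A z) (B z) k := by
  have h0 := differentiable_det hA
  have h4 := differentiable_det hB
  have hs : ∀ c : ℂ, Differentiable ℂ fun z => (A z + c • B z).det := fun c =>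
    differentiable_det fun i j => by
      simp only [Matrix.add_apply, Matrix.smul_apply]
      exact (hA i j).add ((hB i j).const_smul c)
  have h1 : Differentiable ℂ fun z => (A z + B z).det := by simpa using hs 1
  have hm := hs (-1)
  have h2 := hs 2
  have key : ∀ v0 v1 vm v2 v4 : ℂ → ℂ, Differentiable ℂ v0 → Differentiable ℂ v1 →
      Differentiable ℂ vm → Differentiable ℂ v2 → Differentiable ℂ v4 →
      Differentiable ℂ fun z =>
        (let o := (v1 z - vm z) / 2
         let p2 := (v1 z + vm z) / 2 - v0 z - v4 z
         let p3 := (v2 z - v0 z - 4 * p2 - 16 * v4 z - 2 * o) / 6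
         ![v0 z, o - p3, p2, p3, v4 z] : Fin 5 → ℂ) k := by
    intro v0 v1 vm v2 v4 d0 d1 dm d2 d4
    fin_cases k <;> simp <;> fun_prop
  exact key _ _ _ _ _ h0 h1 hm h2 h4

theorem pencilPoly_diagonal {n : ℕ} (a b : Fin n → ℂ) :
    pencilPoly (diagonal a) (diagonal b) = linearProd a b := by
  refine Polynomial.funext fun t => ?_
  rw [eval_pencilPoly, eval_linearProd, ← det_diagonal]
  congr 1
  ext i j
  by_cases hij : i = j
  · subst hij; simp [mul_comm]
  · simp [hij]

/-- The characteristic polynomial of the pencil of the Battaglini and the Klein quadric is the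
resolvent cubic of `det (A + s B)` in `t ^ 2`. -/
theorem det_battaglini_pencil {A B : Matrix (Fin 4) (Fin 4) ℂ} (hA : A.IsSymm) (hB : B.IsSymm)
    (t : ℂ) : (battagliniMatrix A B + t • kleinMatrix).det =
      resolventCubic (quarticCoeffs A B) (quarticCoeffs A B 2 - t ^ 2) := by
  -- A complex line joins (A, B) at z = 0 to a diagonal pair at z = 1 whose resolvent roots 6, 10,
  -- 12 are distinct.
  let A' : ℂ → Matrix (Fin 4) (Fin 4) ℂ := fun z => A + z • (diagonal 1 - A)
  let B' : ℂ → Matrix (Fin 4) (Fin 4) ℂ := fun z => B + z • (diagonal ![0, 1, 2, 4] - B)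
  have hA's : ∀ z, (A' z).IsSymm := fun z =>
    hA.add (((isSymm_diagonal _).sub hA).smul z)
  have hB's : ∀ z, (B' z).IsSymm := fun z =>
    hB.add (((isSymm_diagonal _).sub hB).smul z)
  have hA'd : ∀ i j, Differentiable ℂ fun z => A' z i j := fun i j => by
    simp only [A', Matrix.add_apply, Matrix.smul_apply, smul_eq_mul]
    fun_prop
  have hB'd : ∀ i j, Differentiable ℂ fun z => B' z i j := fun i j => by
    simp only [B', Matrix.add_apply, Matrix.smul_apply, smul_eq_mul]
    fun_prop
  have hq := differentiable_quarticCoeffs hA'd hB'd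
  have hDd : Differentiable ℂ fun z => resolventDiscr (quarticCoeffs (A' z) (B' z)) := by
    simp only [resolventDiscr]
    have q0 := hq 0
    have q1 := hq 1
    have q2 := hq 2
    have q3 := hq 3
    have q4 := hq 4
    fun_prop
  have hMd : Differentiable ℂ fun z => (battagliniMatrix (A' z) (B' z) + t • kleinMatrix).det := by
    refine differentiable_det fun i j => ?_
    simp only [Matrix.add_apply, battagliniMatrix, of_apply, battagliniForm]
    fun_prop
  have hRd : Differentiable ℂ fun z => resolventCubic (quarticCoeffs (A' z) (B' z))
      (quarticCoeffs (A' z) (B' z) 2 - t ^ 2) := by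
    simp only [resolventCubic]
    have q0 := hq 0
    have q1 := hq 1
    have q2 := hq 2
    have q3 := hq 3
    have q4 := hq 4
    fun_prop
  have hD1 : resolventDiscr (quarticCoeffs (A' 1) (B' 1)) ≠ 0 := by
    have h1 : A' 1 = diagonal 1 := by simp [A']
    have h2 : B' 1 = diagonal ![0, 1, 2, 4] := by simp [B']
    rw [h1, h2, resolventDiscr_eq (pencilPoly_diagonal _ _)]
    simp [resolventRoots]
    norm_num
  -- The discriminant is entire in z and non-zero at 1, so its zeros are isolated. The identity
  -- holds on a punctured neighbourhood of 0 and passes to the limit.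
  have hev : ∀ᶠ z in nhdsWithin (0 : ℂ) {0}ᶜ,
      resolventDiscr (quarticCoeffs (A' z) (B' z)) ≠ 0 := by
    by_contra hcon
    have hfr := (Filter.not_eventually.1 hcon).mono fun z hz => not_not.1 hz
    have han : AnalyticOnNhd ℂ (fun z => resolventDiscr (quarticCoeffs (A' z) (B' z))) Set.univ :=
      hDd.differentiableOn.analyticOnNhd isOpen_univ
    exact hD1 (han.eqOn_zero_of_preconnected_of_frequently_eq_zero isPreconnected_univ
      (Set.mem_univ 0) hfr (Set.mem_univ 1))
  have heq : (fun z => (battagliniMatrix (A' z) (B' z) + t • kleinMatrix).det)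
      =ᶠ[nhdsWithin (0 : ℂ) {0}ᶜ] fun z => resolventCubic (quarticCoeffs (A' z) (B' z))
        (quarticCoeffs (A' z) (B' z) 2 - t ^ 2) :=
    hev.mono fun z hz =>
      det_battaglini_pencil_of_resolventDiscr_ne_zero (hA's z) (hB's z) hz t
  have hl := (hMd.continuous.tendsto 0).mono_left (nhdsWithin_le_nhds (s := {0}ᶜ))
  have hr := (hRd.continuous.tendsto 0).mono_left (nhdsWithin_le_nhds (s := {0}ᶜ))
  have := tendsto_nhds_unique (hl.congr' heq) hr
  simpa [A', B'] using this

/-- The sextic with roots the square roots of `θ 0`, `θ 1` and `θ 2`. -/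
noncomputable def evenSextic (c : ℂ) (θ : Fin 3 → ℂ) : ℂ[X] := C c * ∏ k, (X ^ 2 - C (θ k))

/-- No distinctness of the roots is assumed, so the sextic is even for degenerate pairs too. The
sign -1 comes from reversing the three factors θ_k - t². -/
theorem pencilPoly_battagliniMatrix {A B : Matrix (Fin 4) (Fin 4) ℂ} (hA : A.IsSymm)
    (hB : B.IsSymm) {a b : Fin 4 → ℂ} (h : pencilPoly A B = linearProd a b) :
    pencilPoly (battagliniMatrix A B) kleinMatrix = evenSextic (-1) (resolventRoots a b) := by
  refine Polynomial.funext fun t => ?_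
  rw [eval_pencilPoly, det_battaglini_pencil hA hB, resolventCubic_eq h, evenSextic, eval_mul,
    eval_prod, Fin.prod_univ_three, Fin.prod_univ_three]
  simp
  ring

theorem evenSextic_eq {c : ℂ} {τ θ : Fin 3 → ℂ} (h : ∀ k, τ k ^ 2 = θ k) :
    evenSextic c θ =
      C c * linearProd ![-τ 0, -τ 1, -τ 2, τ 0, τ 1, τ 2] ![1, 1, 1, 1, 1, 1] := by
  rw [evenSextic]
  congr 1
  simp [linearProd, Fin.prod_univ_three, Fin.prod_univ_six, ← h]
  ring

theorem pairwiseIndependent_square_roots_iff (τ : Fin 3 → ℂ) :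
    PairwiseIndependent ![-τ 0, -τ 1, -τ 2, τ 0, τ 1, τ 2] ![1, 1, 1, 1, 1, 1] ↔
      Function.Injective (fun k => τ k ^ 2) ∧ ∀ k, τ k ^ 2 ≠ 0 := by
  constructor
  · intro h
    constructor
    · intro i j hij
      by_contra hne
      have h1 := sub_eq_zero.2 hij
      simp only [sq_sub_sq] at h1
      fin_cases i <;> fin_cases j <;> simp at hne h1
      · exact h1.elim (fun e => h 3 1 (by decide) (by simpa using by linear_combination e))
          (fun e => h 3 4 (by decide) (by simpa using by linear_combination e))
      · exact h1.elim (fun e => h 3 2 (by decide) (by simpa using by linear_combination e))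
          (fun e => h 3 5 (by decide) (by simpa using by linear_combination e))
      · exact h1.elim (fun e => h 3 1 (by decide) (by simpa using by linear_combination e))
          (fun e => h 4 3 (by decide) (by simpa using by linear_combination e))
      · exact h1.elim (fun e => h 4 2 (by decide) (by simpa using by linear_combination e))
          (fun e => h 4 5 (by decide) (by simpa using by linear_combination e))
      · exact h1.elim (fun e => h 3 2 (by decide) (by simpa using by linear_combination e))
          (fun e => h 5 3 (by decide) (by simpa using by linear_combination e))
      · exact h1.elim (fun e => h 4 2 (by decide) (by simpa using by linear_combination e))
          (fun e => h 5 4 (by decide) (by simpa using by linear_combination e))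
    · intro k hk
      have hk := pow_eq_zero_iff two_ne_zero |>.1 hk
      fin_cases k <;> simp at hk
      · exact h 3 0 (by decide) (by simp [hk])
      · exact h 4 1 (by decide) (by simp [hk])
      · exact h 5 2 (by decide) (by simp [hk])
  · rintro ⟨hinj, h0⟩ i j hne hij
    have h01 := hinj.ne (show (0 : Fin 3) ≠ 1 by decide)
    have h02 := hinj.ne (show (0 : Fin 3) ≠ 2 by decide)
    have h12 := hinj.ne (show (1 : Fin 3) ≠ 2 by decide)
    have k0 := h0 0
    have k1 := h0 1
    have k2 := h0 2
    generalize τ 0 = u at *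
    generalize τ 1 = v at *
    generalize τ 2 = w at *
    fin_cases i <;> fin_cases j <;> simp at hne hij <;> grind

theorem hasDistinctZeros_C_mul_iff {d : ℕ} {c : ℂ} (hc : c ≠ 0) (f : ℂ[X]) :
    HasDistinctZeros d (C c * f) ↔ HasDistinctZeros d f := by
  have hu : IsUnit (C c : ℂ[X]) := isUnit_C.2 (isUnit_iff_ne_zero.2 hc)
  rw [HasDistinctZeros, HasDistinctZeros, natDegree_C_mul hc]
  have : Associated (C c * f) f := associated_unit_mul_left f _ hu
  rw [this.squarefree_iff]

theorem hasDistinctZeros_evenSextic_iff {c : ℂ} (hc : c ≠ 0) (θ : Fin 3 → ℂ) :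
    HasDistinctZeros 6 (evenSextic c θ) ↔ Function.Injective θ ∧ ∀ k, θ k ≠ 0 := by
  have : ∀ k, ∃ τ : ℂ, τ ^ 2 = θ k := fun k => IsAlgClosed.exists_pow_nat_eq _ two_pos
  choose τ hτ using this
  rw [evenSextic_eq hτ, hasDistinctZeros_C_mul_iff hc,
    hasDistinctZeros_linearProd_iff (by norm_num), pairwiseIndependent_square_roots_iff]
  simp only [hτ]

/-- Six distinct square roots exist exactly when the θ_k are distinct and non-zero. Distinctness is
that of the roots of the quartic; at t = 0 the determinant is ∏ θ_k, so non-vanishing is regularity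
of the Battaglini quadric. -/
theorem hasDistinctZeros_battaglini_pencil_iff {A B : Matrix (Fin 4) (Fin 4) ℂ} (hA : A.IsSymm)
    (hB : B.IsSymm) : HasDistinctZeros 6 (pencilPoly (battagliniMatrix A B) kleinMatrix) ↔
      HasDistinctZeros 4 (pencilPoly A B) ∧ (battagliniMatrix A B).det ≠ 0 := by
  obtain ⟨a, b, h⟩ := exists_eq_linearProd _ (natDegree_pencilPoly_le A B)
  have hdet : (battagliniMatrix A B).det = ∏ k, resolventRoots a b k := by
    have h1 := det_battaglini_pencil hA hB 0
    rw [resolventCubic_eq h] at h1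
    simpa using h1
  rw [pencilPoly_battagliniMatrix hA hB h, hasDistinctZeros_evenSextic_iff (by norm_num), h,
    hasDistinctZeros_linearProd_iff (by norm_num),
    pairwiseIndependent_iff_injective_resolventRoots, hdet, Finset.prod_ne_zero_iff]
  simp

/-! ### The function field of a hyperelliptic curve -/

/-- The square of the denominator of r divides f, being coprime to the numerator. As f is
squarefree, the denominator is a unit and r is a polynomial. -/
theorem dvd_of_algebraMap_mul_sq_eq {f g : ℂ[X]} (hf : Squarefree f) {r : RatFunc ℂ}
    (h : algebraMap ℂ[X] (RatFunc ℂ) f * r ^ 2 = algebraMap ℂ[X] (RatFunc ℂ) g) : f ∣ g := by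
  have hd : r.denom ≠ 0 := r.denom_ne_zero
  have h1 : f * r.num ^ 2 = g * r.denom ^ 2 := by
    apply RatFunc.algebraMap_injective ℂ
    have hd' : algebraMap ℂ[X] (RatFunc ℂ) r.denom ≠ 0 := RatFunc.algebraMap_ne_zero hd
    rw [map_mul, map_mul, map_pow, map_pow, ← h]
    conv_rhs => rw [← RatFunc.num_div_denom r]
    rw [RatFunc.num_div_denom r]
    conv_rhs => rw [← RatFunc.num_div_denom r]
    field_simp
    rw [RatFunc.num_div_denom r]
  have h2 : r.denom ^ 2 ∣ f * r.num ^ 2 := ⟨g, by rw [h1]; ring⟩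
  have h3 : IsCoprime (r.denom ^ 2) (r.num ^ 2) := (RatFunc.isCoprime_num_denom r).symm.pow
  have h4 : IsUnit r.denom := hf _ (by rw [← sq]; exact h3.dvd_of_dvd_mul_right h2)
  obtain ⟨e, he⟩ := h4.exists_right_inv
  refine ⟨r.num ^ 2 * e ^ 2, ?_⟩
  calc g = g * r.denom ^ 2 * e ^ 2 := by rw [mul_assoc, ← mul_pow, he, one_pow, mul_one]
    _ = _ := by rw [← h1]; ring

theorem not_isSquare_algebraMap {f : ℂ[X]} (hf : Squarefree f) (hd : 0 < f.natDegree)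
    (r : RatFunc ℂ) : algebraMap ℂ[X] (RatFunc ℂ) f ≠ r ^ 2 := by
  intro h
  have hf0 : f ≠ 0 := by rintro rfl; simp at hd
  have hr : r ≠ 0 := by
    rintro rfl
    exact RatFunc.algebraMap_ne_zero hf0 (by rw [h]; simp)
  have h1 : f ∣ 1 := dvd_of_algebraMap_mul_sq_eq hf (r := r⁻¹) (by
    rw [h, map_one, inv_pow, mul_inv_cancel₀ (pow_ne_zero 2 hr)])
  have := natDegree_eq_zero_of_isUnit (isUnit_of_dvd_one h1)
  omega

/-- `f` defines a hyperelliptic function field. -/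
abbrev IsCurvePoly (f : ℂ[X]) : Prop := Squarefree f ∧ 0 < f.natDegree

instance fact_irreducible_curve (f : ℂ[X]) [hf : Fact (IsCurvePoly f)] :
    Fact (Irreducible ((Polynomial.X : (RatFunc ℂ)[X]) ^ 2 -
      Polynomial.C (algebraMap ℂ[X] (RatFunc ℂ) f))) :=
  ⟨X_pow_sub_C_irreducible_of_prime Nat.prime_two fun r h =>
    not_isSquare_algebraMap hf.out.1 hf.out.2 r h.symm⟩

noncomputable instance field_curveField (f : ℂ[X]) [Fact (IsCurvePoly f)] :
    Field (CurveField f) := AdjoinRoot.instField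

theorem curveZ_sq (f : ℂ[X]) :
    curveZ f ^ 2 = algebraMap (RatFunc ℂ) (CurveField f) (algebraMap ℂ[X] (RatFunc ℂ) f) := by
  have h := AdjoinRoot.mk_self (f := (Polynomial.X : (RatFunc ℂ)[X]) ^ 2 -
    Polynomial.C (algebraMap ℂ[X] (RatFunc ℂ) f))
  rw [map_sub, map_pow, AdjoinRoot.mk_X, AdjoinRoot.mk_C] at h
  exact sub_eq_zero.1 h

theorem aeval_curveT (f g : ℂ[X]) : aeval (curveT f) g =
    algebraMap (RatFunc ℂ) (CurveField f) (algebraMap ℂ[X] (RatFunc ℂ) g) := by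
  have h1 : curveT f = algebraMap (RatFunc ℂ) (CurveField f) RatFunc.X := rfl
  rw [h1, aeval_algebraMap_apply, ← RatFunc.algebraMap_X, aeval_algebraMap_apply, aeval_X_left]
  rfl

theorem curveZ_sq_eq_aeval (f : ℂ[X]) : curveZ f ^ 2 = aeval (curveT f) f := by
  rw [curveZ_sq, aeval_curveT]

theorem monic_curve (f : ℂ[X]) : ((Polynomial.X : (RatFunc ℂ)[X]) ^ 2 -
    Polynomial.C (algebraMap ℂ[X] (RatFunc ℂ) f)).Monic :=
  monic_X_pow_sub_C _ two_ne_zero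

theorem natDegree_curve (f : ℂ[X]) : ((Polynomial.X : (RatFunc ℂ)[X]) ^ 2 -
    Polynomial.C (algebraMap ℂ[X] (RatFunc ℂ) f)).natDegree = 2 :=
  natDegree_X_pow_sub_C

theorem exists_eq_add_mul_curveZ {f : ℂ[X]} (u : CurveField f) : ∃ r s : RatFunc ℂ,
    u = algebraMap _ (CurveField f) r + algebraMap _ (CurveField f) s * curveZ f := by
  obtain ⟨p, rfl⟩ := AdjoinRoot.mk_surjective u
  set m := (Polynomial.X : (RatFunc ℂ)[X]) ^ 2 - Polynomial.C (algebraMap ℂ[X] (RatFunc ℂ) f) with hm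
  have h1 : AdjoinRoot.mk m p = AdjoinRoot.mk m (p %ₘ m) := by
    rw [AdjoinRoot.mk_eq_mk]
    exact ⟨p /ₘ m, by rw [sub_eq_iff_eq_add, add_comm]; exact (modByMonic_add_div p m).symm⟩
  have h2 : (p %ₘ m).natDegree ≤ 1 := by
    have h3 := natDegree_modByMonic_lt p (monic_curve f) (by
      intro h; have := natDegree_curve f; rw [h] at this; simp at this)
    rw [natDegree_curve] at h3
    exact Nat.lt_succ_iff.1 h3
  obtain ⟨s, r, h⟩ := exists_eq_X_add_C_of_natDegree_le_one h2
  refine ⟨r, s, ?_⟩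
  rw [h1, h, map_add, map_mul, AdjoinRoot.mk_C, AdjoinRoot.mk_C, AdjoinRoot.mk_X, add_comm]
  rfl

theorem add_mul_curveZ_eq_zero {f : ℂ[X]} {r s : RatFunc ℂ}
    (h : algebraMap _ (CurveField f) r + algebraMap _ (CurveField f) s * curveZ f = 0) :
    r = 0 ∧ s = 0 := by
  by_contra hne
  refine AdjoinRoot.mk_ne_zero_of_natDegree_lt (monic_curve f)
    (g := Polynomial.C r + Polynomial.C s * Polynomial.X) ?_ ?_ ?_
  · intro h0
    apply hne
    have h1 := congrArg (fun p => p.coeff 0) h0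
    have h2 := congrArg (fun p => p.coeff 1) h0
    simp at h1 h2
    exact ⟨h1, h2⟩
  · rw [natDegree_curve]
    have : (Polynomial.C r + Polynomial.C s * Polynomial.X).natDegree ≤ 1 := by
      rw [add_comm]; exact natDegree_linear_le
    omega
  · rw [map_add, map_mul, AdjoinRoot.mk_C, AdjoinRoot.mk_C, AdjoinRoot.mk_X]
    exact h

theorem curveT_transcendental (f : ℂ[X]) : Function.Injective (aeval (R := ℂ) (curveT f)) := by
  rw [injective_iff_map_eq_zero]
  intro p hp
  rw [aeval_curveT] at hp
  have h := (add_mul_curveZ_eq_zero (f := f) (r := algebraMap ℂ[X] (RatFunc ℂ) p) (s := 0)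
    (by rw [map_zero, zero_mul, add_zero, hp])).1
  exact RatFunc.algebraMap_injective ℂ (by rw [h, map_zero])

section Hom

variable {L : Type} [Field L] [Algebra ℂ L]

/-- The homomorphism from the function field that sends `t` to `u` and `z` to `w`. -/
noncomputable def curveLift (f : ℂ[X]) (u w : L) (hu : Function.Injective (aeval (R := ℂ) u))
    (h : w ^ 2 = aeval u f) : CurveField f →ₐ[ℂ] L :=
  AdjoinRoot.liftAlgHom _ (RatFunc.liftAlgHom (aeval u)
    (nonZeroDivisors_le_comap_nonZeroDivisors_of_injective _ hu)) w (by
    rw [eval₂_sub, eval₂_pow, eval₂_X, eval₂_C, h, sub_eq_zero]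
    have := RatFunc.liftAlgHom_apply_div (aeval u)
      (nonZeroDivisors_le_comap_nonZeroDivisors_of_injective _ hu) f 1
    simpa using this.symm)

theorem curveLift_curveT (f : ℂ[X]) (u w : L) (hu : Function.Injective (aeval (R := ℂ) u))
    (h : w ^ 2 = aeval u f) : curveLift f u w hu h (curveT f) = u := by
  rw [curveLift, curveT, AdjoinRoot.liftAlgHom_of, ← RatFunc.algebraMap_X]
  have := RatFunc.liftAlgHom_apply_div (aeval u)
      (nonZeroDivisors_le_comap_nonZeroDivisors_of_injective _ hu) (X : ℂ[X]) 1
  simpa using this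

theorem curveLift_curveZ (f : ℂ[X]) (u w : L) (hu : Function.Injective (aeval (R := ℂ) u))
    (h : w ^ 2 = aeval u f) : curveLift f u w hu h (curveZ f) = w := by
  rw [curveLift, curveZ, AdjoinRoot.liftAlgHom_root]

end Hom

theorem intermediateField_eq_top {f : ℂ[X]} [Fact (IsCurvePoly f)]
    (E : IntermediateField ℂ (CurveField f)) (ht : curveT f ∈ E) (hz : curveZ f ∈ E) : E = ⊤ := by
  have hp : ∀ p : ℂ[X], algebraMap (RatFunc ℂ) (CurveField f) (algebraMap ℂ[X] (RatFunc ℂ) p) ∈ E :=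
    fun p => by
      rw [← aeval_curveT]
      exact Algebra.adjoin_le (S := E.toSubalgebra) (Set.singleton_subset_iff.2 ht)
        (aeval_mem_adjoin_singleton ℂ _)
  have hr : ∀ r : RatFunc ℂ, algebraMap (RatFunc ℂ) (CurveField f) r ∈ E := fun r => by
    rw [← RatFunc.num_div_denom r, map_div₀]
    exact E.div_mem (hp _) (hp _)
  refine eq_top_iff.2 fun u _ => ?_
  obtain ⟨r, s, rfl⟩ := exists_eq_add_mul_curveZ u
  exact E.add_mem (hr r) (E.mul_mem (hr s) hz)

theorem curveField_algHom_ext {f : ℂ[X]} [Fact (IsCurvePoly f)] {L : Type} [Field L] [Algebra ℂ L]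
    {φ ψ : CurveField f →ₐ[ℂ] L} (ht : φ (curveT f) = ψ (curveT f))
    (hz : φ (curveZ f) = ψ (curveZ f)) : φ = ψ := by
  let E : IntermediateField ℂ (CurveField f) :=
    { AlgHom.equalizer φ ψ with
      inv_mem' := fun x hx => by
        have hx : φ x = ψ x := hx
        change φ x⁻¹ = ψ x⁻¹
        rw [map_inv₀, map_inv₀, hx] }
  have hE := intermediateField_eq_top E ht hz
  refine AlgHom.ext fun x => ?_
  have : x ∈ E := hE ▸ IntermediateField.mem_top
  exact this

theorem curveField_algEquiv_ext {f : ℂ[X]} [Fact (IsCurvePoly f)]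
    {φ ψ : CurveField f ≃ₐ[ℂ] CurveField f} (ht : φ (curveT f) = ψ (curveT f))
    (hz : φ (curveZ f) = ψ (curveZ f)) : φ = ψ := by
  have := curveField_algHom_ext (f := f) (L := CurveField f)
    (φ := (φ : CurveField f →ₐ[ℂ] CurveField f))
    (ψ := (ψ : CurveField f →ₐ[ℂ] CurveField f)) ht hz
  exact AlgEquiv.ext fun x => DFunLike.congr_fun this x

/-! ### Involutions of a curve of genus two act on the projective line -/

theorem HasDistinctZeros.isCurvePoly {f : ℂ[X]} (h : HasDistinctZeros 6 f) : IsCurvePoly f :=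
  ⟨h.1, by have := h.2; omega⟩

/-! ### The algebraic relation between t and its image under an automorphism -/

theorem coeff_coeff_swap (F : ℂ[X][X]) (i j : ℕ) :
    ((Bivariate.swap F).coeff i).coeff j = (F.coeff j).coeff i := by
  induction F using Polynomial.induction_on' with
  | add p q hp hq => simp only [map_add, coeff_add, hp, hq]
  | monomial n a =>
    induction a using Polynomial.induction_on' with
    | add p q hp hq => simp only [map_add, coeff_add, hp, hq]
    | monomial m c =>
      rw [Bivariate.swap_monomial_monomial]
      simp only [coeff_monomial]
      split_ifs <;> simp_all [coeff_monomial]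

theorem natDegree_coeff_le_natDegree_swap (F : ℂ[X][X]) (j : ℕ) :
    (F.coeff j).natDegree ≤ (Bivariate.swap F).natDegree := by
  rw [natDegree_le_iff_coeff_eq_zero]
  intro i hi
  rw [← coeff_coeff_swap, coeff_eq_zero_of_natDegree_lt hi, coeff_zero]

theorem aevalAeval_curveT {f : ℂ[X]} (u : CurveField f) (G : ℂ[X][X]) :
    aevalAeval (curveT f) u G = aeval u (G.map (algebraMap ℂ[X] (RatFunc ℂ))) := by
  have : (aevalAeval (R := ℂ) (curveT f) u : ℂ[X][X] →+* CurveField f) =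
      (aeval (R := RatFunc ℂ) u : (RatFunc ℂ)[X] →+* CurveField f).comp
        (mapRingHom (algebraMap ℂ[X] (RatFunc ℂ))) := by
    refine Polynomial.ringHom_ext (fun p => ?_) ?_
    · simpa using aeval_curveT f p
    · simp
  exact RingHom.congr_fun this G

theorem map_aevalAeval {K : Type} [CommRing K] [Algebra ℂ K] (σ : K ≃ₐ[ℂ] K) (x y : K)
    (G : ℂ[X][X]) : σ (aevalAeval x y G) = aevalAeval (σ x) (σ y) G := by
  have : (σ : K →ₐ[ℂ] K).comp (aevalAeval x y) = aevalAeval (σ x) (σ y) := by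
    apply (aevalAevalEquiv ℂ K).symm.injective
    simp
  exact DFunLike.congr_fun this G

/-- A primitive polynomial in two variables that generates the relations between `t` and `u`. -/
theorem exists_primitive_relation {f : ℂ[X]} [Fact (IsCurvePoly f)] (u : CurveField f) :
    ∃ F : ℂ[X][X], F.IsPrimitive ∧ F.natDegree = (minpoly (RatFunc ℂ) u).natDegree ∧
      aevalAeval (curveT f) u F = 0 ∧
      ∀ G : ℂ[X][X], aevalAeval (curveT f) u G = 0 → F ∣ G := by
  let _ : NormalizedGCDMonoid ℂ[X] := UniqueFactorizationMonoid.toNormalizedGCDMonoid _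
  have hfin : Module.Finite (RatFunc ℂ) (CurveField f) := (monic_curve f).finite_adjoinRoot
  set m := minpoly (RatFunc ℂ) u
  have hm0 : m ≠ 0 := minpoly.ne_zero (Algebra.IsIntegral.isIntegral u)
  obtain ⟨b, hb, hF0⟩ := IsLocalization.integerNormalization_spec (nonZeroDivisors ℂ[X]) m
  set F0 := IsLocalization.integerNormalization (nonZeroDivisors ℂ[X]) m
  have hb0 : algebraMap ℂ[X] (RatFunc ℂ) b ≠ 0 :=
    RatFunc.algebraMap_ne_zero (nonZeroDivisors.ne_zero hb)
  have hF0' : F0.map (algebraMap ℂ[X] (RatFunc ℂ)) = C (algebraMap ℂ[X] (RatFunc ℂ) b) * m := by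
    rw [hF0, ← smul_eq_C_mul, algebraMap_smul]
  have hne : F0 ≠ 0 := by
    intro h
    rw [h, Polynomial.map_zero] at hF0'
    exact mul_ne_zero (C_ne_zero.2 hb0) hm0 hF0'.symm
  have hc0 : algebraMap ℂ[X] (RatFunc ℂ) F0.content ≠ 0 :=
    RatFunc.algebraMap_ne_zero (by rwa [Ne, content_eq_zero_iff])
  have hF : F0.primPart.map (algebraMap ℂ[X] (RatFunc ℂ)) =
      C ((algebraMap ℂ[X] (RatFunc ℂ) F0.content)⁻¹ * algebraMap ℂ[X] (RatFunc ℂ) b) * m := by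
    have h1 : F0.map (algebraMap ℂ[X] (RatFunc ℂ)) =
        C (algebraMap ℂ[X] (RatFunc ℂ) F0.content) * F0.primPart.map (algebraMap ℂ[X] (RatFunc ℂ)) := by
      rw [← map_C, ← Polynomial.map_mul, ← eq_C_content_mul_primPart F0]
    rw [C_mul, mul_assoc, ← hF0', h1, ← mul_assoc, ← C_mul, inv_mul_cancel₀ hc0, C_1, one_mul]
  have hcc := mul_ne_zero (inv_ne_zero hc0) hb0
  refine ⟨F0.primPart, isPrimitive_primPart _, ?_, ?_, fun G hG => ?_⟩
  · rw [← natDegree_map_eq_of_injective (RatFunc.algebraMap_injective ℂ), hF, natDegree_C_mul hcc]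
  · rw [aevalAeval_curveT, hF, map_mul, minpoly.aeval, mul_zero]
  -- Gauss's lemma: for a primitive divisor, divisibility over the rational functions descends to
  -- polynomial coefficients.
  · refine (isPrimitive_primPart F0).dvd_of_fraction_map_dvd_fraction_map (K := RatFunc ℂ) ?_
    rw [hF]
    rw [aevalAeval_curveT] at hG
    have hu : IsUnit (C ((algebraMap ℂ[X] (RatFunc ℂ) F0.content)⁻¹ *
      algebraMap ℂ[X] (RatFunc ℂ) b)) := isUnit_C.2 (isUnit_iff_ne_zero.2 hcc)
    exact (hu.mul_left_dvd).2 (minpoly.dvd _ _ hG)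

/-- The square of r + s z is r² + f s² + 2 r s z. If it lies in ℂ(t), its coordinate along z
vanishes. -/
theorem curveField_coord_eq_zero {f : ℂ[X]} {r s : RatFunc ℂ} {g : ℂ[X]}
    (h : (algebraMap _ (CurveField f) r + algebraMap _ (CurveField f) s * curveZ f) ^ 2 =
      algebraMap (RatFunc ℂ) (CurveField f) (algebraMap ℂ[X] (RatFunc ℂ) g)) :
    r * s = 0 ∧ r ^ 2 + algebraMap ℂ[X] (RatFunc ℂ) f * s ^ 2 = algebraMap ℂ[X] (RatFunc ℂ) g := by
  have h1 := add_mul_curveZ_eq_zero (f := f)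
    (r := r ^ 2 + algebraMap ℂ[X] (RatFunc ℂ) f * s ^ 2 - algebraMap ℂ[X] (RatFunc ℂ) g)
    (s := 2 * (r * s)) (by
      rw [map_sub, ← h, map_add, map_mul, map_mul, map_mul, map_pow, map_pow, ← curveZ_sq, map_ofNat]
      ring)
  refine ⟨?_, sub_eq_zero.1 h1.1⟩
  simpa using h1.2

/-- An involution of a hyperelliptic curve of genus two acts on `t` by a Möbius transformation. -/
theorem exists_moebius {f : ℂ[X]} (hf : HasDistinctZeros 6 f) [Fact (IsCurvePoly f)]
    (σ : CurveField f ≃ₐ[ℂ] CurveField f)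
    (hσ : σ (σ (curveT f)) = curveT f) :
    ∃ p q : ℂ[X], p.natDegree ≤ 1 ∧ q.natDegree ≤ 1 ∧ q ≠ 0 ∧
      aeval (curveT f) q * σ (curveT f) = aeval (curveT f) p := by
  have hfin : Module.Finite (RatFunc ℂ) (CurveField f) := (monic_curve f).finite_adjoinRoot
  obtain ⟨F, hprim, hdeg, hF, hdvd⟩ := exists_primitive_relation (σ (curveT f))
  set u := σ (curveT f) with hu
  have hint : IsIntegral (RatFunc ℂ) u := Algebra.IsIntegral.isIntegral u
  -- The involution exchanges t and u, so the relation holds with the variables interchanged.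
  have hswap : aevalAeval (curveT f) u (Bivariate.swap F) = 0 := by
    rw [Bivariate.aevalAeval_swap]
    have := map_aevalAeval σ (curveT f) u F
    rw [hF, map_zero, hσ] at this
    exact this.symm
  obtain ⟨H, hH⟩ := hdvd _ hswap
  have hH' : F = Bivariate.swap F * Bivariate.swap H := by
    rw [← map_mul, ← hH, Bivariate.swap_swap_apply]
  -- F and its swap divide each other, so the degree in t is bounded by the degree in u, which is at
  -- most two.
  have hle : (Bivariate.swap F).natDegree ≤ F.natDegree :=
    natDegree_le_of_dvd ⟨_, hH'⟩ hprim.ne_zero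
  have hcoeff : ∀ j, (F.coeff j).natDegree ≤ F.natDegree := fun j =>
    (natDegree_coeff_le_natDegree_swap F j).trans hle
  have h2 : F.natDegree ≤ 2 := by
    rw [hdeg]
    refine (minpoly.natDegree_le u).trans ?_
    rw [(AdjoinRoot.powerBasis' (monic_curve f)).finrank, AdjoinRoot.powerBasis'_dim,
      natDegree_curve]
  have hpos : 0 < F.natDegree := by rw [hdeg]; exact minpoly.natDegree_pos hint
  have hlead : F.coeff F.natDegree ≠ 0 := leadingCoeff_ne_zero.2 hprim.ne_zero
  have hrel : ∑ j ∈ Finset.range 3, aeval (curveT f) (F.coeff j) * u ^ j = 0 := by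
    rw [aevalAeval_curveT, aeval_eq_sum_range' (n := 3)
      ((natDegree_map_le).trans_lt (by omega))] at hF
    rw [← hF]
    refine Finset.sum_congr rfl fun j _ => ?_
    rw [coeff_map, Algebra.smul_def, aeval_curveT]
  simp only [Finset.sum_range_succ, Finset.sum_range_zero] at hrel
  obtain h1 | h2 : F.natDegree = 1 ∨ F.natDegree = 2 := by omega
  · rw [h1] at hcoeff hlead
    refine ⟨-F.coeff 0, F.coeff 1, by rw [natDegree_neg]; exact hcoeff 0, hcoeff 1, hlead, ?_⟩
    rw [coeff_eq_zero_of_natDegree_lt (by omega : F.natDegree < 2)] at hrel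
    rw [map_neg]
    rw [map_zero] at hrel
    linear_combination hrel
  -- If the relation is quadratic in u, then u involves z and the discriminant of the relation is f
  -- times a square, hence a multiple of f. It has degree at most 4, while f has degree at least 5;
  -- this is where genus two enters.
  · exfalso
    rw [h2] at hcoeff hlead
    obtain ⟨r, s, hrs⟩ := exists_eq_add_mul_curveZ u
    have hs : s ≠ 0 := by
      rintro rfl
      rw [map_zero, zero_mul, add_zero] at hrs
      have := minpoly.eq_X_sub_C (CurveField f) r
      rw [← hrs] at this
      rw [this, natDegree_X_sub_C, h2] at hdeg
      omega
    set D := F.coeff 1 ^ 2 - 4 * F.coeff 2 * F.coeff 0 with hD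
    have hsq : (algebraMap _ (CurveField f) (2 * algebraMap ℂ[X] (RatFunc ℂ) (F.coeff 2) * r +
          algebraMap ℂ[X] (RatFunc ℂ) (F.coeff 1)) +
        algebraMap _ (CurveField f) (2 * algebraMap ℂ[X] (RatFunc ℂ) (F.coeff 2) * s) *
          curveZ f) ^ 2 = algebraMap (RatFunc ℂ) (CurveField f) (algebraMap ℂ[X] (RatFunc ℂ) D) := by
      have e1 : algebraMap _ (CurveField f) (2 * algebraMap ℂ[X] (RatFunc ℂ) (F.coeff 2) * r +
          algebraMap ℂ[X] (RatFunc ℂ) (F.coeff 1)) +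
        algebraMap _ (CurveField f) (2 * algebraMap ℂ[X] (RatFunc ℂ) (F.coeff 2) * s) *
          curveZ f = 2 * aeval (curveT f) (F.coeff 2) * u + aeval (curveT f) (F.coeff 1) := by
        rw [hrs]
        simp only [map_add, map_mul, map_ofNat, aeval_curveT]
        ring
      rw [e1, ← aeval_curveT, hD]
      simp only [map_sub, map_mul, map_pow, map_ofNat]
      linear_combination 4 * aeval (curveT f) (F.coeff 2) * hrel
    obtain ⟨k1, k2⟩ := curveField_coord_eq_zero hsq
    have hS : 2 * algebraMap ℂ[X] (RatFunc ℂ) (F.coeff 2) * s ≠ 0 :=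
      mul_ne_zero (mul_ne_zero two_ne_zero (RatFunc.algebraMap_ne_zero hlead)) hs
    have hR := (mul_eq_zero.1 k1).resolve_right hS
    rw [hR, zero_pow two_ne_zero, zero_add] at k2
    have hfD := dvd_of_algebraMap_mul_sq_eq hf.1 k2
    have hf0 : f ≠ 0 := hf.1.ne_zero
    have hD0 : D ≠ 0 := by
      intro h0
      rw [h0, map_zero] at k2
      exact mul_ne_zero (RatFunc.algebraMap_ne_zero hf0) (pow_ne_zero 2 hS) k2
    have h3 := natDegree_le_of_dvd hfD hD0
    have h4 : D.natDegree ≤ 4 := by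
      refine (natDegree_sub_le _ _).trans (max_le ?_ ?_)
      · refine natDegree_pow_le.trans ?_
        have := hcoeff 1
        omega
      · refine natDegree_mul_le.trans ?_
        have h5 : (4 * F.coeff 2).natDegree ≤ 2 := by
          have : (4 : ℂ[X]) = C 4 := rfl
          rw [this]
          exact (natDegree_C_mul_le _ _).trans (hcoeff 2)
        have := hcoeff 0
        omega
    have := hf.2
    omega

/-! ### Constructing involutions and recognizing extra ones -/

theorem linear_eq_zero_of_injective_aeval {K : Type} [CommRing K] [Algebra ℂ K] {T : K}
    (hT : Function.Injective (aeval (R := ℂ) T)) {x y : ℂ}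
    (h : algebraMap ℂ K x + algebraMap ℂ K y * T = 0) : x = 0 ∧ y = 0 := by
  have h1 : aeval T (C x + C y * X) = aeval T (0 : ℂ[X]) := by
    rw [map_zero, map_add, map_mul, aeval_C, aeval_C, aeval_X, h]
  have h2 := hT h1
  by_contra hne
  exact linearFactor_ne_zero hne h2

/-- Over an algebraically closed field every algebraic element is a constant. -/
theorem injective_aeval_of_forall_ne {K : Type} [Field K] [Algebra ℂ K] {u : K}
    (h : ∀ c : ℂ, u ≠ algebraMap ℂ K c) : Function.Injective (aeval (R := ℂ) u) := by
  rw [← transcendental_iff_injective]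
  intro halg
  have hint := halg.isIntegral
  obtain ⟨c, hc⟩ := minpoly.mem_range_of_degree_eq_one ℂ u
    (IsAlgClosed.degree_eq_one_of_irreducible ℂ (minpoly.irreducible hint))
  exact h c hc.symm

theorem injective_aeval_moebius {K : Type} [Field K] [Algebra ℂ K] {T u : K}
    (hT : Function.Injective (aeval (R := ℂ) T)) {a b c d : ℂ} (hdet : a * d - b * c ≠ 0)
    (h : u * (algebraMap ℂ K c * T + algebraMap ℂ K d) = algebraMap ℂ K a * T + algebraMap ℂ K b) :
    Function.Injective (aeval (R := ℂ) u) := by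
  refine injective_aeval_of_forall_ne fun r hr => hdet ?_
  obtain ⟨h1, h2⟩ := linear_eq_zero_of_injective_aeval hT (x := r * d - b) (y := r * c - a) (by
    simp only [map_sub, map_mul]
    rw [hr] at h
    linear_combination h)
  linear_combination -d * h2 + c * h1

theorem injective_aeval_const_sub {K : Type} [Field K] [Algebra ℂ K] {T : K}
    (hT : Function.Injective (aeval (R := ℂ) T)) (b : ℂ) :
    Function.Injective (aeval (R := ℂ) (algebraMap ℂ K b - T)) :=
  injective_aeval_moebius hT (a := -1) (b := b) (c := 0) (d := 1) (by norm_num)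
    (by simp only [map_zero, map_one, map_neg]; ring)

/-- An automorphism fixing t sends z to ±z, so it is the identity or the hyperelliptic involution.
-/
theorem IsExtraInvolution.map_curveT_ne {f : ℂ[X]} [Fact (IsCurvePoly f)]
    {σ : CurveField f ≃ₐ[ℂ] CurveField f} (h : IsExtraInvolution f σ) :
    σ (curveT f) ≠ curveT f := by
  intro ht
  have h1 : (σ (curveZ f)) ^ 2 = curveZ f ^ 2 := by
    rw [← map_pow, curveZ_sq_eq_aeval, ← AlgEquiv.coe_toAlgHom, ← aeval_algHom_apply,
      AlgEquiv.coe_toAlgHom, ht]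
  rcases sq_eq_sq_iff_eq_or_eq_neg.1 h1 with h2 | h2
  · have : σ = 1 := curveField_algEquiv_ext ht h2
    have h3 := h.1
    rw [this, orderOf_one] at h3
    omega
  · exact h.2 ⟨ht, h2⟩

theorem map_map_of_orderOf_two {f : ℂ[X]} {σ : CurveField f ≃ₐ[ℂ] CurveField f}
    (h : orderOf σ = 2) (x : CurveField f) : σ (σ x) = x := by
  have h1 : σ ^ 2 = 1 := orderOf_dvd_iff_pow_eq_one.1 h.dvd
  have := DFunLike.congr_fun h1 x
  simpa [sq] using this

/-- The involution is (t, z) ↦ (b - t, z). -/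
theorem hasExtraInvolutionFixingInfinity_of_comp_eq {f : ℂ[X]} (hf : IsCurvePoly f) {b : ℂ}
    (h : f.comp (C b - X) = f) : HasExtraInvolutionFixingInfinity f := by
  have : Fact (IsCurvePoly f) := ⟨hf⟩
  have hu : Function.Injective (aeval (R := ℂ) (algebraMap ℂ (CurveField f) b - curveT f)) :=
    injective_aeval_const_sub (curveT_transcendental f) b
  have hw : curveZ f ^ 2 = aeval (algebraMap ℂ (CurveField f) b - curveT f) f := by
    have h1 : aeval (curveT f) (f.comp (C b - X)) = aeval (curveT f) f := congrArg _ h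
    rw [curveZ_sq_eq_aeval, ← h1, aeval_comp]
    simp
  set φ := curveLift f _ _ hu hw with hφ
  have hφt : φ (curveT f) = algebraMap ℂ (CurveField f) b - curveT f := curveLift_curveT ..
  have hφz : φ (curveZ f) = curveZ f := curveLift_curveZ ..
  have hφφ : φ.comp φ = AlgHom.id ℂ (CurveField f) := by
    refine curveField_algHom_ext (f := f) (L := CurveField f) ?_ ?_
    · rw [AlgHom.comp_apply, hφt, map_sub, hφt, AlgHom.commutes, AlgHom.id_apply]
      ring
    · rw [AlgHom.comp_apply, hφz, hφz, AlgHom.id_apply]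
  let σ : CurveField f ≃ₐ[ℂ] CurveField f := AlgEquiv.ofAlgHom φ φ hφφ hφφ
  have hσt : σ (curveT f) = algebraMap ℂ (CurveField f) b - curveT f := hφt
  have hσz : σ (curveZ f) = curveZ f := hφz
  have hne : σ (curveT f) ≠ curveT f := by
    intro h0
    have := (linear_eq_zero_of_injective_aeval (curveT_transcendental f) (x := b) (y := -2) (by
      rw [map_neg, map_ofNat]
      linear_combination h0 - hσt)).2
    norm_num at this
  refine ⟨σ, ⟨?_, fun h0 => hne h0.1⟩, -1, b, ?_⟩
  · refine orderOf_eq_prime ?_ ?_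
    · refine AlgEquiv.ext fun x => ?_
      rw [sq σ]
      exact DFunLike.congr_fun hφφ x
    · intro h1
      rw [h1] at hne
      exact hne rfl
  · rw [hσt, map_neg, map_one]
    ring

theorem squarefree_comp_neg_X {f : ℂ[X]} (h : Squarefree f) : Squarefree (f.comp (-X)) := by
  have hcc : ∀ p : ℂ[X], (p.comp (-X)).comp (-X) = p := fun p => by simp [comp_assoc]
  rintro x ⟨y, hy⟩
  have h1 : x.comp (-X) * x.comp (-X) ∣ f := ⟨y.comp (-X), by
    rw [← mul_comp, ← mul_comp, ← hy, hcc]⟩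
  obtain ⟨e, he⟩ := (h _ h1).exists_right_inv
  refine IsUnit.of_mul_eq_one (e.comp (-X)) ?_
  rw [← hcc x, ← mul_comp, he, one_comp]

/-- A sextic invariant under `t ↦ -t` has roots in pairs. -/
theorem exists_eq_evenSextic {f : ℂ[X]} (hf : HasDistinctZeros 6 f) (h : f.comp (-X) = f) :
    ∃ c θ, c ≠ 0 ∧ f = evenSextic c θ := by
  have hodd : ∀ n, Odd n → f.coeff n = 0 := by
    intro n hn
    have h1 := congrArg (fun p => p.coeff n) h
    simp only [show (-X : ℂ[X]) = C (-1) * X by simp, comp_C_mul_X_coeff, hn.neg_one_pow] at h1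
    exact self_eq_neg.1 (by linear_combination -h1)
  have hg : expand ℂ 2 (contract 2 f) = f := by
    ext n
    rw [coeff_expand two_pos]
    split_ifs with h2
    · rw [coeff_contract two_ne_zero, Nat.div_mul_cancel h2]
    · exact (hodd n (Nat.not_even_iff_odd.1 fun he => h2 he.two_dvd)).symm
  set g := contract 2 f
  have hdeg : g.natDegree * 2 = f.natDegree := by rw [← natDegree_expand, hg]
  -- The degree of f is even, which rules out a zero at infinity. So g has full degree 3 and none of
  -- its linear factors is constant.
  have hdeg3 : g.natDegree = 3 := by have := hf.2; omega
  obtain ⟨a, b, hab⟩ := exists_eq_linearProd (d := 2) g hdeg3.le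
  have hb : ∀ i, b i ≠ 0 := by
    intro i hi
    have h1 := natDegree_linearProd_le a b
    rw [← hab, hdeg3] at h1
    have h2 : (Finset.univ.filter fun i => b i ≠ 0) ⊆ Finset.univ.erase i := by
      intro j hj
      rw [Finset.mem_filter] at hj
      refine Finset.mem_erase.2 ⟨?_, Finset.mem_univ _⟩
      rintro rfl
      exact hj.2 hi
    have h3 := Finset.card_le_card h2
    rw [Finset.card_erase_of_mem (Finset.mem_univ i), Finset.card_univ, Fintype.card_fin] at h3
    omega
  refine ⟨∏ i, b i, fun i => -a i / b i, Finset.prod_ne_zero_iff.2 fun i _ => hb i, ?_⟩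
  rw [← hg, hab, evenSextic, map_prod C, ← Finset.prod_mul_distrib, linearProd,
    map_prod (expand ℂ 2)]
  refine Finset.prod_congr rfl fun i _ => ?_
  rw [map_add, map_mul, expand_C, expand_C, expand_X, mul_sub, ← C_mul,
    show b i * (-a i / b i) = -a i by have := hb i; field_simp, C_neg]
  ring

/-- The image of z has square f(-t), which is not a square in ℂ(t), so it is a multiple s z.
Equality of degrees makes s a constant ν with f(-t) = ν² f(t). Applying the involution twice
multiplies z by ν², so ν² = 1. For odd f the lifts of t ↦ -t have order four. -/
theorem comp_neg_X_eq_of_involution {f : ℂ[X]} (hf : HasDistinctZeros 6 f) [Fact (IsCurvePoly f)]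
    {τ : CurveField f ≃ₐ[ℂ] CurveField f} (hτ : orderOf τ = 2)
    (ht : τ (curveT f) = -curveT f) : f.comp (-X) = f := by
  obtain ⟨r, s, hrs⟩ := exists_eq_add_mul_curveZ (τ (curveZ f))
  have hsq : (algebraMap _ (CurveField f) r + algebraMap _ (CurveField f) s * curveZ f) ^ 2 =
      algebraMap (RatFunc ℂ) (CurveField f) (algebraMap ℂ[X] (RatFunc ℂ) (f.comp (-X))) := by
    rw [← hrs, ← map_pow, curveZ_sq_eq_aeval, ← AlgEquiv.coe_toAlgHom, ← aeval_algHom_apply,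
      AlgEquiv.coe_toAlgHom, ht, ← aeval_curveT, aeval_comp]
    simp
  obtain ⟨k1, k2⟩ := curveField_coord_eq_zero hsq
  have hdeg : (f.comp (-X)).natDegree = f.natDegree := by
    rw [natDegree_comp, natDegree_neg, natDegree_X, mul_one]
  have hf0 : f ≠ 0 := hf.1.ne_zero
  have hs : s ≠ 0 := by
    rintro rfl
    rw [zero_pow two_ne_zero, mul_zero, add_zero] at k2
    exact not_isSquare_algebraMap (squarefree_comp_neg_X hf.1)
      (by rw [hdeg]; exact hf.isCurvePoly.2) r k2.symm
  have hr := (mul_eq_zero.1 k1).resolve_right hs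
  rw [hr, zero_pow two_ne_zero, zero_add] at k2
  obtain ⟨k, hk⟩ := dvd_of_algebraMap_mul_sq_eq hf.1 k2
  have hk0 : k ≠ 0 := by
    rintro rfl
    rw [hk, mul_zero, map_zero] at k2
    exact mul_ne_zero (RatFunc.algebraMap_ne_zero hf0) (pow_ne_zero 2 hs) k2
  have hkdeg : k.natDegree = 0 := by
    have := natDegree_mul hf0 hk0
    rw [← hk, hdeg] at this
    omega
  obtain ⟨κ, rfl⟩ : ∃ κ, k = C κ := ⟨_, eq_C_of_natDegree_eq_zero hkdeg⟩
  obtain ⟨μ, hμ⟩ : ∃ μ : ℂ, μ ^ 2 = κ := IsAlgClosed.exists_pow_nat_eq _ two_pos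
  have hs2 : s ^ 2 = (algebraMap ℂ (RatFunc ℂ) μ) ^ 2 := by
    apply mul_left_cancel₀ (RatFunc.algebraMap_ne_zero hf0)
    rw [k2, hk, map_mul, ← map_pow, hμ, IsScalarTower.algebraMap_apply ℂ ℂ[X] (RatFunc ℂ) κ]
    rfl
  obtain ⟨ν, hν, hsν⟩ : ∃ ν : ℂ, ν ^ 2 = κ ∧ s = algebraMap ℂ (RatFunc ℂ) ν := by
    rcases sq_eq_sq_iff_eq_or_eq_neg.1 hs2 with h | h
    · exact ⟨μ, hμ, h⟩
    · exact ⟨-μ, by rw [neg_sq, hμ], by rw [h, map_neg]⟩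
  have hτz : τ (curveZ f) = algebraMap ℂ (CurveField f) ν * curveZ f := by
    rw [hrs, hr, hsν, map_zero, zero_add, ← IsScalarTower.algebraMap_apply]
  have h2 := map_map_of_orderOf_two hτ (curveZ f)
  rw [hτz, map_mul, AlgEquiv.commutes, hτz, ← mul_assoc, ← map_mul, ← sq, hν] at h2
  have hz : curveZ f ≠ 0 := by
    intro h0
    have := curveZ_sq_eq_aeval f
    rw [h0, zero_pow two_ne_zero] at this
    exact hf0 (curveT_transcendental f (by rw [← this, map_zero]))
  have h3 : algebraMap ℂ (CurveField f) κ = algebraMap ℂ (CurveField f) 1 := by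
    apply mul_right_cancel₀ hz
    rw [h2, map_one, one_mul]
  have h4 : κ = 1 := (algebraMap ℂ (CurveField f)).injective h3
  rw [hk, h4, C_1, mul_one]

/-! ### Change of coordinate on the projective line -/

theorem aeval_linearProd {K : Type} [CommRing K] [Algebra ℂ K] {d : ℕ} (a b : Fin d → ℂ) (T : K) :
    aeval T (linearProd a b) = ∏ i, (algebraMap ℂ K (a i) + algebraMap ℂ K (b i) * T) := by
  simp [linearProd, map_prod]

/-- The sextic with roots moved by the Möbius transformation `t ↦ (a t + b) / (c t + d)`. -/
noncomputable def moebiusProd {n : ℕ} (α β : Fin n → ℂ) (a b c d : ℂ) : ℂ[X] :=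
  linearProd (fun i => α i * d + β i * b) fun i => α i * c + β i * a

theorem hasDistinctZeros_moebiusProd {n : ℕ} (hn : 2 ≤ n) {α β : Fin n → ℂ}
    (h : HasDistinctZeros n (linearProd α β)) {a b c d : ℂ} (hdet : a * d - b * c ≠ 0) :
    HasDistinctZeros n (moebiusProd α β a b c d) := by
  rw [hasDistinctZeros_linearProd_iff hn] at h
  rw [moebiusProd, hasDistinctZeros_linearProd_iff hn]
  intro i j hij h0
  refine mul_ne_zero hdet (h i j hij) ?_
  linear_combination h0

theorem exists_curveEquiv {f : ℂ[X]} [Fact (IsCurvePoly f)] {K : Type} [Field K] [Algebra ℂ K]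
    {u w : K} (hu : Function.Injective (aeval (R := ℂ) u)) (hw : w ^ 2 = aeval u f)
    (hgen : ∀ E : IntermediateField ℂ K, u ∈ E → w ∈ E → E = ⊤) :
    ∃ φ : CurveField f ≃ₐ[ℂ] K, φ (curveT f) = u ∧ φ (curveZ f) = w := by
  have h1 := curveLift_curveT f u w hu hw
  have h2 := curveLift_curveZ f u w hu hw
  have hrange := hgen (curveLift f u w hu hw).fieldRange ⟨_, h1⟩ ⟨_, h2⟩
  have hsurj : Function.Surjective (curveLift f u w hu hw) := fun x => by
    have hx : x ∈ (curveLift f u w hu hw).fieldRange := hrange ▸ IntermediateField.mem_top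
    exact hx
  exact ⟨AlgEquiv.ofBijective _ ⟨(curveLift f u w hu hw).injective, hsurj⟩, h1, h2⟩

theorem exists_curveEquiv_of_generators {α β : Fin 6 → ℂ} [Fact (IsCurvePoly (linearProd α β))]
    {a b c d : ℂ} (hdet : a * d - b * c ≠ 0) {K : Type} [Field K] [Algebra ℂ K] {T Z : K}
    (hT : Function.Injective (aeval (R := ℂ) T))
    (hZ : Z ^ 2 = aeval T (moebiusProd α β a b c d))
    (hgen : ∀ E : IntermediateField ℂ K, T ∈ E → Z ∈ E → E = ⊤) :
    ∃ φ : CurveField (linearProd α β) ≃ₐ[ℂ] K, φ (curveT (linearProd α β)) *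
      (algebraMap ℂ K c * T + algebraMap ℂ K d) = algebraMap ℂ K a * T + algebraMap ℂ K b := by
  have hden : algebraMap ℂ K c * T + algebraMap ℂ K d ≠ 0 := by
    intro h0
    obtain ⟨hd, hc⟩ := linear_eq_zero_of_injective_aeval hT (x := d) (y := c) (by rw [← h0]; ring)
    exact hdet (by rw [hd, hc]; ring)
  have hdet' : algebraMap ℂ K a * algebraMap ℂ K d - algebraMap ℂ K b * algebraMap ℂ K c ≠ 0 := by
    rw [← map_mul, ← map_mul, ← map_sub]
    exact (_root_.map_ne_zero _).2 hdet
  rw [moebiusProd, aeval_linearProd] at hZ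
  set D := algebraMap ℂ K c * T + algebraMap ℂ K d with hD
  set u := (algebraMap ℂ K a * T + algebraMap ℂ K b) / D with hu
  have huD : u * D = algebraMap ℂ K a * T + algebraMap ℂ K b := div_mul_cancel₀ _ hden
  -- Each of the six linear factors acquires one denominator D under the substitution, so z picks up
  -- D ^ 3.
  have hw : (Z / D ^ 3) ^ 2 = aeval u (linearProd α β) := by
    have h1 : ∏ i, (algebraMap ℂ K (α i * d + β i * b) + algebraMap ℂ K (α i * c + β i * a) * T) =
        D ^ 6 * ∏ i, (algebraMap ℂ K (α i) + algebraMap ℂ K (β i) * u) := by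
      have h2 : D ^ 6 = ∏ _i : Fin 6, D := by simp
      rw [h2, ← Finset.prod_mul_distrib]
      refine Finset.prod_congr rfl fun i _ => ?_
      simp only [map_add, map_mul]
      rw [hD] at huD ⊢
      linear_combination -algebraMap ℂ K (β i) * huD
    rw [div_pow, hZ, h1, aeval_linearProd, ← pow_mul, mul_div_cancel_left₀]
    exact pow_ne_zero _ hden
  obtain ⟨φ, hφ, -⟩ := exists_curveEquiv (f := linearProd α β)
    (injective_aeval_moebius hT hdet huD) hw fun E hE1 hE2 => by
      have hc : ∀ x : ℂ, algebraMap ℂ K x ∈ E := fun x => E.algebraMap_mem x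
      have hden2 : algebraMap ℂ K c * u - algebraMap ℂ K a ≠ 0 := by
        intro h0
        apply hdet'
        rw [hD] at huD
        linear_combination -(algebraMap ℂ K c * T + algebraMap ℂ K d) * h0 + algebraMap ℂ K c * huD
      have hTE : T ∈ E := by
        have : T = (algebraMap ℂ K b - algebraMap ℂ K d * u) /
            (algebraMap ℂ K c * u - algebraMap ℂ K a) := by
          rw [eq_div_iff hden2]
          rw [hD] at huD
          linear_combination huD
        rw [this]
        exact E.div_mem (E.sub_mem (hc _) (E.mul_mem (hc _) hE1))
          (E.sub_mem (E.mul_mem (hc _) hE1) (hc _))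
      refine hgen E hTE ?_
      have : Z = Z / D ^ 3 * D ^ 3 := (div_mul_cancel₀ _ (pow_ne_zero _ hden)).symm
      rw [this]
      exact E.mul_mem hE2 (pow_mem (E.add_mem (E.mul_mem (hc _) hTE) (hc _)) 3)
  exact ⟨φ, by rw [hφ, huD]⟩

theorem nonempty_curveEquiv_C_mul {c : ℂ} (hc : c ≠ 0) {f : ℂ[X]} (hf : IsCurvePoly f)
    (hcf : IsCurvePoly (C c * f)) : Nonempty (CurveField (C c * f) ≃ₐ[ℂ] CurveField f) := by
  have : Fact (IsCurvePoly f) := ⟨hf⟩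
  have : Fact (IsCurvePoly (C c * f)) := ⟨hcf⟩
  obtain ⟨μ, hμ⟩ : ∃ μ : ℂ, μ ^ 2 = c := IsAlgClosed.exists_pow_nat_eq _ two_pos
  have hμ0 : μ ≠ 0 := by rintro rfl; exact hc (by rw [← hμ]; simp)
  obtain ⟨φ, -⟩ := exists_curveEquiv (f := C c * f) (K := CurveField f) (u := curveT f)
    (w := algebraMap ℂ (CurveField f) μ * curveZ f) (curveT_transcendental f) (by
      rw [mul_pow, curveZ_sq_eq_aeval, ← map_pow, hμ, map_mul, aeval_C])
    fun E h1 h2 => intermediateField_eq_top E h1 (by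
      have h3 : curveZ f = algebraMap ℂ (CurveField f) μ⁻¹ *
          (algebraMap ℂ (CurveField f) μ * curveZ f) := by
        rw [← mul_assoc, ← map_mul, inv_mul_cancel₀ hμ0, map_one, one_mul]
      rw [h3]
      exact E.mul_mem (E.algebraMap_mem _) h2)
  exact ⟨φ⟩

/-- Conjugated to the curve of the transformed sextic, the involution still has order two and, by
`hconj`, negates the new coordinate; so that sextic is even. The condition is stated for arbitrary
target fields because it is a formal computation with the coordinate T. -/
theorem exists_moebiusProd_eq_evenSextic_of_conj {α β : Fin 6 → ℂ}
    (h : HasDistinctZeros 6 (linearProd α β)) [Fact (IsCurvePoly (linearProd α β))]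
    {a b c d : ℂ} (hdet : a * d - b * c ≠ 0)
    {σ : CurveField (linearProd α β) ≃ₐ[ℂ] CurveField (linearProd α β)} (hσ : orderOf σ = 2)
    (hconj : ∀ (K : Type) [Field K] [Algebra ℂ K] (T : K)
      (_ : Function.Injective (aeval (R := ℂ) T)) (φ : CurveField (linearProd α β) ≃ₐ[ℂ] K)
      (_ : φ (curveT (linearProd α β)) * (algebraMap ℂ K c * T + algebraMap ℂ K d) =
        algebraMap ℂ K a * T + algebraMap ℂ K b), φ (σ (φ.symm T)) = -T) :
    (∃ k θ, k ≠ 0 ∧ moebiusProd α β a b c d = evenSextic k θ) ∧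
      Nonempty (CurveField (linearProd α β) ≃ₐ[ℂ] CurveField (moebiusProd α β a b c d)) := by
  have hg := hasDistinctZeros_moebiusProd (by norm_num) h hdet
  have : Fact (IsCurvePoly (moebiusProd α β a b c d)) := ⟨hg.isCurvePoly⟩
  have hT := curveT_transcendental (moebiusProd α β a b c d)
  obtain ⟨φ, hφ⟩ := exists_curveEquiv_of_generators hdet hT
    (curveZ_sq_eq_aeval (moebiusProd α β a b c d)) intermediateField_eq_top
  have h1 := hconj (CurveField (moebiusProd α β a b c d)) _ hT φ hφ
  refine ⟨exists_eq_evenSextic hg (comp_neg_X_eq_of_involution hg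
    (τ := AlgEquiv.autCongr φ σ) ?_ h1), ⟨φ⟩⟩
  rw [MulEquiv.orderOf_eq, hσ]

/-- Translation by b / 2 moves the finite fixed point of t ↦ b - t to the origin. -/
theorem exists_even_of_map_eq_sub {α β : Fin 6 → ℂ} (h : HasDistinctZeros 6 (linearProd α β))
    [Fact (IsCurvePoly (linearProd α β))]
    {σ : CurveField (linearProd α β) ≃ₐ[ℂ] CurveField (linearProd α β)} (hσ : orderOf σ = 2) {b : ℂ}
    (hb : σ (curveT (linearProd α β)) = algebraMap ℂ (CurveField (linearProd α β)) b -
      curveT (linearProd α β)) :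
    (∃ k θ, k ≠ 0 ∧ moebiusProd α β 1 (b / 2) 0 1 = evenSextic k θ) ∧
      Nonempty (CurveField (linearProd α β) ≃ₐ[ℂ] CurveField (moebiusProd α β 1 (b / 2) 0 1)) := by
  refine exists_moebiusProd_eq_evenSextic_of_conj h (by norm_num) hσ ?_
  intro K _ _ T hT φ hφ
  rw [map_zero, zero_mul, zero_add, map_one, mul_one, one_mul] at hφ
  have h1 : φ.symm T = curveT (linearProd α β) -
      algebraMap ℂ (CurveField (linearProd α β)) (b / 2) := by
    rw [AlgEquiv.symm_apply_eq, map_sub, hφ, AlgEquiv.commutes]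
    ring
  have h2 : algebraMap ℂ K b = 2 * algebraMap ℂ K (b / 2) := by
    rw [← map_ofNat (algebraMap ℂ K) 2, ← map_mul]
    congr 1
    ring
  rw [h1, map_sub, hb, AlgEquiv.commutes, map_sub, map_sub, hφ, AlgEquiv.commutes,
    AlgEquiv.commutes, h2]
  ring

/-- A sextic whose curve has an extra involution is even in a suitable coordinate. -/
theorem exists_moebiusProd_eq_evenSextic {α β : Fin 6 → ℂ}
    (h : HasDistinctZeros 6 (linearProd α β)) (hex : HasExtraInvolution (linearProd α β)) :
    ∃ a b c d : ℂ, a * d - b * c ≠ 0 ∧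
      (∃ k θ, k ≠ 0 ∧ moebiusProd α β a b c d = evenSextic k θ) ∧
      Nonempty (CurveField (linearProd α β) ≃ₐ[ℂ] CurveField (moebiusProd α β a b c d)) := by
  have : Fact (IsCurvePoly (linearProd α β)) := ⟨h.isCurvePoly⟩
  obtain ⟨σ, hσ⟩ := hex
  have hne := hσ.map_curveT_ne
  have hσσ := map_map_of_orderOf_two hσ.1 (curveT (linearProd α β))
  obtain ⟨p, q, hp, hq, hq0, hpq⟩ := exists_moebius h σ hσσ
  obtain ⟨m1, m2, rfl⟩ := exists_eq_X_add_C_of_natDegree_le_one hp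
  obtain ⟨m3, m4, rfl⟩ := exists_eq_X_add_C_of_natDegree_le_one hq
  simp only [map_add, map_mul, aeval_C, aeval_X] at hpq
  have hT := curveT_transcendental (linearProd α β)
  have hpq' := congrArg σ hpq
  simp only [map_add, map_mul, AlgEquiv.commutes, hσσ] at hpq'
  -- A non-trivial involutive Möbius transformation has trace zero: the relation and its image under
  -- σ differ by (m4 + m1)(σ t - t).
  have h14 : m4 = -m1 := by
    have h1 : algebraMap ℂ (CurveField (linearProd α β)) (m4 + m1) = 0 := by
      refine (mul_eq_zero.1 ?_).resolve_right (sub_ne_zero.2 hne)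
      rw [map_add]
      linear_combination hpq - hpq'
    have h2 := (map_eq_zero _).1 h1
    linear_combination h2
  subst h14
  by_cases h3 : m3 = 0
  · subst h3
    have hm1 : m1 ≠ 0 := by
      rintro rfl
      simp at hq0
    have hm1' : algebraMap ℂ (CurveField (linearProd α β)) m1 ≠ 0 := (_root_.map_ne_zero _).2 hm1
    obtain ⟨h1, h2⟩ := exists_even_of_map_eq_sub h hσ.1 (b := -m2 / m1) (by
      apply mul_left_cancel₀ hm1'
      rw [mul_sub, ← map_mul, mul_div_cancel₀ _ hm1, map_neg]
      rw [map_zero, map_neg] at hpq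
      linear_combination -hpq)
    exact ⟨1, -m2 / m1 / 2, 0, 1, by norm_num, h1, h2⟩
  -- The fixed points are (m1 ± l) / m3, and with the centre m1 / m3 as origin the involution reads
  -- V U = constant, which is `key`.
  · obtain ⟨l, hl⟩ : ∃ l : ℂ, l ^ 2 = m1 ^ 2 + m2 * m3 := IsAlgClosed.exists_pow_nat_eq _ two_pos
    have key : ∀ (K : Type) [Field K] [Algebra ℂ K] (V U : K),
        (algebraMap ℂ K m3 * V + algebraMap ℂ K (-m1)) * U =
          algebraMap ℂ K m1 * V + algebraMap ℂ K m2 →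
        (algebraMap ℂ K m3 * V - algebraMap ℂ K m1) * (algebraMap ℂ K m3 * U - algebraMap ℂ K m1) =
          algebraMap ℂ K l ^ 2 := by
      intro K _ _ V U hVU
      rw [map_neg] at hVU
      rw [← map_pow, hl, map_add, map_mul, map_pow]
      linear_combination algebraMap ℂ K m3 * hVU
    have hl0 : l ≠ 0 := by
      rintro rfl
      have h1 := key _ _ _ hpq
      rw [map_zero, zero_pow two_ne_zero] at h1
      have h2 : algebraMap ℂ (CurveField (linearProd α β)) m3 * curveT (linearProd α β) -
          algebraMap ℂ (CurveField (linearProd α β)) m1 ≠ 0 := by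
        intro h0
        refine h3 (linear_eq_zero_of_injective_aeval hT (x := -m1) (y := m3) ?_).2
        rw [map_neg]
        linear_combination h0
      have h4 := (mul_eq_zero.1 h1).resolve_left h2
      apply h2
      have h5 := congrArg σ h4
      rwa [map_sub, map_mul, AlgEquiv.commutes, AlgEquiv.commutes, hσσ, map_zero] at h5
    -- The new coordinate T is given by t = ((m1 - l) T + (m1 + l)) / (m3 T + m3), so the two fixed
    -- points lie at T = 0 and T = ∞.
    have hdet : (m1 - l) * m3 - (m1 + l) * m3 ≠ 0 := by
      have : (m1 - l) * m3 - (m1 + l) * m3 = -2 * (l * m3) := by ring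
      rw [this]
      exact mul_ne_zero (by norm_num) (mul_ne_zero hl0 h3)
    obtain ⟨h1, h2⟩ := exists_moebiusProd_eq_evenSextic_of_conj h hdet hσ.1 (by
      intro K _ _ T hT φ hφ
      have e3 := key K (φ (curveT (linearProd α β))) (φ (σ (curveT (linearProd α β)))) (by
        have := congrArg φ hpq
        simpa only [map_add, map_mul, AlgEquiv.commutes] using this)
      have e2 := congrArg (fun x => φ (σ (φ.symm x))) hφ
      simp only [map_add, map_sub, map_mul, AlgEquiv.commutes, AlgEquiv.symm_apply_apply] at e2 hφ
      have hl0' : algebraMap ℂ K l ≠ 0 := (_root_.map_ne_zero _).2 hl0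
      have h2K : (2 : K) ≠ 0 := by
        rw [← map_ofNat (algebraMap ℂ K) 2]
        exact (_root_.map_ne_zero _).2 two_ne_zero
      generalize φ (σ (φ.symm T)) = T' at *
      generalize φ (curveT (linearProd α β)) = V at *
      generalize φ (σ (curveT (linearProd α β))) = U at *
      have e1 : (algebraMap ℂ K m3 * V - algebraMap ℂ K m1) * (1 + T) =
          algebraMap ℂ K l * (1 - T) := by linear_combination hφ
      have e2' : (algebraMap ℂ K m3 * U - algebraMap ℂ K m1) * (1 + T') =
          algebraMap ℂ K l * (1 - T') := by linear_combination e2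
      have e4 : algebraMap ℂ K l ^ 2 * ((1 + T) * (1 + T')) =
          algebraMap ℂ K l ^ 2 * ((1 - T) * (1 - T')) := by
        calc _ = ((algebraMap ℂ K m3 * V - algebraMap ℂ K m1) * (1 + T)) *
              ((algebraMap ℂ K m3 * U - algebraMap ℂ K m1) * (1 + T')) := by
              rw [← e3]; ring
          _ = _ := by rw [e1, e2']; ring
      have e5 := mul_left_cancel₀ (pow_ne_zero 2 hl0') e4
      have e6 : 2 * (T' + T) = 0 := by linear_combination e5
      exact eq_neg_of_add_eq_zero_left ((mul_eq_zero.1 e6).resolve_left h2K))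
    exact ⟨_, _, _, _, hdet, h1, h2⟩

theorem exists_even_of_extraInvolutionFixingInfinity {α β : Fin 6 → ℂ}
    (h : HasDistinctZeros 6 (linearProd α β))
    (hex : HasExtraInvolutionFixingInfinity (linearProd α β)) :
    ∃ b k θ, k ≠ 0 ∧ moebiusProd α β 1 b 0 1 = evenSextic k θ := by
  have : Fact (IsCurvePoly (linearProd α β)) := ⟨h.isCurvePoly⟩
  obtain ⟨σ, hσ, a, b, hab⟩ := hex
  have hne := hσ.map_curveT_ne
  have hσσ := map_map_of_orderOf_two hσ.1 (curveT (linearProd α β))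
  have hT := curveT_transcendental (linearProd α β)
  rw [hab, map_add, map_mul, AlgEquiv.commutes, AlgEquiv.commutes, hab] at hσσ
  obtain ⟨h1, h2⟩ := linear_eq_zero_of_injective_aeval hT (x := a * b + b) (y := a * a - 1) (by
    simp only [map_add, map_sub, map_mul, map_one]
    linear_combination hσσ)
  -- From a² = 1, the case a = 1 forces b = 0 and makes the involution fix t, which is excluded.
  have ha : a = -1 := by
    rcases mul_self_eq_one_iff.1 (sub_eq_zero.1 h2) with rfl | ha
    · exfalso
      apply hne
      have hb : b = 0 := by linear_combination h1 / 2
      rw [hab, hb, map_one, map_zero, one_mul, add_zero]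
    · exact ha
  subst ha
  exact ⟨_, (exists_even_of_map_eq_sub h hσ.1 (b := b) (by
    rw [hab, map_neg, map_one]; ring)).1⟩

/-! ### Pencils with prescribed curve -/

theorem exists_isGeneralPair {θ : Fin 3 → ℂ} (h : Function.Injective θ) (h0 : ∀ k, θ k ≠ 0) :
    ∃ A B, IsGeneralPair A B ∧
      pencilPoly (battagliniMatrix A B) kleinMatrix = evenSextic (-1) θ := by
  have : ∀ k, ∃ p : ℂ, p ^ 2 = -θ k := fun k => IsAlgClosed.exists_pow_nat_eq _ two_pos
  choose p hp using this
  -- Lagrange's solution of the quartic: the entries have sum zero and b 0 + b 1, b 0 + b 2, b 0 + b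
  -- 3 are p 0, p 1, p 2. So each resolvent root is -p k ^ 2 = θ k.
  let b : Fin 4 → ℂ := ![(p 0 + p 1 + p 2) / 2, (p 0 - p 1 - p 2) / 2, (p 1 - p 0 - p 2) / 2,
    (p 2 - p 0 - p 1) / 2]
  have hf : pencilPoly (battagliniMatrix (diagonal 1) (diagonal b)) kleinMatrix =
      evenSextic (-1) θ := by
    rw [pencilPoly_battagliniMatrix (isSymm_diagonal _) (isSymm_diagonal _)
      (pencilPoly_diagonal 1 b)]
    congr 1
    ext k
    fin_cases k
    · simp [resolventRoots, b]
      linear_combination -hp 0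
    · simp [resolventRoots, b]
      linear_combination -hp 1
    · simp [resolventRoots, b]
      linear_combination -hp 2
  have h6 := (hasDistinctZeros_evenSextic_iff (c := -1) (by norm_num) θ).2 ⟨h, h0⟩
  rw [← hf, hasDistinctZeros_battaglini_pencil_iff (isSymm_diagonal _) (isSymm_diagonal _)] at h6
  exact ⟨_, _, ⟨isSymm_diagonal _, isSymm_diagonal _, h6⟩, hf⟩

theorem pencilPoly_combination {P Q : Matrix (Fin 6) (Fin 6) ℂ} {α β : Fin 6 → ℂ}
    (h : pencilPoly P Q = linearProd α β) (a b c d : ℂ) :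
    pencilPoly (d • P + b • Q) (c • P + a • Q) = moebiusProd α β a b c d := by
  refine Polynomial.funext fun t => ?_
  have h1 : d • P + b • Q + t • (c • P + a • Q) = (d + t * c) • P + (b + t * a) • Q := by
    module
  have h2 : pencilPoly P Q = C 1 * linearProd α β := by rw [h, C_1, one_mul]
  rw [eval_pencilPoly, h1, det_pencil_eq_prod h2, moebiusProd, eval_linearProd, one_mul]
  refine Finset.prod_congr rfl fun i _ => ?_
  ring

theorem span_pair_combination {V : Type*} [AddCommGroup V] [Module ℂ V] (P Q : V) {a b c d : ℂ}
    (h : a * d - b * c ≠ 0) :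
    Submodule.span ℂ {d • P + b • Q, c • P + a • Q} = Submodule.span ℂ {P, Q} := by
  refine le_antisymm (Submodule.span_le.2 ?_) (Submodule.span_le.2 ?_)
  · rintro x (rfl | rfl)
    · exact Submodule.mem_span_pair.2 ⟨d, b, rfl⟩
    · exact Submodule.mem_span_pair.2 ⟨c, a, rfl⟩
  · have hI := mul_inv_cancel₀ h
    set I := (a * d - b * c)⁻¹
    rintro x (rfl | rfl)
    · refine Submodule.mem_span_pair.2 ⟨a * I, -b * I, ?_⟩
      match_scalars
      · linear_combination hI
      · ring
    · refine Submodule.mem_span_pair.2 ⟨-c * I, d * I, ?_⟩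
      match_scalars
      · ring
      · linear_combination hI

/-- Congruence normal forms depend only on the characteristic roots; the scalars k and k' are
absorbed by the determinants of V and W. Normalizing the second member to the identity makes the
columns orthonormal for it. -/
theorem exists_common_diagonalization {P Q P' Q' : Matrix (Fin 6) (Fin 6) ℂ} (hP : P.IsSymm)
    (hQ : Q.IsSymm) (hP' : P'.IsSymm) (hQ' : Q'.IsSymm) {k k' : ℂ} {θ : Fin 3 → ℂ} (hk : k ≠ 0)
    (hk' : k' ≠ 0) (hθ : Function.Injective θ ∧ ∀ k, θ k ≠ 0)
    (h : pencilPoly P Q = evenSextic k θ) (h' : pencilPoly P' Q' = evenSextic k' θ) :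
    ∃ (V W : Matrix (Fin 6) (Fin 6) ℂ) (a : Fin 6 → ℂ), IsUnit V.det ∧ IsUnit W.det ∧
      Vᵀ * P * V = diagonal a ∧ Wᵀ * P' * W = diagonal a ∧
      Vᵀ * Q * V = 1 ∧ Wᵀ * Q' * W = 1 := by
  have : ∀ k, ∃ τ : ℂ, τ ^ 2 = θ k := fun k => IsAlgClosed.exists_pow_nat_eq _ two_pos
  choose τ hτ using this
  have hd := (hasDistinctZeros_evenSextic_iff one_ne_zero θ).2 hθ
  rw [evenSextic_eq hτ, hasDistinctZeros_C_mul_iff one_ne_zero,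
    hasDistinctZeros_linearProd_iff (by norm_num)] at hd
  rw [evenSextic_eq hτ] at h h'
  have h1 : (diagonal ![1, 1, 1, 1, 1, 1] : Matrix (Fin 6) (Fin 6) ℂ) = 1 := by
    rw [← diagonal_one]
    congr 1
    ext i
    fin_cases i <;> rfl
  obtain ⟨V, hV, hVP, hVQ⟩ :=
    exists_simultaneous_diagonalization (by norm_num) hP hQ hk hd h
  obtain ⟨W, hW, hWP, hWQ⟩ :=
    exists_simultaneous_diagonalization (by norm_num) hP' hQ' hk' hd h'
  exact ⟨V, W, _, hV, hW, hVP, hWP, hVQ.trans h1, hWQ.trans h1⟩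

/-- The Möbius transformation that makes the sextic even is a change of basis of the pencil. The new
basis and that of a Battaglini pencil have a common diagonal form, and V * W⁻¹ carries one to the
other. -/
theorem exists_isGeneralPair_congruent {P Q : Matrix (Fin 6) (Fin 6) ℂ} (hP : P.IsSymm)
    (hQ : Q.IsSymm) (h : HasDistinctZeros 6 (pencilPoly P Q))
    (hex : HasExtraInvolution (pencilPoly P Q)) :
    ∃ A B, IsGeneralPair A B ∧ ∃ g : Matrix (Fin 6) (Fin 6) ℂ, IsUnit g.det ∧
      Submodule.span ℂ {gᵀ * P * g, gᵀ * Q * g} =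
        Submodule.span ℂ {battagliniMatrix A B, kleinMatrix} := by
  obtain ⟨α, β, hαβ⟩ := exists_eq_linearProd _ (natDegree_pencilPoly_le P Q)
  rw [hαβ] at h hex
  obtain ⟨a, b, c, d, hdet, ⟨k, θ, hk, hkθ⟩, -⟩ := exists_moebiusProd_eq_evenSextic h hex
  have h6 := hasDistinctZeros_moebiusProd (by norm_num) h hdet
  rw [hkθ, hasDistinctZeros_evenSextic_iff hk] at h6
  obtain ⟨A, B, hAB, hM⟩ := exists_isGeneralPair h6.1 h6.2
  obtain ⟨V, W, _, hV, hW, hVP, hWP, hV1, hW1⟩ := exists_common_diagonalization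
    ((hP.smul d).add (hQ.smul b)) ((hP.smul c).add (hQ.smul a))
    (battagliniMatrix_isSymm hAB.1 hAB.2.1) kleinMatrix_isSymm hk (by norm_num) h6
    ((pencilPoly_combination hαβ a b c d).trans hkθ) hM
  have hWinv : W * W⁻¹ = 1 := mul_nonsing_inv _ hW
  have hWinvT : (W⁻¹)ᵀ * Wᵀ = 1 := by rw [← transpose_mul, hWinv, transpose_one]
  have hback : ∀ S T : Matrix (Fin 6) (Fin 6) ℂ, Vᵀ * S * V = Wᵀ * T * W →
      (V * W⁻¹)ᵀ * S * (V * W⁻¹) = T := fun S T hST => by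
    calc (V * W⁻¹)ᵀ * S * (V * W⁻¹) = (W⁻¹)ᵀ * (Vᵀ * S * V) * W⁻¹ := by
          rw [transpose_mul]; noncomm_ring
      _ = ((W⁻¹)ᵀ * Wᵀ) * T * (W * W⁻¹) := by rw [hST]; noncomm_ring
      _ = T := by rw [hWinv, hWinvT, one_mul, mul_one]
  refine ⟨A, B, hAB, V * W⁻¹, ?_, ?_⟩
  · rw [det_mul]
    exact hV.mul ((isUnit_nonsing_inv_det_iff).2 hW)
  · rw [← span_pair_combination _ _ hdet, ← hback _ _ (hVP.trans hWP.symm),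
      ← hback _ _ (hV1.trans hW1.symm)]
    congr 2 <;> simp [mul_add, add_mul]

theorem exists_isGeneralPair_curveEquiv {f : ℂ[X]} (h : HasDistinctZeros 6 f)
    (hex : HasExtraInvolution f) :
    ∃ A B, IsGeneralPair A B ∧ Nonempty (CurveField f ≃ₐ[ℂ]
      CurveField (pencilPoly (battagliniMatrix A B) kleinMatrix)) := by
  obtain ⟨α, β, rfl⟩ := exists_eq_linearProd f (d := 5) h.natDegree_le
  obtain ⟨a, b, c, d, hdet, ⟨k, θ, hk, hkθ⟩, ⟨φ⟩⟩ := exists_moebiusProd_eq_evenSextic h hex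
  have h6 := hasDistinctZeros_moebiusProd (by norm_num) h hdet
  rw [hkθ] at h6 φ
  have hθ := (hasDistinctZeros_evenSextic_iff hk θ).1 h6
  obtain ⟨A, B, hAB, hM⟩ := exists_isGeneralPair hθ.1 hθ.2
  have h1 : HasDistinctZeros 6 (evenSextic (-1) θ) :=
    (hasDistinctZeros_evenSextic_iff (by norm_num) θ).2 hθ
  have hmul : evenSextic k θ = C (-k) * evenSextic (-1) θ := by
    simp [evenSextic]
  rw [hmul] at h6 φ
  obtain ⟨ψ⟩ := nonempty_curveEquiv_C_mul (neg_ne_zero.2 hk) h1.isCurvePoly h6.isCurvePoly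
  exact ⟨A, B, hAB, hM ▸ ⟨φ.trans ψ⟩⟩

/-! ### The extra involution of the pencil of a Battaglini quadric -/

theorem IsGeneralPair.det_neg {A B : Matrix (Fin 4) (Fin 4) ℂ} (h : IsGeneralPair A B) (t : ℂ) :
    (battagliniMatrix A B + (-t) • kleinMatrix).det =
      (battagliniMatrix A B + t • kleinMatrix).det := by
  rw [det_battaglini_pencil h.1 h.2.1, det_battaglini_pencil h.1 h.2.1, neg_sq]

/-- For Q = x AB + y G the evenness in t becomes symmetry about t = -y, that is, under t ↦ -2y - t.
The coefficient x is non-zero, since a multiple of G alone would give a sixth power. -/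
theorem hasExtraInvolutionFixingInfinity_of_mem_span {A B : Matrix (Fin 4) (Fin 4) ℂ}
    (hAB : IsGeneralPair A B) {Q : Matrix (Fin 6) (Fin 6) ℂ}
    (h : HasDistinctZeros 6 (pencilPoly Q kleinMatrix))
    (hQ : Q ∈ Submodule.span ℂ {battagliniMatrix A B, kleinMatrix}) :
    HasExtraInvolutionFixingInfinity (pencilPoly Q kleinMatrix) := by
  obtain ⟨x, y, rfl⟩ := Submodule.mem_span_pair.1 hQ
  refine hasExtraInvolutionFixingInfinity_of_comp_eq h.isCurvePoly (b := -2 * y) ?_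
  have hx : x ≠ 0 := by
    rintro rfl
    have h1 : pencilPoly ((0 : ℂ) • battagliniMatrix A B + y • kleinMatrix) kleinMatrix =
        (X + C y) * (X + C y) * (C kleinMatrix.det * (X + C y) ^ 4) := by
      refine Polynomial.funext fun t => ?_
      rw [eval_pencilPoly, zero_smul, zero_add, ← add_smul, det_smul]
      simp
      ring
    have h2 := h.1 _ ⟨_, h1⟩
    exact not_isUnit_of_natDegree_pos _ (by rw [natDegree_X_add_C]; norm_num) h2
  have key : ∀ s : ℂ, (x • battagliniMatrix A B + s • kleinMatrix).det =
      x ^ 6 * (battagliniMatrix A B + (s / x) • kleinMatrix).det := fun s => by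
    have h1 := det_smul (battagliniMatrix A B + (s / x) • kleinMatrix) x
    rwa [smul_add, smul_smul, mul_div_cancel₀ _ hx, Fintype.card_fin] at h1
  refine Polynomial.funext fun t => ?_
  rw [eval_comp, eval_pencilPoly, eval_pencilPoly, add_assoc, add_assoc, ← add_smul, ← add_smul,
    key, key, ← hAB.det_neg ((y + t) / x)]
  congr 4
  simp
  ring

/-! ### Isometries of the Klein form -/

/-- The bilinear form of the Klein quadric. -/
noncomputable def kleinForm : LinearMap.BilinForm ℂ (Fin 6 → ℂ) := Matrix.toBilin' kleinMatrix

theorem kleinForm_eq (x y : Fin 6 → ℂ) : kleinForm x y = x ⬝ᵥ kleinMatrix *ᵥ y :=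
  Matrix.toBilin'_apply' _ _ _

theorem kleinForm_apply (x y : Fin 6 → ℂ) : kleinForm x y =
    x 0 * y 3 + x 3 * y 0 + (x 1 * y 4 + x 4 * y 1) + (x 2 * y 5 + x 5 * y 2) := by
  rw [kleinForm_eq, kleinMatrix_bilin]

theorem kleinForm_comm (x y : Fin 6 → ℂ) : kleinForm x y = kleinForm y x := by
  simp only [kleinForm_apply]
  ring

/-- The coordinates of the dual bivector. -/
def kleinDual : (Fin 6 → ℂ) →ₗ[ℂ] (Fin 6 → ℂ) where
  toFun x := ![x 3, x 4, x 5, x 0, x 1, x 2]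
  map_add' x y := by ext i; fin_cases i <;> simp
  map_smul' c x := by ext i; fin_cases i <;> simp

theorem kleinDual_kleinDual (x : Fin 6 → ℂ) : kleinDual (kleinDual x) = x := by
  ext i
  fin_cases i <;> simp [kleinDual]

theorem kleinForm_kleinDual (x y : Fin 6 → ℂ) :
    kleinForm (kleinDual x) (kleinDual y) = kleinForm x y := by
  simp only [kleinForm_apply, kleinDual, LinearMap.coe_mk, AddHom.coe_mk, cons_val]
  ring

/-- The reflection in the hyperplane orthogonal to `s` with respect to the Klein form. -/
noncomputable def kleinReflection (s : Fin 6 → ℂ) : (Fin 6 → ℂ) →ₗ[ℂ] (Fin 6 → ℂ) :=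
  LinearMap.id - (2 / kleinForm s s) • (kleinForm s).smulRight s

theorem kleinReflection_apply (s x : Fin 6 → ℂ) :
    kleinReflection s x = x - (2 / kleinForm s s * kleinForm s x) • s := by
  simp [kleinReflection, smul_smul]

theorem kleinForm_kleinReflection {s : Fin 6 → ℂ} (hs : kleinForm s s ≠ 0) (x y : Fin 6 → ℂ) :
    kleinForm (kleinReflection s x) (kleinReflection s y) = kleinForm x y := by
  simp only [kleinReflection_apply, map_sub, map_smul, LinearMap.sub_apply, LinearMap.smul_apply,
    smul_eq_mul]
  rw [kleinForm_comm x s]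
  field_simp
  ring

/-- Reflection in v - w takes v to w unless v - w is isotropic; then v + w is not, and reflection in
it takes v to -w. Allowing the sign makes exactly one reflection suffice even when v = w, which
keeps the parity of the total number under control. -/
theorem exists_kleinReflection_eq {v w : Fin 6 → ℂ} (hv : kleinForm v v = 1)
    (hw : kleinForm w w = 1) : ∃ s, kleinForm s s ≠ 0 ∧
      (kleinReflection s v = w ∨ kleinReflection s v = -w) ∧
      ∀ u, kleinForm u v = 0 → kleinForm u w = 0 → kleinReflection s u = u := by
  by_cases h : kleinForm v w = 1
  · have hs : kleinForm (v + w) (v + w) = 4 := by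
      simp only [map_add, LinearMap.add_apply, hv, hw, kleinForm_comm w v, h]
      norm_num
    refine ⟨v + w, by rw [hs]; norm_num, Or.inr ?_, fun u hu1 hu2 => ?_⟩
    · rw [kleinReflection_apply, hs]
      simp only [map_add, LinearMap.add_apply, hv, kleinForm_comm w v, h]
      norm_num
    · rw [kleinReflection_apply, kleinForm_comm (v + w) u, map_add (kleinForm u), hu1, hu2]
      simp
  · have hs : kleinForm (v - w) (v - w) = 2 * kleinForm (v - w) v := by
      simp only [map_sub, LinearMap.sub_apply, hv, hw, kleinForm_comm w v]
      ring
    have hne : kleinForm (v - w) v ≠ 0 := by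
      simp only [map_sub, LinearMap.sub_apply, hv, kleinForm_comm w v]
      exact sub_ne_zero.2 (Ne.symm h)
    refine ⟨v - w, by rw [hs]; exact mul_ne_zero two_ne_zero hne, Or.inl ?_, fun u hu1 hu2 => ?_⟩
    · rw [kleinReflection_apply, hs, show 2 / (2 * kleinForm (v - w) v) * kleinForm (v - w) v = 1 by
        field_simp]
      simp
    · rw [kleinReflection_apply, kleinForm_comm (v - w) u, map_sub (kleinForm u), hu1, hu2]
      simp

/-- A bivector s off the Klein quadric is a null polarity, hence a correlation. On bivectors it acts
as the reflection in s, up to a factor, composed with duality. -/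
theorem bivector_mul_bivector_kleinDual_mul (s x : Fin 6 → ℂ) :
    bivector s * bivector (kleinDual x) * (bivector s)ᵀ =
      bivector (kleinForm s x • s - (kleinForm s s / 2) • x) := by
  ext i j
  fin_cases i <;> fin_cases j <;>
    simp [bivector, kleinForm_apply, kleinDual, Matrix.mul_apply, Fin.sum_univ_four] <;> ring

theorem bivector_kleinReflection {s : Fin 6 → ℂ} (hs : kleinForm s s ≠ 0) (x : Fin 6 → ℂ) :
    bivector (kleinReflection s x) = (-2 / kleinForm s s) •
      (bivector s * bivector (kleinDual x) * (bivector s)ᵀ) := by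
  rw [bivector_mul_bivector_kleinDual_mul, ← bivector_smul, kleinReflection_apply]
  congr 1
  match_scalars <;> field_simp

theorem kleinDual_kleinReflection (s x : Fin 6 → ℂ) :
    kleinDual (kleinReflection s x) = kleinReflection (kleinDual s) (kleinDual x) := by
  rw [kleinReflection_apply, kleinReflection_apply, map_sub, map_smul, kleinForm_kleinDual,
    kleinForm_kleinDual]

theorem exists_smul_congruence (c : ℂ) (h : Matrix (Fin 4) (Fin 4) ℂ) :
    ∃ h' : Matrix (Fin 4) (Fin 4) ℂ, ∀ X, h' * X * h'ᵀ = c • (h * X * hᵀ) := by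
  obtain ⟨μ, hμ⟩ : ∃ μ : ℂ, μ ^ 2 = c := IsAlgClosed.exists_pow_nat_eq _ two_pos
  refine ⟨μ • h, fun X => ?_⟩
  simp only [transpose_smul, Matrix.smul_mul, Matrix.mul_smul, smul_smul, ← hμ, sq]

/-- A composition of `m` reflections is induced by a collineation or a correlation of twistor space
according to the parity of `m`. -/
theorem exists_map_orthonormal (m : ℕ) : ∀ k, m + k = 6 → ∀ v w : Fin 6 → Fin 6 → ℂ,
    (∀ i j, kleinForm (v i) (v j) = if i = j then 1 else 0) →
    (∀ i j, kleinForm (w i) (w j) = if i = j then 1 else 0) →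
    (∀ i : Fin 6, i.1 < k → v i = w i ∨ v i = -w i) →
    ∃ T : (Fin 6 → ℂ) →ₗ[ℂ] (Fin 6 → ℂ), (∀ i, T (v i) = w i ∨ T (v i) = -w i) ∧
      ∃ h : Matrix (Fin 4) (Fin 4) ℂ, (Even m → ∀ x, bivector (T x) = h * bivector x * hᵀ) ∧
        (¬ Even m → ∀ x, bivector (T x) = h * bivector (kleinDual x) * hᵀ) := by
  induction m with
  | zero =>
    intro k hk v w _ _ h
    exact ⟨LinearMap.id, fun i => h i (by omega), 1, by simp, by simp⟩
  | succ m ih =>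
    intro k hk v w hv hw h
    let i₀ : Fin 6 := ⟨k, by omega⟩
    obtain ⟨s, hs, hs1, hs2⟩ := exists_kleinReflection_eq (v := v i₀) (w := w i₀)
      (by simp [hv]) (by simp [hw])
    -- The vectors already aligned are orthogonal to v i₀ and w i₀, so the new reflection leaves
    -- them alone.
    obtain ⟨T, hT, h', hE, hO⟩ := ih (k + 1) (by omega) (fun i => kleinReflection s (v i)) w
      (fun i j => by rw [kleinForm_kleinReflection hs, hv]) hw (fun i hi => by
        rcases Nat.lt_succ_iff_lt_or_eq.1 hi with hi | hi
        · have hne : i ≠ i₀ := fun h => hi.ne (congrArg Fin.val h)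
          have h1 : kleinForm (v i) (v i₀) = 0 := by simp [hv, hne]
          have h2 : kleinForm (v i) (w i₀) = 0 := by
            rcases h i hi with h3 | h3 <;> rw [h3] <;> simp [hw, hne]
          rw [hs2 _ h1 h2]
          exact h i hi
        · have : i = i₀ := Fin.ext hi
          rw [this]
          exact hs1)
    -- A reflection is a congruence of the dual bivector, so each further one toggles between x and
    -- its dual. Its scalar factor is absorbed by a square root.
    refine ⟨T ∘ₗ kleinReflection s, hT, ?_⟩
    by_cases hm : Even m
    · obtain ⟨g, hg⟩ := exists_smul_congruence (-2 / kleinForm s s) (h' * bivector s)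
      refine ⟨g, fun h2 => absurd hm (Nat.even_add_one.1 h2), fun _ x => ?_⟩
      rw [hg, LinearMap.comp_apply, hE hm, bivector_kleinReflection hs, transpose_mul]
      simp only [Matrix.smul_mul, Matrix.mul_smul, Matrix.mul_assoc]
    · obtain ⟨g, hg⟩ := exists_smul_congruence (-2 / kleinForm s s) (h' * bivector (kleinDual s))
      refine ⟨g, fun _ x => ?_, fun h2 => absurd (Nat.even_add_one.2 hm) h2⟩
      rw [hg, LinearMap.comp_apply, hO hm, kleinDual_kleinReflection,
        bivector_kleinReflection (by rwa [kleinForm_kleinDual]), transpose_mul,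
        kleinForm_kleinDual, kleinDual_kleinDual]
      simp only [Matrix.smul_mul, Matrix.mul_smul, Matrix.mul_assoc]

/-- Aligning six vectors takes six reflections, an even number, so the map comes from a collineation
h. The price is a sign e i on each vector. -/
theorem exists_bivectorMap_of_orthonormal {V W : Matrix (Fin 6) (Fin 6) ℂ}
    (hV : Vᵀ * kleinMatrix * V = 1) (hW : Wᵀ * kleinMatrix * W = 1) :
    ∃ (h : Matrix (Fin 4) (Fin 4) ℂ) (e : Fin 6 → ℂ), (∀ i, e i * e i = 1) ∧
      LinearMap.toMatrix' (bivectorMap h) * V = W * diagonal e := by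
  have hform : ∀ {U : Matrix (Fin 6) (Fin 6) ℂ}, Uᵀ * kleinMatrix * U = 1 → ∀ i j,
      kleinForm (fun k => U k i) (fun k => U k j) = if i = j then 1 else 0 := by
    intro U hU i j
    rw [kleinForm_eq, ← Matrix.one_apply, ← hU, transpose_mul_mul_apply]
    rfl
  obtain ⟨T, hT, h, hE, -⟩ := exists_map_orthonormal 6 0 rfl (fun i k => V k i) (fun i k => W k i)
    (hform hV) (hform hW) (by simp)
  have hTh : T = bivectorMap h := LinearMap.ext fun x => bivector_injective (by
    rw [hE (by decide), bivector_bivectorMap])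
  have : ∀ i, ∃ c : ℂ, c * c = 1 ∧ T (fun k => V k i) = c • fun k => W k i := fun i => by
    rcases hT i with h | h
    · exact ⟨1, by norm_num, by rw [h, one_smul]⟩
    · exact ⟨-1, by norm_num, by rw [h, neg_one_smul]⟩
  choose e he1 he2 using this
  refine ⟨h, e, he1, ?_⟩
  ext i j
  have h1 := congrFun (he2 j) i
  rw [hTh, ← LinearMap.toMatrix'_mulVec] at h1
  rw [mul_diagonal, mul_comm]
  exact h1

theorem Matrix.IsSymm.transpose_mul_mul {n : ℕ} {A : Matrix (Fin n) (Fin n) ℂ} (h : A.IsSymm)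
    (g : Matrix (Fin n) (Fin n) ℂ) : (gᵀ * A * g).IsSymm := by
  rw [IsSymm, Matrix.transpose_mul, Matrix.transpose_mul, transpose_transpose, h.eq,
    Matrix.mul_assoc]

/-- An involution fixing infinity needs only a translation of t, which replaces Q by Q + bG and
leaves G alone. Both pencils are then diagonalized with G the identity, and the collineation
comparing the bases pulls (A, B) back to the required pair. The signs e i drop out because a
diagonal form sees only their squares. -/
theorem exists_isGeneralPair_span_eq {Q : Matrix (Fin 6) (Fin 6) ℂ} (hQ : Q.IsSymm)
    (h : HasDistinctZeros 6 (pencilPoly Q kleinMatrix))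
    (hex : HasExtraInvolutionFixingInfinity (pencilPoly Q kleinMatrix)) :
    ∃ A B, IsGeneralPair A B ∧ Submodule.span ℂ {Q, kleinMatrix} =
      Submodule.span ℂ {battagliniMatrix A B, kleinMatrix} := by
  obtain ⟨α, β, hαβ⟩ := exists_eq_linearProd _ (natDegree_pencilPoly_le Q kleinMatrix)
  rw [hαβ] at h hex
  obtain ⟨b, k, θ, hk, hkθ⟩ := exists_even_of_extraInvolutionFixingInfinity h hex
  have h6 := hasDistinctZeros_moebiusProd (a := 1) (b := b) (c := 0) (d := 1) (by norm_num) h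
    (by simp)
  have hpoly := pencilPoly_combination hαβ 1 b 0 1
  have hspan := span_pair_combination Q kleinMatrix (a := 1) (b := b) (c := 0) (d := 1) (by simp)
  rw [← hpoly] at h6
  rw [hkθ] at hpoly
  simp only [zero_smul, zero_add, one_smul] at h6 hpoly hspan
  have hθ := (hasDistinctZeros_evenSextic_iff hk θ).1 (hpoly ▸ h6)
  obtain ⟨A, B, hAB, hM⟩ := exists_isGeneralPair hθ.1 hθ.2
  have hsymm : (Q + b • kleinMatrix).IsSymm := hQ.add (kleinMatrix_isSymm.smul b)
  obtain ⟨V, W, a, hV, hW, hVP, hWP, hV1, hW1⟩ := exists_common_diagonalization hsymm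
    kleinMatrix_isSymm (battagliniMatrix_isSymm hAB.1 hAB.2.1) kleinMatrix_isSymm hk (by norm_num)
    hθ hpoly hM
  obtain ⟨g, e, he, hge⟩ := exists_bivectorMap_of_orthonormal hV1 hW1
  have hA : (gᵀ * A * g).IsSymm := hAB.1.transpose_mul_mul g
  have hB : (gᵀ * B * g).IsSymm := hAB.2.1.transpose_mul_mul g
  have heq : Q + b • kleinMatrix = battagliniMatrix (gᵀ * A * g) (gᵀ * B * g) := by
    set G := LinearMap.toMatrix' (bivectorMap g)
    have h1 : battagliniMatrix (gᵀ * A * g) (gᵀ * B * g) = Gᵀ * battagliniMatrix A B * G :=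
      Matrix.ext_of_bilin fun x y => by
        rw [battagliniMatrix_bilin, ← battagliniForm_bivectorMap, ← battagliniMatrix_bilin,
          ← LinearMap.toMatrix'_mulVec (bivectorMap g), ← LinearMap.toMatrix'_mulVec (bivectorMap g),
          ← mulVec_mulVec, ← mulVec_mulVec, dotProduct_mulVec _ Gᵀ, vecMul_transpose]
    have h2 : Vᵀ * (Gᵀ * battagliniMatrix A B * G) * V = Vᵀ * (Q + b • kleinMatrix) * V := by
      calc Vᵀ * (Gᵀ * battagliniMatrix A B * G) * V =
          (G * V)ᵀ * battagliniMatrix A B * (G * V) := by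
            rw [transpose_mul]; noncomm_ring
        _ = diagonal e * (Wᵀ * battagliniMatrix A B * W) * diagonal e := by
            rw [hge, transpose_mul, diagonal_transpose]; noncomm_ring
        _ = _ := by
            rw [hWP, hVP, diagonal_mul_diagonal, diagonal_mul_diagonal]
            congr 1
            ext i
            linear_combination a i * he i
    have hVT : IsUnit (Vᵀ).det := by rwa [det_transpose]
    rw [h1]
    have h3 := (Matrix.isUnit_iff_isUnit_det V).2 hV
    have h4 := (Matrix.isUnit_iff_isUnit_det _).2 hVT
    exact (h4.mul_left_cancel (h3.mul_right_cancel h2)).symm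
  refine ⟨_, _, ⟨hA, hB, ?_⟩, ?_⟩
  · exact (hasDistinctZeros_battaglini_pencil_iff hA hB).1 (heq ▸ h6)
  · rw [← heq, hspan]

/-! ### Lines and a pair of quadratic forms -/

section Forms

variable {E : Type*} [AddCommGroup E] [Module ℂ E]

/-- The value on the line `p ∧ q` of the quadratic form whose zeros are the lines that meet
the quadrics `a` and `b` in harmonically separated pairs of points. -/
def harmonicForm (a b : LinearMap.BilinForm ℂ E) (p q : E) : ℂ :=
  a q q * b p p + a p p * b q q - 2 * a p q * b p q

/-- The discriminant of the form `a` on the line `p ∧ q`. -/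
def lineDiscr (a : LinearMap.BilinForm ℂ E) (p q : E) : ℂ := a p q ^ 2 - a p p * a q q

theorem harmonicForm_combination {a b : LinearMap.BilinForm ℂ E} (ha : ∀ x y, a x y = a y x)
    (hb : ∀ x y, b x y = b y x) (p q : E) (α β γ δ : ℂ) :
    harmonicForm a b (α • p + β • q) (γ • p + δ • q) =
      (α * δ - β * γ) ^ 2 * harmonicForm a b p q := by
  simp only [harmonicForm, map_add, map_smul, LinearMap.add_apply, LinearMap.smul_apply,
    smul_eq_mul, ha q p, hb q p]
  ring

theorem lineDiscr_combination {a : LinearMap.BilinForm ℂ E} (ha : ∀ x y, a x y = a y x)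
    (p q : E) (α β γ δ : ℂ) :
    lineDiscr a (α • p + β • q) (γ • p + δ • q) = (α * δ - β * γ) ^ 2 * lineDiscr a p q := by
  simp only [lineDiscr, map_add, map_smul, LinearMap.add_apply, LinearMap.smul_apply,
    smul_eq_mul, ha q p]
  ring

theorem linearIndependent_of_lineDiscr_ne_zero {a : LinearMap.BilinForm ℂ E}
    (ha : ∀ x y, a x y = a y x) {p q : E} (h : lineDiscr a p q ≠ 0) :
    LinearIndependent ℂ ![p, q] := by
  rw [LinearIndependent.pair_iff]
  intro s t hst
  have h1 : s * a p p + t * a p q = 0 := by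
    simpa [ha q p] using congrArg (fun x => a x p) hst
  have h2 : s * a p q + t * a q q = 0 := by
    simpa using congrArg (fun x => a x q) hst
  rw [lineDiscr] at h
  exact ⟨(mul_eq_zero.1 (show s * _ = 0 by
      linear_combination a p q * h2 - a q q * h1)).resolve_right h,
    (mul_eq_zero.1 (show t * _ = 0 by linear_combination a p q * h1 - a p p * h2)).resolve_right h⟩

theorem exists_isotropic_basis {a : LinearMap.BilinForm ℂ E} (ha : ∀ x y, a x y = a y x) {p q : E}
    (h : lineDiscr a p q ≠ 0) : ∃ α β γ δ : ℂ, α * δ - β * γ ≠ 0 ∧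
      a (α • p + β • q) (α • p + β • q) = 0 ∧ a (γ • p + δ • q) (γ • p + δ • q) = 0 := by
  by_cases h0 : a p p = 0
  · have hpq : a p q ≠ 0 := by
      intro h1
      simp [lineDiscr, h0, h1] at h
    refine ⟨1, 0, -a q q / (2 * a p q), 1, by simp, by simp [h0], ?_⟩
    simp only [map_add, map_smul, LinearMap.add_apply, LinearMap.smul_apply, smul_eq_mul, ha q p, h0]
    field_simp
    ring
  · obtain ⟨δ, hδ⟩ : ∃ δ : ℂ, δ ^ 2 = lineDiscr a p q := IsAlgClosed.exists_pow_nat_eq _ two_pos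
    have hδ0 : δ ≠ 0 := by
      rintro rfl
      exact h (by rw [← hδ]; ring)
    rw [lineDiscr] at hδ
    refine ⟨-a p q + δ, a p p, -a p q - δ, a p p, ?_, ?_, ?_⟩
    · have : (-a p q + δ) * a p p - a p p * (-a p q - δ) = 2 * δ * a p p := by ring
      rw [this]
      exact mul_ne_zero (mul_ne_zero two_ne_zero hδ0) h0
    all_goals
      simp only [map_add, map_smul, LinearMap.add_apply, LinearMap.smul_apply, smul_eq_mul, ha q p]
      linear_combination a p p * hδ

end Forms

/-! ### Decomposable bivectors and harmonic separation -/

theorem plucker_combination (p q : Fin 4 → ℂ) (α β γ δ : ℂ) :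
    plucker (α • p + β • q) (γ • p + δ • q) = (α * δ - β * γ) • plucker p q := by
  ext i
  fin_cases i <;> simp [plucker] <;> ring

/-- For a bivector on the Klein quadric the correction term vanishes, so two rows of its skew matrix
with a non-zero common entry span the line it represents. -/
theorem plucker_bivector (x : Fin 6 → ℂ) (i j : Fin 4) :
    plucker (bivector x i) (bivector x j) = bivector x i j • x -
      (kleinForm x x / 2) • kleinDual (plucker (Pi.single i 1) (Pi.single j 1)) := by
  ext k
  fin_cases i <;> fin_cases j <;> fin_cases k <;>
    simp [plucker, bivector, kleinForm_apply, kleinDual] <;> ring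

theorem exists_eq_plucker {x : Fin 6 → ℂ} (hx : x ≠ 0) (h : kleinForm x x = 0) :
    ∃ p q, x = plucker p q := by
  obtain ⟨i, j, hij⟩ : ∃ i j, bivector x i j ≠ 0 := by
    by_contra! h0
    refine hx (bivector_injective ?_)
    ext i j
    rw [h0, ← zero_smul ℂ (0 : Fin 6 → ℂ), bivector_smul]
    simp
  have h1 := plucker_bivector x i j
  rw [h, zero_div, zero_smul, sub_zero] at h1
  refine ⟨(bivector x i j)⁻¹ • bivector x i, bivector x j, ?_⟩
  have h2 := plucker_combination (bivector x i) (bivector x j) (bivector x i j)⁻¹ 0 0 1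
  simp only [zero_smul, add_zero, one_smul, zero_add, mul_one, mul_zero, sub_zero] at h2
  rw [h2, h1, smul_smul, inv_mul_cancel₀ hij, one_smul]

theorem kleinForm_plucker (p q : Fin 4 → ℂ) : kleinForm (plucker p q) (plucker p q) = 0 := by
  simp [kleinForm_apply, plucker]
  ring

theorem Matrix.IsSymm.toBilin'_comm {A : Matrix (Fin 4) (Fin 4) ℂ} (hA : A.IsSymm)
    (x y : Fin 4 → ℂ) : Matrix.toBilin' A x y = Matrix.toBilin' A y x := by
  rw [Matrix.toBilin'_apply', Matrix.toBilin'_apply', hA.dotProduct_mulVec_comm]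

/-- On a rank-two bivector the trace splits into products of values of A and B, and what is left is
the apolarity invariant of the two binary quadratic forms on the line. -/
theorem battagliniForm_plucker {A B : Matrix (Fin 4) (Fin 4) ℂ} (hA : A.IsSymm) (hB : B.IsSymm)
    (p q : Fin 4 → ℂ) : battagliniForm A B (plucker p q) (plucker p q) =
      -harmonicForm (Matrix.toBilin' A) (Matrix.toBilin' B) p q := by
  have htr : ∀ x y u v : Fin 4 → ℂ, trace (vecMulVec x y * A * vecMulVec u v * B) =
      Matrix.toBilin' A y u * Matrix.toBilin' B v x := fun x y u v => by
    rw [Matrix.toBilin'_apply', Matrix.toBilin'_apply', vecMulVec_mul, vecMulVec_mul_vecMulVec,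
      vecMulVec_smul, Matrix.smul_mul, vecMulVec_mul, trace_smul, trace_vecMulVec, dotProduct_comm x,
      ← dotProduct_mulVec, ← dotProduct_mulVec, smul_eq_mul]
  rw [battagliniForm_eq_trace, bivector_plucker, hA.eq, hB.eq]
  simp only [Matrix.sub_mul, Matrix.mul_sub, trace_sub, htr, harmonicForm, hA.toBilin'_comm q p,
    hB.toBilin'_comm q p]
  ring

theorem submodule_mk_eq_span {x : Fin 6 → ℂ} (hx : x ≠ 0) :
    (Projectivization.mk ℂ x hx).submodule = Submodule.span ℂ {x} :=
  Projectivization.submodule_mk _ _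

theorem exists_mem_span_pair_iff {p q w : Fin 4 → ℂ} :
    w ∈ Submodule.span ℂ {p, q} ↔ ∃ x y : ℂ, w = x • p + y • q := by
  rw [Submodule.mem_span_pair]
  exact ⟨fun ⟨x, y, h⟩ => ⟨x, y, h.symm⟩, fun ⟨x, y, h⟩ => ⟨x, y, h.symm⟩⟩

/-- In a basis P, Q of the line that is isotropic for A, the invariant is -2 A(P, Q) B(P, Q). Its
vanishing makes B diagonal, with zeros P ± μ Q, which are harmonic to P and Q. -/
theorem mem_harmonicLines {A B : Matrix (Fin 4) (Fin 4) ℂ} (hA : A.IsSymm) (hB : B.IsSymm)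
    {p q : Fin 4 → ℂ} (hpq : plucker p q ≠ 0)
    (h : harmonicForm (Matrix.toBilin' A) (Matrix.toBilin' B) p q = 0)
    (hDA : lineDiscr (Matrix.toBilin' A) p q ≠ 0) (hDB : lineDiscr (Matrix.toBilin' B) p q ≠ 0) :
    Projectivization.mk ℂ (plucker p q) hpq ∈ harmonicLines A B := by
  have ha := hA.toBilin'_comm
  have hb := hB.toBilin'_comm
  obtain ⟨α, β, γ, δ, hdet, hp, hq⟩ := exists_isotropic_basis ha hDA
  have h' := harmonicForm_combination ha hb p q α β γ δ
  have hDA' := lineDiscr_combination ha p q α β γ δ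
  have hDB' := lineDiscr_combination hb p q α β γ δ
  have hplu := plucker_combination p q α β γ δ
  rw [h, mul_zero] at h'
  have hDA0 := mul_ne_zero (pow_ne_zero 2 hdet) hDA
  have hDB0 := mul_ne_zero (pow_ne_zero 2 hdet) hDB
  rw [← hDA'] at hDA0
  rw [← hDB'] at hDB0
  have hspan : (Projectivization.mk ℂ (plucker p q) hpq).submodule =
      Submodule.span ℂ {plucker (α • p + β • q) (γ • p + δ • q)} := by
    rw [submodule_mk_eq_span, hplu, Submodule.span_singleton_smul_eq (isUnit_iff_ne_zero.2 hdet)]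
  set P := α • p + β • q
  set Q := γ • p + δ • q
  clear hDA' hDB' hplu
  have hli := linearIndependent_of_lineDiscr_ne_zero ha hDA0
  have hapq : Matrix.toBilin' A P Q ≠ 0 := fun h0 => hDA0 (by rw [lineDiscr, h0, hp]; ring)
  have hbpq : Matrix.toBilin' B P Q = 0 := by
    rw [harmonicForm, hp, hq] at h'
    exact (mul_eq_zero.1 (show Matrix.toBilin' A P Q * Matrix.toBilin' B P Q = 0 by
      linear_combination -h' / 2)).resolve_left hapq
  rw [lineDiscr, hbpq] at hDB0
  have hbp : Matrix.toBilin' B P P ≠ 0 := fun h0 => hDB0 (by rw [h0]; ring)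
  have hbq : Matrix.toBilin' B Q Q ≠ 0 := fun h0 => hDB0 (by rw [h0]; ring)
  obtain ⟨μ, hμ⟩ : ∃ μ : ℂ, μ ^ 2 = -Matrix.toBilin' B P P / Matrix.toBilin' B Q Q :=
    IsAlgClosed.exists_pow_nat_eq _ two_pos
  have hμ0 : μ ≠ 0 := by
    rintro rfl
    rw [zero_pow two_ne_zero, eq_comm, div_eq_zero_iff, neg_eq_zero] at hμ
    exact hμ.elim hbp hbq
  rw [eq_div_iff hbq] at hμ
  have hexp : ∀ (M : Matrix (Fin 4) (Fin 4) ℂ) (_ : M.IsSymm) (x y : ℂ),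
      (x • P + y • Q) ⬝ᵥ M *ᵥ (x • P + y • Q) = x ^ 2 * Matrix.toBilin' M P P +
        2 * x * y * Matrix.toBilin' M P Q + y ^ 2 * Matrix.toBilin' M Q Q := fun M hM x y => by
    rw [← Matrix.toBilin'_apply']
    simp only [map_add, map_smul, LinearMap.add_apply, LinearMap.smul_apply, smul_eq_mul,
      hM.toBilin'_comm Q P]
    ring
  rw [LinearIndependent.pair_iff] at hli
  have hinj : ∀ x y x' y' : ℂ, x • P + y • Q = x' • P + y' • Q → x = x' ∧ y = y' :=
    fun x y x' y' h0 => by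
      have := hli (x - x') (y - y') (by
        rw [← sub_eq_zero] at h0
        rw [← h0]
        module)
      exact ⟨sub_eq_zero.1 this.1, sub_eq_zero.1 this.2⟩
  refine ⟨P, Q, P + μ • Q, P + (-μ) • Q, ⟨LinearIndependent.pair_iff.2 hli, 1, μ, 1, -μ,
    by rw [one_smul], by rw [one_smul], by field_simp⟩, ?_, ?_, hspan⟩
  · intro w hw
    obtain ⟨x, y, rfl⟩ := exists_mem_span_pair_iff.1 hw
    rw [hexp A hA, hp, hq, Submodule.mem_span_singleton, Submodule.mem_span_singleton]
    constructor
    · intro h0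
      have : x * y = 0 := (mul_eq_zero.1 (show (x * y) * Matrix.toBilin' A P Q = 0 by
        linear_combination h0 / 2)).resolve_right hapq
      rcases mul_eq_zero.1 this with rfl | rfl
      · exact Or.inr ⟨y, by simp⟩
      · exact Or.inl ⟨x, by simp⟩
    · rintro (⟨c, hc⟩ | ⟨c, hc⟩)
      · have := (hinj c 0 x y (by rw [← hc]; simp)).2
        rw [← this]; ring
      · have := (hinj 0 c x y (by rw [← hc]; simp)).1
        rw [← this]; ring
  · intro w hw
    obtain ⟨x, y, rfl⟩ := exists_mem_span_pair_iff.1 hw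
    rw [hexp B hB, hbpq, Submodule.mem_span_singleton, Submodule.mem_span_singleton]
    constructor
    · intro h0
      have : (y - μ * x) * (y + μ * x) = 0 :=
        (mul_eq_zero.1 (show (y - μ * x) * (y + μ * x) * Matrix.toBilin' B Q Q = 0 by
          linear_combination h0 - x ^ 2 * hμ)).resolve_right hbq
      rcases mul_eq_zero.1 this with h1 | h1
      · exact Or.inl ⟨x, by rw [sub_eq_zero.1 h1]; module⟩
      · exact Or.inr ⟨x, by rw [eq_neg_of_add_eq_zero_left h1]; module⟩
    · rintro (⟨c, hc⟩ | ⟨c, hc⟩)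
      · obtain ⟨h1, h2⟩ := hinj c (c * μ) x y (by rw [← hc]; module)
        rw [← h1, ← h2]
        linear_combination c ^ 2 * hμ
      · obtain ⟨h1, h2⟩ := hinj c (-(c * μ)) x y (by rw [← hc]; module)
        rw [← h1, ← h2]
        linear_combination c ^ 2 * hμ

theorem harmonicForm_eq_zero_of_harmonicallySeparated {A B : Matrix (Fin 4) (Fin 4) ℂ}
    (hB : B.IsSymm) {p q r s : Fin 4 → ℂ} (h : HarmonicallySeparated p q r s)
    (hpq : LineMeetsQuadricIn A p q p q) (hrs : LineMeetsQuadricIn B p q r s) :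
    harmonicForm (Matrix.toBilin' A) (Matrix.toBilin' B) p q = 0 := by
  obtain ⟨-, a, b, c, d, rfl, rfl, hcr⟩ := h
  have hbil : ∀ (M : Matrix (Fin 4) (Fin 4) ℂ) (x y : Fin 4 → ℂ),
      x ⬝ᵥ M *ᵥ y = Matrix.toBilin' M x y := fun M x y => (Matrix.toBilin'_apply' _ _ _).symm
  have hp : Matrix.toBilin' A p p = 0 := by
    rw [← hbil]
    exact (hpq p (Submodule.subset_span (by simp))).2 (Or.inl (Submodule.mem_span_singleton_self p))
  have hq : Matrix.toBilin' A q q = 0 := by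
    rw [← hbil]
    exact (hpq q (Submodule.subset_span (by simp))).2 (Or.inr (Submodule.mem_span_singleton_self q))
  have hr := (hrs _ (exists_mem_span_pair_iff.2 ⟨a, b, rfl⟩)).2
    (Or.inl (Submodule.mem_span_singleton_self _))
  have hs := (hrs _ (exists_mem_span_pair_iff.2 ⟨c, d, rfl⟩)).2
    (Or.inr (Submodule.mem_span_singleton_self _))
  rw [hbil] at hr hs
  simp only [map_add, map_smul, LinearMap.add_apply, LinearMap.smul_apply, smul_eq_mul,
    hB.toBilin'_comm q p] at hr hs
  have had : a * d ≠ 0 := by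
    intro h0
    rw [h0, div_zero] at hcr
    norm_num at hcr
  have hbc : b * c = -(a * d) := by
    rw [div_eq_iff had] at hcr
    rw [hcr]; ring
  have hb : b * c ≠ 0 := by rw [hbc]; exact neg_ne_zero.2 had
  -- By bc = -ad the points r and s are proportional to p ± λ q, and a quadratic form vanishing at
  -- both has no mixed term. The combination d² hr - b² hs eliminates B(q, q).
  have hB0 : Matrix.toBilin' B p q = 0 := by
    have h1 : (4 * (a * d) * (b * d)) * Matrix.toBilin' B p q = 0 := by
      linear_combination d ^ 2 * hr - b ^ 2 * hs + (2 * b * d * Matrix.toBilin' B p q -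
        (a * d - b * c) * Matrix.toBilin' B p p) * hbc
    exact (mul_eq_zero.1 h1).resolve_left (mul_ne_zero (mul_ne_zero (by norm_num) had)
      (mul_ne_zero (left_ne_zero_of_mul hb) (right_ne_zero_of_mul had)))
  rw [harmonicForm, hp, hq, hB0]
  ring

/-! ### Quadratic equations depending on a parameter -/

theorem exists_quadratic_factorization {c₂ : ℂ} (h : c₂ ≠ 0) (c₁ c₀ : ℂ) :
    ∃ s₁ s₂, c₁ = -(c₂ * (s₁ + s₂)) ∧ c₀ = c₂ * (s₁ * s₂) := by
  obtain ⟨δ, hδ⟩ : ∃ δ : ℂ, δ ^ 2 = c₁ ^ 2 - 4 * c₂ * c₀ := IsAlgClosed.exists_pow_nat_eq _ two_pos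
  refine ⟨(-c₁ + δ) / (2 * c₂), (-c₁ - δ) / (2 * c₂), ?_, ?_⟩
  · field_simp
    ring
  · field_simp
    linear_combination hδ

/-- The product of the roots is c₀ / c₂, so the smaller one tends to zero with c₀ as long as c₂
stays away from zero. -/
theorem exists_small_root {c₂ : ℂ} (h : c₂ ≠ 0) (c₁ c₀ : ℂ) :
    ∃ s, c₂ * s ^ 2 + c₁ * s + c₀ = 0 ∧ ‖s‖ ^ 2 ≤ ‖c₀ / c₂‖ := by
  obtain ⟨s₁, s₂, rfl, rfl⟩ := exists_quadratic_factorization h c₁ c₀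
  rw [mul_div_cancel_left₀ _ h, norm_mul]
  rcases le_total ‖s₁‖ ‖s₂‖ with hle | hle
  · exact ⟨s₁, by ring, by rw [sq]; gcongr⟩
  · exact ⟨s₂, by ring, by rw [sq]; gcongr⟩

/-- The resultant of two binary quadratic forms. -/
def quadraticResultant (c₂ c₁ c₀ d₂ d₁ d₀ : ℂ) : ℂ :=
  (c₂ * d₀ - c₀ * d₂) ^ 2 - (c₂ * d₁ - c₁ * d₂) * (c₁ * d₀ - c₀ * d₁)

theorem quadraticResultant_eq_zero {c₂ c₁ c₀ d₂ d₁ d₀ s : ℂ} (hc : c₂ * s ^ 2 + c₁ * s + c₀ = 0)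
    (hd : d₂ * s ^ 2 + d₁ * s + d₀ = 0) : quadraticResultant c₂ c₁ c₀ d₂ d₁ d₀ = 0 := by
  obtain rfl : c₀ = -(c₂ * s ^ 2 + c₁ * s) := by linear_combination hc
  obtain rfl : d₀ = -(d₂ * s ^ 2 + d₁ * s) := by linear_combination hd
  rw [quadraticResultant]
  ring

/-- The resultant is c₂² times the product of the values of the second quadratic at the roots of the
first, so only the first must have true degree two. -/
theorem exists_root_of_quadraticResultant_eq_zero {c₂ c₁ c₀ d₂ d₁ d₀ : ℂ} (hc₂ : c₂ ≠ 0)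
    (h : quadraticResultant c₂ c₁ c₀ d₂ d₁ d₀ = 0) :
    ∃ s, c₂ * s ^ 2 + c₁ * s + c₀ = 0 ∧ d₂ * s ^ 2 + d₁ * s + d₀ = 0 := by
  obtain ⟨s₁, s₂, rfl, rfl⟩ := exists_quadratic_factorization hc₂ c₁ c₀
  have h1 : c₂ ^ 2 * ((d₂ * s₁ ^ 2 + d₁ * s₁ + d₀) * (d₂ * s₂ ^ 2 + d₁ * s₂ + d₀)) = 0 := by
    rw [← h, quadraticResultant]
    ring
  rcases mul_eq_zero.1 ((mul_eq_zero.1 h1).resolve_left (pow_ne_zero 2 hc₂)) with h2 | h2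
  · exact ⟨s₁, by ring, h2⟩
  · exact ⟨s₂, by ring, h2⟩

theorem eventually_ne_zero_of_differentiable {f : ℂ → ℂ} (hf : Differentiable ℂ f) {z : ℂ}
    (hz : f z ≠ 0) (w : ℂ) : ∀ᶠ ε in nhdsWithin w {w}ᶜ, f ε ≠ 0 := by
  by_contra h
  have h1 : ∃ᶠ ε in nhdsWithin w {w}ᶜ, f ε = 0 := by
    simpa [Filter.not_eventually] using h
  exact hz (AnalyticOnNhd.eqOn_zero_of_preconnected_of_frequently_eq_zero
    (fun x _ => hf.analyticAt x) isPreconnected_univ (Set.mem_univ w) h1 (Set.mem_univ z))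

/-! ### Density of the harmonic lines -/

section Forms

variable {E : Type*} [AddCommGroup E] [Module ℂ E]

/-- Half the linear coefficient of `s ↦ harmonicForm a b p (q + s • e)`. -/
def harmonicPolar (a b : LinearMap.BilinForm ℂ E) (p q e : E) : ℂ :=
  a q e * b p p + a p p * b q e - a p q * b p e - a p e * b p q

theorem harmonicForm_add_smul {a b : LinearMap.BilinForm ℂ E} (ha : ∀ x y, a x y = a y x)
    (hb : ∀ x y, b x y = b y x) (p q e : E) (s : ℂ) : harmonicForm a b p (q + s • e) =
      harmonicForm a b p e * s ^ 2 + 2 * harmonicPolar a b p q e * s + harmonicForm a b p q := by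
  simp only [harmonicForm, harmonicPolar, map_add, map_smul, LinearMap.add_apply,
    LinearMap.smul_apply, smul_eq_mul, ha e q, hb e q]
  ring

theorem lineDiscr_add_smul {a : LinearMap.BilinForm ℂ E} (ha : ∀ x y, a x y = a y x)
    (p q e : E) (s : ℂ) : lineDiscr a p (q + s • e) =
      lineDiscr a p e * s ^ 2 + 2 * (a p q * a p e - a p p * a q e) * s + lineDiscr a p q := by
  simp only [lineDiscr, map_add, map_smul, LinearMap.add_apply, LinearMap.smul_apply, smul_eq_mul,
    ha e q]
  ring

/-- The resultant in `s` of `harmonicForm a b p (q + s • e)` and `lineDiscr c p (q + s • e)`. -/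
def lineResultant (a b c : LinearMap.BilinForm ℂ E) (p q e : E) : ℂ :=
  quadraticResultant (harmonicForm a b p e) (2 * harmonicPolar a b p q e) (harmonicForm a b p q)
    (lineDiscr c p e) (2 * (c p q * c p e - c p p * c q e)) (lineDiscr c p q)

theorem differentiable_harmonicForm_path (a b : LinearMap.BilinForm ℂ E) (p u q v : E) :
    Differentiable ℂ fun ε : ℂ => harmonicForm a b (p + ε • u) (q + ε • v) := by
  simp only [harmonicForm, map_add, map_smul, LinearMap.add_apply, LinearMap.smul_apply,
    smul_eq_mul]
  fun_prop

theorem differentiable_lineResultant_path (a b c : LinearMap.BilinForm ℂ E) (p u q v e : E) :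
    Differentiable ℂ fun ε : ℂ => lineResultant a b c (p + ε • u) (q + ε • v) e := by
  simp only [lineResultant, quadraticResultant, lineDiscr, harmonicPolar, harmonicForm, map_add,
    map_smul, LinearMap.add_apply, LinearMap.smul_apply, smul_eq_mul]
  fun_prop

theorem exists_harmonicForm_ne_zero_pair {a b : LinearMap.BilinForm ℂ E} (ha : ∀ x y, a x y = a y x)
    (hb : ∀ x y, b x y = b y x) {p p' u v : E} (h : harmonicForm a b p u ≠ 0)
    (h' : harmonicForm a b p' v ≠ 0) :
    ∃ e, harmonicForm a b p e ≠ 0 ∧ harmonicForm a b p' e ≠ 0 := by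
  have hd : ∀ p, Differentiable ℂ fun t : ℂ => harmonicForm a b p (u + t • (v - u)) := fun p => by
    simp only [harmonicForm_add_smul ha hb]
    fun_prop
  have h1 := eventually_ne_zero_of_differentiable (hd p) (z := 0) (by simpa using h) 0
  have h2 := eventually_ne_zero_of_differentiable (hd p') (z := 1) (by simpa using h') 0
  obtain ⟨t, ht⟩ := (h1.and h2).exists
  exact ⟨_, ht⟩

end Forms

/-- A path leads from (p₀, q₀) to a pair (p, q), and q is moved in a fixed direction e by a root s
of the harmonic equation. By `h2` only finitely many lines through p are harmonic and degenerate, so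
a suitable q makes both resultants in s non-zero at the far end of the path. They are then non-zero
for all small ε ≠ 0, while s tends to 0 with ε. -/
theorem mem_closure_of_exists_generic {a b : LinearMap.BilinForm ℂ (Fin 4 → ℂ)}
    (ha : ∀ x y, a x y = a y x) (hb : ∀ x y, b x y = b y x)
    (h1 : ∀ p, p ≠ 0 → ∃ e, harmonicForm a b p e ≠ 0)
    (h2 : ∃ (p : Fin 4 → ℂ) (z : Fin 4 → Fin 4 → ℂ), p ≠ 0 ∧ ∀ y, harmonicForm a b p y = 0 →
      lineDiscr a p y = 0 ∨ lineDiscr b p y = 0 → ∃ k, y ∈ Submodule.span ℂ {p, z k})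
    {p₀ q₀ : Fin 4 → ℂ} (hp₀ : p₀ ≠ 0) (h₀ : harmonicForm a b p₀ q₀ = 0) :
    (p₀, q₀) ∈ closure {x : (Fin 4 → ℂ) × (Fin 4 → ℂ) | harmonicForm a b x.1 x.2 = 0 ∧
      lineDiscr a x.1 x.2 ≠ 0 ∧ lineDiscr b x.1 x.2 ≠ 0} := by
  obtain ⟨p, z, hp, hz⟩ := h2
  obtain ⟨u, hu⟩ := h1 p₀ hp₀
  obtain ⟨v, hv⟩ := h1 p hp
  obtain ⟨e, he₀, he⟩ := exists_harmonicForm_ne_zero_pair ha hb hu hv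
  -- Finitely many proper subspaces do not cover ℂ⁴. Including e in each span keeps the whole affine
  -- line q + s e away from the bad lines.
  obtain ⟨q, hq⟩ : ∃ q, ∀ k, q ∉ Submodule.span ℂ {p, z k, e} := by
    by_contra! hcon
    refine Subspace.biUnion_ne_univ_of_top_notMem (k := ℂ) (E := Fin 4 → ℂ)
      (s := Finset.univ.image fun k => Submodule.span ℂ {p, z k, e}) ?_ ?_
    · intro htop
      obtain ⟨k, -, hk⟩ := Finset.mem_image.1 htop
      have h3 := finrank_span_le_card (R := ℂ) ({p, z k, e} : Set (Fin 4 → ℂ))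
      rw [hk, finrank_top, Module.finrank_fin_fun] at h3
      have h4 : ({p, z k, e} : Set (Fin 4 → ℂ)).toFinset.card ≤ 3 := by
        rw [← Set.ncard_eq_toFinset_card']
        exact (Set.ncard_insert_le _ _).trans (Nat.succ_le_succ
          ((Set.ncard_insert_le _ _).trans (by simp)))
      omega
    · refine Set.eq_univ_of_forall fun q => ?_
      obtain ⟨k, hk⟩ := hcon q
      exact Set.mem_biUnion (Finset.mem_coe.2 (Finset.mem_image_of_mem _ (Finset.mem_univ k))) hk
  have hgen : ∀ (s : ℂ) k, q + s • e ∉ Submodule.span ℂ {p, z k} := fun s k hmem => by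
    have h3 : Submodule.span ℂ {p, z k} ≤ Submodule.span ℂ {p, z k, e} :=
      Submodule.span_mono (by intro x; simp; tauto)
    have h4 : e ∈ Submodule.span ℂ {p, z k, e} := Submodule.subset_span (by simp)
    refine hq k ?_
    have := Submodule.sub_mem _ (h3 hmem) (Submodule.smul_mem _ s h4)
    rwa [add_sub_cancel_right] at this
  have hres : ∀ c, c = a ∨ c = b → lineResultant a b c p q e ≠ 0 := by
    intro c hc hres
    obtain ⟨s, hs1, hs2⟩ := exists_root_of_quadraticResultant_eq_zero he hres
    rw [← harmonicForm_add_smul ha hb] at hs1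
    obtain ⟨k, hk⟩ : ∃ k, q + s • e ∈ Submodule.span ℂ {p, z k} := by
      refine hz _ hs1 ?_
      rcases hc with rfl | rfl
      · exact Or.inl (by rw [lineDiscr_add_smul ha, hs2])
      · exact Or.inr (by rw [lineDiscr_add_smul hb, hs2])
    exact hgen s k hk
  let P : ℂ → Fin 4 → ℂ := fun ε => p₀ + ε • (p - p₀)
  let Q : ℂ → Fin 4 → ℂ := fun ε => q₀ + ε • (q - q₀)
  have hroot : ∀ ε, ∃ s : ℂ, harmonicForm a b (P ε) e ≠ 0 → harmonicForm a b (P ε) (Q ε + s • e) = 0 ∧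
      ‖s‖ ^ 2 ≤ ‖harmonicForm a b (P ε) (Q ε) / harmonicForm a b (P ε) e‖ := fun ε => by
    by_cases h : harmonicForm a b (P ε) e = 0
    · exact ⟨0, fun h' => absurd h h'⟩
    · obtain ⟨s, hs⟩ := exists_small_root h (2 * harmonicPolar a b (P ε) (Q ε) e)
        (harmonicForm a b (P ε) (Q ε))
      exact ⟨s, fun _ => by rwa [harmonicForm_add_smul ha hb]⟩
  choose s hs using hroot
  have hdc₂ : Differentiable ℂ fun ε => harmonicForm a b (P ε) e := by
    simpa using differentiable_harmonicForm_path a b p₀ (p - p₀) e 0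
  have hdc₀ := differentiable_harmonicForm_path a b p₀ (p - p₀) q₀ (q - q₀)
  have ev1 : ∀ᶠ ε in nhdsWithin 0 {0}ᶜ, harmonicForm a b (P ε) e ≠ 0 :=
    eventually_ne_zero_of_differentiable hdc₂ (z := 0) (by simpa [P] using he₀) 0
  have ev2 : ∀ c, c = a ∨ c = b →
      ∀ᶠ ε in nhdsWithin 0 {0}ᶜ, lineResultant a b c (P ε) (Q ε) e ≠ 0 := fun c hc =>
    eventually_ne_zero_of_differentiable (differentiable_lineResultant_path a b c _ _ _ _ e)
      (z := 1) (by simpa using hres c hc) 0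
  -- The constant term of the quadratic tends to its value at (p₀, q₀), which is zero, and the
  -- leading one to a non-zero limit.
  have hs0 : Filter.Tendsto s (nhdsWithin 0 {0}ᶜ) (nhds 0) := by
    have h3 : Filter.Tendsto (fun ε => harmonicForm a b (P ε) (Q ε) / harmonicForm a b (P ε) e)
        (nhdsWithin 0 {0}ᶜ) (nhds 0) := by
      have h4 := (hdc₀.continuous.tendsto 0).div (hdc₂.continuous.tendsto 0) (by simpa [P] using he₀)
      simp only [zero_smul, add_zero, h₀, zero_div] at h4
      exact h4.mono_left nhdsWithin_le_nhds
    have h5 : Filter.Tendsto (fun ε => ‖s ε‖ ^ 2) (nhdsWithin 0 {0}ᶜ) (nhds 0) := by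
      refine squeeze_zero' (Filter.Eventually.of_forall fun ε => by positivity) ?_
        (tendsto_zero_iff_norm_tendsto_zero.1 h3)
      filter_upwards [ev1] with ε hε using (hs ε hε).2
    have h6 := h5.sqrt
    simp only [Real.sqrt_sq (norm_nonneg _), Real.sqrt_zero] at h6
    exact tendsto_zero_iff_norm_tendsto_zero.2 h6
  have hP : Filter.Tendsto P (nhdsWithin 0 {0}ᶜ) (nhds p₀) := by
    have : Continuous P := by fun_prop
    simpa [P] using (this.tendsto 0).mono_left nhdsWithin_le_nhds
  have hQ : Filter.Tendsto (fun ε => Q ε + s ε • e) (nhdsWithin 0 {0}ᶜ) (nhds q₀) := by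
    have : Continuous Q := by fun_prop
    have h3 := ((this.tendsto 0).mono_left nhdsWithin_le_nhds).add (hs0.smul_const e)
    simpa [Q] using h3
  refine mem_closure_of_tendsto (hP.prodMk_nhds hQ) ?_
  filter_upwards [ev1, ev2 a (Or.inl rfl), ev2 b (Or.inr rfl)] with ε hε hεa hεb
  have h3 := (hs ε hε).1
  refine ⟨h3, fun h4 => hεa ?_, fun h4 => hεb ?_⟩
  · rw [harmonicForm_add_smul ha hb] at h3
    rw [lineDiscr_add_smul ha] at h4
    exact quadraticResultant_eq_zero h3 h4
  · rw [harmonicForm_add_smul ha hb] at h3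
    rw [lineDiscr_add_smul hb] at h4
    exact quadraticResultant_eq_zero h3 h4

/-! ### Genericity for pairs of quadrics with distinct roots -/

theorem toBilin'_diagonal_apply (a x y : Fin 4 → ℂ) : Matrix.toBilin' (diagonal a) x y =
    a 0 * x 0 * y 0 + a 1 * x 1 * y 1 + a 2 * x 2 * y 2 + a 3 * x 3 * y 3 := by
  rw [Matrix.toBilin'_apply', dotProduct, Fin.sum_univ_four]
  simp only [mulVec_diagonal]
  ring

theorem toBilin'_diagonal_single (a x : Fin 4 → ℂ) (i : Fin 4) :
    Matrix.toBilin' (diagonal a) x (Pi.single i 1) = a i * x i := by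
  rw [toBilin'_diagonal_apply]
  fin_cases i <;> simp

/-- No point has all lines through it in the harmonic complex. Testing on basis vectors and their
sums shows that three coordinates never are non-zero together, so two vanish; the other two then
vanish as well. -/
theorem eq_zero_of_harmonicForm_diagonal {a b x : Fin 4 → ℂ} (hab : PairwiseIndependent a b)
    (h : ∀ y, harmonicForm (Matrix.toBilin' (diagonal a)) (Matrix.toBilin' (diagonal b)) x y = 0) :
    x = 0 := by
  have hsa := (isSymm_diagonal a).toBilin'_comm
  have hsb := (isSymm_diagonal b).toBilin'_comm
  set α := Matrix.toBilin' (diagonal a) x x with hα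
  set β := Matrix.toBilin' (diagonal b) x x with hβ
  have hd : ∀ i, a i * β + α * b i - 2 * (a i * x i) * (b i * x i) = 0 := fun i => by
    have := h (Pi.single i 1)
    simpa only [harmonicForm, toBilin'_diagonal_single, Pi.single_eq_same, mul_one] using this
  have hm : ∀ i j, i ≠ j → (a i * b j + a j * b i) * (x i * x j) = 0 := fun i j hij => by
    have h1 := h (Pi.single i 1 + (1 : ℂ) • Pi.single j 1)
    rw [harmonicForm_add_smul hsa hsb, h, h] at h1
    simp only [harmonicPolar, toBilin'_diagonal_single, Pi.single_eq_of_ne hij.symm] at h1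
    linear_combination -h1 / 2
  -- Otherwise (a j : b j) and (a k : b k) would both equal (a i : -b i), against distinctness.
  have htriple : ∀ i j k, i ≠ j → i ≠ k → j ≠ k → x i * x j * x k = 0 := fun i j k hij hik hjk => by
    by_contra h0
    have h1 : a i * b j + a j * b i = 0 := (mul_eq_zero.1 (hm i j hij)).resolve_right
      (left_ne_zero_of_mul h0)
    have h2 : a i * b k + a k * b i = 0 := (mul_eq_zero.1 (hm i k hik)).resolve_right
      (mul_ne_zero (left_ne_zero_of_mul (left_ne_zero_of_mul h0)) (right_ne_zero_of_mul h0))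
    have ha : a i * (a j * b k - a k * b j) = 0 := by linear_combination a j * h2 - a k * h1
    have hb : b i * (a j * b k - a k * b j) = 0 := by linear_combination b k * h1 - b j * h2
    have h3 := (mul_eq_zero.1 ha).resolve_right (hab j k hjk)
    have h4 := (mul_eq_zero.1 hb).resolve_right (hab j k hjk)
    exact hab i j hij (by rw [h3, h4]; ring)
  -- Two vanishing coordinates k, l turn the diagonal equations into a regular linear system for α
  -- and β. Then α = β = 0 is a regular system for the squares of x i and x j.
  have hpair : ∀ i j k l, i ≠ j → k ≠ l →
      (∀ s : Fin 4 → ℂ, s 0 + s 1 + s 2 + s 3 = s i + s j + s k + s l) →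
      x k = 0 → x l = 0 → x i = 0 ∧ x j = 0 := fun i j k l hij hkl hsum hk hl => by
    have h1 := hd k
    have h2 := hd l
    rw [hk] at h1
    rw [hl] at h2
    have hα0 : α = 0 := (mul_eq_zero.1 (show α * (a k * b l - a l * b k) = 0 by
      linear_combination a k * h2 - a l * h1)).resolve_right (hab k l hkl)
    have hβ0 : β = 0 := (mul_eq_zero.1 (show β * (a k * b l - a l * b k) = 0 by
      linear_combination b l * h1 - b k * h2)).resolve_right (hab k l hkl)
    rw [hα, toBilin'_diagonal_apply, hsum fun i => a i * x i * x i, hk, hl] at hα0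
    rw [hβ, toBilin'_diagonal_apply, hsum fun i => b i * x i * x i, hk, hl] at hβ0
    constructor
    · refine pow_eq_zero_iff two_ne_zero |>.1 ((mul_eq_zero.1 (show
        x i ^ 2 * (a i * b j - a j * b i) = 0 from ?_)).resolve_right (hab i j hij))
      linear_combination b j * hα0 - a j * hβ0
    · refine pow_eq_zero_iff two_ne_zero |>.1 ((mul_eq_zero.1 (show
        x j ^ 2 * (a i * b j - a j * b i) = 0 from ?_)).resolve_right (hab i j hij))
      linear_combination a i * hβ0 - b i * hα0
  have hzero : ∀ k l, k ≠ l → x k = 0 → x l = 0 → x = 0 := by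
    have hall : ∀ i j k l, i ≠ j → k ≠ l →
        (∀ s : Fin 4 → ℂ, s 0 + s 1 + s 2 + s 3 = s i + s j + s k + s l) →
        (∀ m, m = i ∨ m = j ∨ m = k ∨ m = l) → x k = 0 → x l = 0 → x = 0 :=
      fun i j k l hij hkl hsum hm hk hl => by
        obtain ⟨hi, hj⟩ := hpair i j k l hij hkl hsum hk hl
        ext m
        rcases hm m with rfl | rfl | rfl | rfl <;> assumption
    intro k l hkl hk hl
    have key : ∀ k l : Fin 4, k ≠ l → ∃ i j, i ≠ j ∧ (∀ m, m = i ∨ m = j ∨ m = k ∨ m = l) ∧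
        i ≠ k ∧ i ≠ l ∧ j ≠ k ∧ j ≠ l := by
      decide
    obtain ⟨i, j, hij, hm, hik, hil, hjk, hjl⟩ := key k l hkl
    refine hall i j k l hij hkl (fun s => ?_) hm hk hl
    have hu : (Finset.univ : Finset (Fin 4)) = {i, j, k, l} := by
      ext m
      simpa using hm m
    rw [← Fin.sum_univ_four, hu, Finset.sum_insert (by simp [hij, hik, hil]),
      Finset.sum_insert (by simp [hjk, hjl]), Finset.sum_pair hkl]
    ring
  have h012 := htriple 0 1 2 (by decide) (by decide) (by decide)
  have h013 := htriple 0 1 3 (by decide) (by decide) (by decide)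
  have h023 := htriple 0 2 3 (by decide) (by decide) (by decide)
  have h123 := htriple 1 2 3 (by decide) (by decide) (by decide)
  rcases mul_eq_zero.1 h012 with h1 | h1
  · rcases mul_eq_zero.1 h1 with h0 | h0
    · rcases mul_eq_zero.1 h123 with h2 | h2
      · rcases mul_eq_zero.1 h2 with h3 | h3 <;> exact hzero _ _ (by decide) h0 h3
      · exact hzero _ _ (by decide) h0 h2
    · rcases mul_eq_zero.1 h023 with h2 | h2
      · rcases mul_eq_zero.1 h2 with h3 | h3 <;> exact hzero _ _ (by decide) h0 h3
      · exact hzero _ _ (by decide) h0 h2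
  · rcases mul_eq_zero.1 h013 with h2 | h2
    · rcases mul_eq_zero.1 h2 with h3 | h3 <;> exact hzero _ _ (by decide) h1 h3
    · exact hzero _ _ (by decide) h1 h2

/-- Let A', B' be the parts of the two quadratic forms in the last three coordinates. Through the
first coordinate point, the harmonic equation is b₀A' + a₀B' = 0 and the discriminants are -a₀A' and
-b₀B'. As a₀, b₀ ≠ 0, both conics vanish, and they meet in four points whose squared coordinates are
the 2 × 2 minors of a and b. -/
theorem exists_finite_common_zeros_diagonal {a b : Fin 4 → ℂ} (hab : PairwiseIndependent a b)
    (ha0 : a 0 ≠ 0) (hb0 : b 0 ≠ 0) : ∃ (p : Fin 4 → ℂ) (z : Fin 4 → Fin 4 → ℂ), p ≠ 0 ∧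
      ∀ y, harmonicForm (Matrix.toBilin' (diagonal a)) (Matrix.toBilin' (diagonal b)) p y = 0 →
        lineDiscr (Matrix.toBilin' (diagonal a)) p y = 0 ∨
          lineDiscr (Matrix.toBilin' (diagonal b)) p y = 0 →
        ∃ k, y ∈ Submodule.span ℂ {p, z k} := by
  obtain ⟨ζ₁, h1⟩ : ∃ ζ : ℂ, ζ ^ 2 = a 2 * b 3 - a 3 * b 2 :=
    IsAlgClosed.exists_pow_nat_eq _ two_pos
  obtain ⟨ζ₂, h2⟩ : ∃ ζ : ℂ, ζ ^ 2 = a 3 * b 1 - a 1 * b 3 :=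
    IsAlgClosed.exists_pow_nat_eq _ two_pos
  obtain ⟨ζ₃, h3⟩ : ∃ ζ : ℂ, ζ ^ 2 = a 1 * b 2 - a 2 * b 1 :=
    IsAlgClosed.exists_pow_nat_eq _ two_pos
  have hζ : ζ₁ ≠ 0 := by
    rintro rfl
    exact hab 2 3 (by decide) (by rw [← h1]; ring)
  refine ⟨Pi.single 0 1, ![![0, ζ₁, ζ₂, ζ₃], ![0, ζ₁, ζ₂, -ζ₃], ![0, ζ₁, -ζ₂, ζ₃],
    ![0, ζ₁, -ζ₂, -ζ₃]], by simp, fun y hy hD => ?_⟩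
  have hp : ∀ c : Fin 4 → ℂ, Matrix.toBilin' (diagonal c) (Pi.single 0 1) y = c 0 * y 0 :=
    fun c => by rw [(isSymm_diagonal c).toBilin'_comm, toBilin'_diagonal_single]
  simp only [harmonicForm, lineDiscr, hp, toBilin'_diagonal_single, Pi.single_eq_same,
    mul_one] at hy hD
  rw [toBilin'_diagonal_apply, toBilin'_diagonal_apply] at hy
  simp only [toBilin'_diagonal_apply] at hD
  have hS : a 1 * y 1 ^ 2 + a 2 * y 2 ^ 2 + a 3 * y 3 ^ 2 = 0 ∧
      b 1 * y 1 ^ 2 + b 2 * y 2 ^ 2 + b 3 * y 3 ^ 2 = 0 := by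
    rcases hD with hD | hD
    · have hA : a 1 * y 1 ^ 2 + a 2 * y 2 ^ 2 + a 3 * y 3 ^ 2 = 0 :=
        (mul_eq_zero.1 (show a 0 * _ = 0 by linear_combination -hD)).resolve_left ha0
      exact ⟨hA, (mul_eq_zero.1 (show a 0 * _ = 0 by
        linear_combination hy - b 0 * hA)).resolve_left ha0⟩
    · have hB : b 1 * y 1 ^ 2 + b 2 * y 2 ^ 2 + b 3 * y 3 ^ 2 = 0 :=
        (mul_eq_zero.1 (show b 0 * _ = 0 by linear_combination -hD)).resolve_left hb0
      exact ⟨(mul_eq_zero.1 (show b 0 * _ = 0 by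
        linear_combination hy - a 0 * hB)).resolve_left hb0, hB⟩
  obtain ⟨hA, hB⟩ := hS
  have hy2 : (y 2 * ζ₁) ^ 2 = (y 1 * ζ₂) ^ 2 := by
    rw [mul_pow, mul_pow, h1, h2]
    linear_combination b 3 * hA - a 3 * hB
  have hy3 : (y 3 * ζ₁) ^ 2 = (y 1 * ζ₃) ^ 2 := by
    rw [mul_pow, mul_pow, h1, h3]
    linear_combination a 2 * hB - b 2 * hA
  have hmem : ∀ u v : ℂ, y 2 * ζ₁ = y 1 * u → y 3 * ζ₁ = y 1 * v →
      y ∈ Submodule.span ℂ {Pi.single 0 1, ![0, ζ₁, u, v]} := fun u v hu hv => by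
    refine Submodule.mem_span_pair.2 ⟨y 0, y 1 / ζ₁, ?_⟩
    ext i
    fin_cases i
    · simp
    · simp [hζ]
    · simp
      field_simp
      rw [← hu, mul_comm]
    · simp
      field_simp
      rw [← hv, mul_comm]
  rcases sq_eq_sq_iff_eq_or_eq_neg.1 hy2 with h4 | h4 <;>
    rcases sq_eq_sq_iff_eq_or_eq_neg.1 hy3 with h5 | h5
  · exact ⟨0, hmem _ _ h4 h5⟩
  · exact ⟨1, hmem _ _ h4 (by rw [h5]; ring)⟩
  · exact ⟨2, hmem _ _ (by rw [h4]; ring) h5⟩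
  · exact ⟨3, hmem _ _ (by rw [h4]; ring) (by rw [h5]; ring)⟩

theorem exists_diagonalization_of_hasDistinctZeros {A B : Matrix (Fin 4) (Fin 4) ℂ}
    (hA : A.IsSymm) (hB : B.IsSymm) (h : HasDistinctZeros 4 (pencilPoly A B)) :
    ∃ (V : Matrix (Fin 4) (Fin 4) ℂ) (a b : Fin 4 → ℂ), IsUnit V.det ∧ PairwiseIndependent a b ∧
      a 0 ≠ 0 ∧ b 0 ≠ 0 ∧ Vᵀ * A * V = diagonal a ∧ Vᵀ * B * V = diagonal b := by
  obtain ⟨a, b, hab⟩ := exists_eq_linearProd _ (natDegree_pencilPoly_le A B)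
  have hind := h
  rw [hab, hasDistinctZeros_linearProd_iff (by norm_num)] at hind
  -- At most one a i and at most one b i vanish, so some index is free of both; it is swapped into
  -- position 0.
  obtain ⟨i, hai, hbi⟩ : ∃ i, a i ≠ 0 ∧ b i ≠ 0 := by
    by_contra! h0
    have key : ∀ i j, i ≠ j → a i ≠ 0 ∨ a j ≠ 0 := fun i j hij => by
      by_contra! h1
      exact hind i j hij (by rw [h1.1, h1.2]; ring)
    have key' : ∀ i j, i ≠ j → a i = 0 ∨ a j = 0 := fun i j hij => by
      by_contra! h1
      exact hind i j hij (by rw [h0 i h1.1, h0 j h1.2]; ring)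
    have h01 := key 0 1 (by decide)
    have h02 := key 0 2 (by decide)
    have h12 := key 1 2 (by decide)
    have h01' := key' 0 1 (by decide)
    have h02' := key' 0 2 (by decide)
    have h12' := key' 1 2 (by decide)
    tauto
  let σ := Equiv.swap 0 i
  have hind' : PairwiseIndependent (a ∘ σ) (b ∘ σ) := fun i j hij =>
    hind _ _ (σ.injective.ne hij)
  have hab' : pencilPoly A B = C 1 * linearProd (a ∘ σ) (b ∘ σ) := by
    rw [hab, C_1, one_mul, linearProd, linearProd]
    exact (Equiv.prod_comp σ fun i => C (a i) + C (b i) * X).symm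
  obtain ⟨V, hV, hVA, hVB⟩ :=
    exists_simultaneous_diagonalization (by norm_num) hA hB one_ne_zero hind' hab'
  exact ⟨V, _, _, hV, hind', by simpa [σ] using hai, by simpa [σ] using hbi, hVA, hVB⟩

theorem toBilin'_mulVec (A V : Matrix (Fin 4) (Fin 4) ℂ) (x y : Fin 4 → ℂ) :
    Matrix.toBilin' A (V *ᵥ x) (V *ᵥ y) = Matrix.toBilin' (Vᵀ * A * V) x y := by
  rw [Matrix.toBilin'_apply', Matrix.toBilin'_apply', ← mulVec_mulVec, ← mulVec_mulVec,
    dotProduct_mulVec x, vecMul_transpose]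

theorem mem_closure_harmonic_pairs {A B : Matrix (Fin 4) (Fin 4) ℂ} (hA : A.IsSymm) (hB : B.IsSymm)
    (h : HasDistinctZeros 4 (pencilPoly A B)) {p₀ q₀ : Fin 4 → ℂ} (hp₀ : p₀ ≠ 0)
    (h₀ : harmonicForm (Matrix.toBilin' A) (Matrix.toBilin' B) p₀ q₀ = 0) :
    (p₀, q₀) ∈ closure {x : (Fin 4 → ℂ) × (Fin 4 → ℂ) |
      harmonicForm (Matrix.toBilin' A) (Matrix.toBilin' B) x.1 x.2 = 0 ∧
      lineDiscr (Matrix.toBilin' A) x.1 x.2 ≠ 0 ∧ lineDiscr (Matrix.toBilin' B) x.1 x.2 ≠ 0} := by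
  obtain ⟨V, a, b, hV, hab, ha0, hb0, hVA, hVB⟩ :=
    exists_diagonalization_of_hasDistinctZeros hA hB h
  have hsurj : ∀ x, V *ᵥ (V⁻¹ *ᵥ x) = x := fun x => by
    rw [mulVec_mulVec, mul_nonsing_inv _ hV, one_mulVec]
  have hharm : ∀ x y, harmonicForm (Matrix.toBilin' A) (Matrix.toBilin' B) (V *ᵥ x) (V *ᵥ y) =
      harmonicForm (Matrix.toBilin' (diagonal a)) (Matrix.toBilin' (diagonal b)) x y := fun x y => by
    simp only [harmonicForm, toBilin'_mulVec, hVA, hVB]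
  have hdA : ∀ x y, lineDiscr (Matrix.toBilin' A) (V *ᵥ x) (V *ᵥ y) =
      lineDiscr (Matrix.toBilin' (diagonal a)) x y := fun x y => by
    simp only [lineDiscr, toBilin'_mulVec, hVA]
  have hdB : ∀ x y, lineDiscr (Matrix.toBilin' B) (V *ᵥ x) (V *ᵥ y) =
      lineDiscr (Matrix.toBilin' (diagonal b)) x y := fun x y => by
    simp only [lineDiscr, toBilin'_mulVec, hVB]
  refine mem_closure_of_exists_generic hA.toBilin'_comm hB.toBilin'_comm (fun p hp => ?_) ?_ hp₀ h₀
  · by_contra! h1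
    refine hp ?_
    rw [← hsurj p, eq_zero_of_harmonicForm_diagonal (x := V⁻¹ *ᵥ p) hab fun y => ?_, mulVec_zero]
    rw [← hharm, hsurj, h1]
  · obtain ⟨p, z, hp, hz⟩ := exists_finite_common_zeros_diagonal hab ha0 hb0
    have hinj : V *ᵥ p ≠ 0 := fun h1 => hp (by
      have : V⁻¹ *ᵥ (V *ᵥ p) = p := by rw [mulVec_mulVec, nonsing_inv_mul _ hV, one_mulVec]
      rw [← this, h1, mulVec_zero])
    refine ⟨V *ᵥ p, fun k => V *ᵥ z k, hinj, fun y hy hD => ?_⟩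
    rw [← hsurj y] at hy hD
    rw [hharm] at hy
    rw [hdA, hdB] at hD
    obtain ⟨k, hk⟩ := hz _ hy hD
    obtain ⟨s, t, hst⟩ := Submodule.mem_span_pair.1 hk
    refine ⟨k, Submodule.mem_span_pair.2 ⟨s, t, ?_⟩⟩
    rw [← hsurj y, ← hst, mulVec_add, mulVec_smul, mulVec_smul]

/-! ### The closure of the set of harmonic lines -/

theorem mk_mem_kleinQuadric_iff {x : Fin 6 → ℂ} (hx : x ≠ 0) :
    Projectivization.mk ℂ x hx ∈ kleinQuadric ↔ kleinForm x x = 0 := by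
  rw [kleinForm_eq]
  constructor
  · intro h
    exact h x (by rw [submodule_mk_eq_span]; exact Submodule.mem_span_singleton_self x)
  · intro h y hy
    rw [submodule_mk_eq_span, Submodule.mem_span_singleton] at hy
    obtain ⟨c, rfl⟩ := hy
    rw [mulVec_smul, smul_dotProduct, dotProduct_smul, h, smul_zero, smul_zero]

theorem mk_mem_battagliniQuadric_iff (A B : Matrix (Fin 4) (Fin 4) ℂ) {x : Fin 6 → ℂ} (hx : x ≠ 0) :
    Projectivization.mk ℂ x hx ∈ battagliniQuadric A B ↔ battagliniForm A B x x = 0 := by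
  constructor
  · intro h
    exact h x (by rw [submodule_mk_eq_span]; exact Submodule.mem_span_singleton_self x)
  · intro h y hy
    rw [submodule_mk_eq_span, Submodule.mem_span_singleton] at hy
    obtain ⟨c, rfl⟩ := hy
    rw [← battagliniMatrix_bilin] at h ⊢
    rw [mulVec_smul, smul_dotProduct, dotProduct_smul, h, smul_zero, smul_zero]

theorem isClosed_inter_quadrics (A B : Matrix (Fin 4) (Fin 4) ℂ) :
    IsClosed (kleinQuadric ∩ battagliniQuadric A B) := by
  rw [isClosed_coinduced]
  have hset : (fun v : {v : Fin 6 → ℂ // v ≠ 0} => Projectivization.mk ℂ v.1 v.2) ⁻¹'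
      (kleinQuadric ∩ battagliniQuadric A B) =
      {v | v.1 ⬝ᵥ kleinMatrix *ᵥ v.1 = 0} ∩ {v | v.1 ⬝ᵥ battagliniMatrix A B *ᵥ v.1 = 0} := by
    ext v
    rw [Set.mem_preimage, Set.mem_inter_iff, mk_mem_kleinQuadric_iff, mk_mem_battagliniQuadric_iff,
      kleinForm_eq, ← battagliniMatrix_bilin]
    rfl
  rw [hset]
  have hcont : ∀ M : Matrix (Fin 6) (Fin 6) ℂ,
      Continuous fun v : {v : Fin 6 → ℂ // v ≠ 0} => v.1 ⬝ᵥ M *ᵥ v.1 := fun M =>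
    continuous_subtype_val.dotProduct (continuous_const.matrix_mulVec continuous_subtype_val)
  exact (isClosed_singleton.preimage (hcont _)).inter (isClosed_singleton.preimage (hcont _))

theorem harmonicLines_subset {A B : Matrix (Fin 4) (Fin 4) ℂ} (hA : A.IsSymm) (hB : B.IsSymm) :
    harmonicLines A B ⊆ kleinQuadric ∩ battagliniQuadric A B := by
  rintro P ⟨p, q, r, s, hsep, hpq, hrs, hP⟩
  induction P using Projectivization.ind with
  | h x hx =>
    rw [submodule_mk_eq_span] at hP
    obtain ⟨c, rfl⟩ := Submodule.mem_span_singleton.1 (hP ▸ Submodule.mem_span_singleton_self x)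
    rw [Set.mem_inter_iff, mk_mem_kleinQuadric_iff, mk_mem_battagliniQuadric_iff]
    constructor
    · simp [kleinForm_plucker]
    · have h1 := battagliniForm_plucker hA hB p q
      rw [harmonicForm_eq_zero_of_harmonicallySeparated hB hsep hpq hrs, neg_zero,
        ← battagliniMatrix_bilin] at h1
      rw [← battagliniMatrix_bilin, mulVec_smul, smul_dotProduct, dotProduct_smul, h1, smul_zero,
        smul_zero]

theorem continuous_plucker : Continuous fun x : (Fin 4 → ℂ) × (Fin 4 → ℂ) => plucker x.1 x.2 := by
  refine continuous_pi fun i => ?_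
  fin_cases i <;> simp [plucker] <;> fun_prop

theorem closure_harmonicLines {A B : Matrix (Fin 4) (Fin 4) ℂ} (hA : A.IsSymm) (hB : B.IsSymm)
    (h : HasDistinctZeros 4 (pencilPoly A B)) :
    closure (harmonicLines A B) = kleinQuadric ∩ battagliniQuadric A B := by
  refine (closure_minimal (harmonicLines_subset hA hB) (isClosed_inter_quadrics A B)).antisymm ?_
  intro P hP
  induction P using Projectivization.ind with
  | h x hx =>
    rw [Set.mem_inter_iff, mk_mem_kleinQuadric_iff, mk_mem_battagliniQuadric_iff] at hP
    obtain ⟨p, q, rfl⟩ := exists_eq_plucker hx hP.1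
    have h0 := hP.2
    rw [battagliniForm_plucker hA hB, neg_eq_zero] at h0
    have hp : p ≠ 0 := by
      rintro rfl
      refine hx ?_
      ext i
      fin_cases i <;> simp [plucker]
    have hcl := mem_closure_harmonic_pairs hA hB h hp h0
    rw [mem_closure_iff] at hcl ⊢
    intro U hU hPU
    have hU' := isOpen_coinduced.1 hU
    obtain ⟨W, hW, hWU⟩ := isOpen_induced_iff.1 hU'
    have hne : IsOpen {v : Fin 6 → ℂ | v ≠ 0} := isOpen_ne
    -- The requirement p' ∧ q' ≠ 0 is open, so it can be imposed along with membership in W.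
    obtain ⟨⟨p', q'⟩, ⟨h1, h2⟩, h3, h4, h5⟩ := hcl _ ((hW.inter hne).preimage continuous_plucker)
      ⟨(Set.ext_iff.1 hWU ⟨_, hx⟩).2 hPU, hx⟩
    exact ⟨Projectivization.mk ℂ _ h2, (Set.ext_iff.1 hWU ⟨_, h2⟩).1 h1,
      mem_harmonicLines hA hB h2 h3 h4 h5⟩

/-- If AB were κ G, the sextic would be a multiple of (κ + t) ^ 6, and all three resolvent roots
would equal κ², contrary to their distinctness. -/
theorem linearIndependent_battagliniMatrix_kleinMatrix {A B : Matrix (Fin 4) (Fin 4) ℂ}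
    (hA : A.IsSymm) (hB : B.IsSymm) (h : HasDistinctZeros 4 (pencilPoly A B)) :
    LinearIndependent ℂ ![battagliniMatrix A B, kleinMatrix] := by
  rw [LinearIndependent.pair_iff]
  intro s t hst
  have hJ : kleinMatrix ≠ 0 := fun h0 => det_kleinMatrix_ne_zero (by rw [h0, det_zero])
  by_cases hs : s = 0
  · rw [hs, zero_smul, zero_add] at hst
    exact ⟨hs, (smul_eq_zero.1 hst).resolve_right hJ⟩
  exfalso
  obtain ⟨κ, hκ⟩ : ∃ κ : ℂ, battagliniMatrix A B = κ • kleinMatrix := by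
    refine ⟨-(t / s), ?_⟩
    have h1 : s • (battagliniMatrix A B + (t / s) • kleinMatrix) = 0 := by
      rw [smul_add, smul_smul, mul_div_cancel₀ _ hs, hst]
    rw [neg_smul, eq_neg_iff_add_eq_zero]
    exact (smul_eq_zero.1 h1).resolve_left hs
  obtain ⟨a, b, hab⟩ := exists_eq_linearProd _ (natDegree_pencilPoly_le A B)
  have hpoly := pencilPoly_battagliniMatrix hA hB hab
  rw [hab, hasDistinctZeros_linearProd_iff (by norm_num)] at h
  have hinj := (pairwiseIndependent_iff_injective_resolventRoots a b).1 h
  have hroot : ∀ k, resolventRoots a b k = κ ^ 2 := fun k => by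
    obtain ⟨τ, hτ⟩ : ∃ τ : ℂ, τ ^ 2 = resolventRoots a b k :=
      IsAlgClosed.exists_pow_nat_eq _ two_pos
    have h1 := congrArg (eval τ) hpoly
    have h2 : ∏ j, (τ ^ 2 - resolventRoots a b j) = 0 :=
      Finset.prod_eq_zero (Finset.mem_univ k) (by rw [hτ, sub_self])
    rw [eval_pencilPoly, hκ, ← add_smul, det_smul, evenSextic, eval_mul, eval_prod] at h1
    simp only [eval_sub, eval_pow, eval_X, eval_C, h2, mul_zero] at h1
    have h3 := (mul_eq_zero.1 h1).resolve_right det_kleinMatrix_ne_zero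
    rw [← hτ, eq_neg_of_add_eq_zero_left (pow_eq_zero_iff (by simp) |>.1 h3), neg_sq]
  exact absurd (hinj ((hroot 0).trans (hroot 1).symm)) (by decide)

theorem mainTheorem4 :
    -- the closure of the set of harmonic lines is the intersection of two distinct quadrics
    (∀ A B : Matrix (Fin 4) (Fin 4) ℂ, A.IsSymm → B.IsSymm →
      HasDistinctZeros 4 (pencilPoly A B) →
        closure (harmonicLines A B) = kleinQuadric ∩ battagliniQuadric A B ∧
        LinearIndependent ℂ ![battagliniMatrix A B, kleinMatrix]) ∧
    -- the curve of the pencil has genus two exactly for general pairs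
    (∀ A B : Matrix (Fin 4) (Fin 4) ℂ, A.IsSymm → B.IsSymm →
      (HasDistinctZeros 6 (pencilPoly (battagliniMatrix A B) kleinMatrix) ↔
        HasDistinctZeros 4 (pencilPoly A B) ∧ (battagliniMatrix A B).det ≠ 0)) ∧
    -- and then it has an extra involution
    (∀ A B : Matrix (Fin 4) (Fin 4) ℂ, IsGeneralPair A B →
      HasExtraInvolutionFixingInfinity (pencilPoly (battagliniMatrix A B) kleinMatrix)) ∧
    -- all such pencils through the Klein quadric arise
    (∀ Q : Matrix (Fin 6) (Fin 6) ℂ, Q.IsSymm →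
      HasDistinctZeros 6 (pencilPoly Q kleinMatrix) →
      (HasExtraInvolutionFixingInfinity (pencilPoly Q kleinMatrix) ↔
        ∃ A B : Matrix (Fin 4) (Fin 4) ℂ, IsGeneralPair A B ∧
          Submodule.span ℂ {Q, kleinMatrix} =
            Submodule.span ℂ {battagliniMatrix A B, kleinMatrix})) ∧
    -- all such pencils arise, up to projective equivalence
    (∀ P Q : Matrix (Fin 6) (Fin 6) ℂ, P.IsSymm → Q.IsSymm →
      HasDistinctZeros 6 (pencilPoly P Q) → HasExtraInvolution (pencilPoly P Q) →
        ∃ A B : Matrix (Fin 4) (Fin 4) ℂ, IsGeneralPair A B ∧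
          ∃ g : Matrix (Fin 6) (Fin 6) ℂ, IsUnit g.det ∧
            Submodule.span ℂ {gᵀ * P * g, gᵀ * Q * g} =
              Submodule.span ℂ {battagliniMatrix A B, kleinMatrix}) ∧
    -- all such curves arise, up to isomorphism
    (∀ f : ℂ[X], HasDistinctZeros 6 f → HasExtraInvolution f →
      ∃ A B : Matrix (Fin 4) (Fin 4) ℂ, IsGeneralPair A B ∧
        Nonempty (CurveField f ≃ₐ[ℂ]
          CurveField (pencilPoly (battagliniMatrix A B) kleinMatrix))) := by
  refine ⟨fun A B hA hB h => ⟨closure_harmonicLines hA hB h,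
    linearIndependent_battagliniMatrix_kleinMatrix hA hB h⟩,
    fun A B hA hB => hasDistinctZeros_battaglini_pencil_iff hA hB, fun A B hAB => ?_,
    fun Q hQ h => ⟨exists_isGeneralPair_span_eq hQ h, ?_⟩,
    fun P Q hP hQ h hex => exists_isGeneralPair_congruent hP hQ h hex,
    fun f h hex => exists_isGeneralPair_curveEquiv h hex⟩
  · exact hasExtraInvolutionFixingInfinity_of_mem_span hAB
      ((hasDistinctZeros_battaglini_pencil_iff hAB.1 hAB.2.1).2 hAB.2.2)
      (Submodule.subset_span (by simp))
  · rintro ⟨A, B, hAB, hspan⟩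
    exact hasExtraInvolutionFixingInfinity_of_mem_span hAB h
      (hspan ▸ Submodule.subset_span (by simp))
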